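/- Let $M$ be a connected complex manifold of dimension $n\ge 2$, let $a_{i\bar j}(z)$ be a smooth Hermitian metric on $M$ and let $\beta=b_i(z)\eta^i$ be a smooth differential $(1,0)$-form on $M$ which does not vanish identically on any non-empty open subset of $M$. On the holomorphic tangent bundle $T'M$, with local coordinates $(z^k,\eta^k)$, put $\alpha=\sqrt{a_{i\bar j}\eta^i\bar\eta^j}$ and let $\tilde F=\alpha+|\beta|$ be the associated complex Randers metric. All conditions that involve $\tilde F$ are understood on the open set $\{\beta\neq 0\}\subset T'M$, where $\tilde F^2$ is smooth. For a metric $F$ with $L=F^2$, write $g_{i\bar j}=\partial^2L/\partial\eta^i\partial\bar\eta^j$, $N^i_j=g^{\bar m i}\frac{\partial g_{l\bar m}}{\partial z^j}\eta^l$, $G^i=\frac12N^i_j\eta^j$ (the spray coefficients), $\delta_k=\frac{\partial}{\partial z^k}-N^j_k\frac{\partial}{\partial\eta^j}$, $L^i_{jk}=g^{\bar l i}\delta_kg_{j\bar l}$, $T^i_{jk}=L^i_{jk}-L^i_{kj}$ and $\theta^{*k}=g^{\bar m k}g_{i\bar p}\,\overline{T^p_{jm}}\,\eta^i\bar\eta^j$.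 The metric is *Kähler* if $T^i_{jk}\eta^j=0$, *generalized Berwald* if $\partial G^i/\partial\bar\eta^h=0$, and *complex Berwald* if it is both. A *complex geodesic* of $F$ is a curve $z(s)$ with $s$ in an open interval, satisfying $\frac{d^2z^i}{ds^2}+2G^i(z,\frac{dz}{ds})=\theta^{*i}(z,\frac{dz}{ds})$ in local coordinates. The metrics $\alpha$ and $\tilde F$ are *projectively related* if they have the same complex geodesics with velocities in $\{\beta\ne0\}$ as point sets, i.e. every such complex geodesic of one of them becomes a complex geodesic of the other after a change of parameter $\tilde s=\tilde s(s)$ with $d\tilde s/ds>0$. Let $\overset{a}{G}{}^i,\theta^{*i}$ belong to $\alpha$ and $\tilde G^i,\tilde\theta^{*i}$ to $\tilde F$; let $B^i=\frac12(\tilde\theta^{*i}-\theta^{*i})$ and $$\Gamma^k_{i\bar j}=\tfrac12a^{\bar m k}\Big(\frac{\partial a_{i\bar m}}{\partial\bar z^j}-\frac{\partial a_{i\bar j}}{\partial\bar z^m}\Big),\qquad P=-\frac{\bar\beta}{2\tilde F|\beta|}\,\Gamma^k_{i\bar j}\,b_k\,\eta^i\bar\eta^j .$$ **Theorem.** (i)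 $\alpha$ and $\tilde F$ are projectively related if and only if $\tilde F$ is generalized Berwald and $B^i=-P\eta^i$ for all $i=1,\dots,n$. (ii) $\alpha$ is Kähler and projectively related to $\tilde F$ if and only if $\tilde F$ is complex Berwald. In both cases (that is, whenever the equivalent conditions of (i), or those of (ii), hold), $\tilde G^i=\overset{a}{G}{}^i$ for all $i$ on $\{\beta\neq0\}$. -/

import Mathlib

open scoped Manifold ContDiff Topology

noncomputable section

namespace CFinsler

/-! ## Wirtinger derivatives -/

/-- The Wirtinger derivative of `f` at `p` in the complex direction `v`:
`(1/2) (∂_v f - i ∂_{iv} f)`. -/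
def wirt {V : Type*} [NormedAddCommGroup V] [NormedSpace ℝ V] [Module ℂ V]
    (v : V) (f : V → ℂ) (p : V) : ℂ :=
  (1 / 2) * (fderiv ℝ f p v - Complex.I * fderiv ℝ f p (Complex.I • v))

/-- The conjugate Wirtinger derivative of `f` at `p` in the complex direction `v`:
`(1/2) (∂_v f + i ∂_{iv} f)`. -/
def wirtBar {V : Type*} [NormedAddCommGroup V] [NormedSpace ℝ V] [Module ℂ V]
    (v : V) (f : V → ℂ) (p : V) : ℂ :=
  (1 / 2) * (fderiv ℝ f p v + Complex.I * fderiv ℝ f p (Complex.I • v))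

/-! ## Local complex Finsler geometry

A point of `(Fin n → ℂ) × (Fin n → ℂ)` is `(z, η)`: the coordinates of a point and the components
of a `(1,0)`-vector at that point. -/

/-- The space of local coordinates `(z, η)` on the holomorphic tangent bundle. -/
abbrev Coord (n : ℕ) : Type := (Fin n → ℂ) × (Fin n → ℂ)

variable {n : ℕ}

/-- `∂f/∂z^k`. -/
def dz (k : Fin n) (f : Coord n → ℂ) : Coord n → ℂ := wirt (Pi.single k 1, 0) f

/-- `∂f/∂η^k`. -/
def dEta (k : Fin n) (f : Coord n → ℂ) : Coord n → ℂ := wirt (0, Pi.single k 1) f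

/-- `∂f/∂η̄^k`. -/
def dEtaBar (k : Fin n) (f : Coord n → ℂ) : Coord n → ℂ := wirtBar (0, Pi.single k 1) f

/-- The fundamental tensor `g_{i j̄} = ∂²L/∂η^i∂η̄^j`. -/
def fundTensor (L : Coord n → ℂ) (i j : Fin n) : Coord n → ℂ := dEta i (dEtaBar j L)

/-- `g^{m̄ i}`, the `(m, i)` entry of the inverse of the matrix `(g_{i j̄})`, so that
`∑ m, g_{l m̄} g^{m̄ i} = δ_l^i`. -/
def fundInv (L : Coord n → ℂ) (m i : Fin n) (p : Coord n) : ℂ :=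
  (Matrix.of fun a b => fundTensor L a b p)⁻¹ m i

/-- The Chern-Finsler nonlinear connection `N^i_j = g^{m̄ i} (∂g_{l m̄}/∂z^j) η^l`. -/
def nonlinConn (L : Coord n → ℂ) (i j : Fin n) (p : Coord n) : ℂ :=
  ∑ m, ∑ l, fundInv L m i p * dz j (fundTensor L l m) p * p.2 l

/-- The spray coefficients `G^i = (1/2) N^i_j η^j`. -/
def spray (L : Coord n → ℂ) (i : Fin n) (p : Coord n) : ℂ :=
  (1 / 2) * ∑ j, nonlinConn L i j p * p.2 j

/-- The horizontal derivative `δ_k f = ∂f/∂z^k - N^j_k ∂f/∂η^j`. -/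
def horDeriv (L : Coord n → ℂ) (k : Fin n) (f : Coord n → ℂ) (p : Coord n) : ℂ :=
  dz k f p - ∑ j, nonlinConn L j k p * dEta j f p

/-- The horizontal Chern-Finsler coefficients `L^i_{jk} = g^{l̄ i} δ_k g_{j l̄}`. -/
def horCoeff (L : Coord n → ℂ) (i j k : Fin n) (p : Coord n) : ℂ :=
  ∑ l, fundInv L l i p * horDeriv L k (fundTensor L j l) p

/-- The horizontal torsion `T^i_{jk} = L^i_{jk} - L^i_{kj}`. -/
def torsion (L : Coord n → ℂ) (i j k : Fin n) (p : Coord n) : ℂ :=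
  horCoeff L i j k p - horCoeff L i k j p

/-- The functions `θ^{*k} = g^{m̄ k} g_{i p̄} (L^{p̄}_{j̄ m̄} - L^{p̄}_{m̄ j̄}) η^i η̄^j`,
where `L^{p̄}_{j̄ m̄}` is the complex conjugate of `L^p_{jm}`. -/
def thetaStar (L : Coord n → ℂ) (k : Fin n) (q : Coord n) : ℂ :=
  ∑ m, ∑ i, ∑ p, ∑ j,
    fundInv L m k q * fundTensor L i p q * star (torsion L p j m q) * q.2 i * star (q.2 j)

/-! ## Finsler functions on a complex manifold -/

variable {M : Type*} [TopologicalSpace M] [ChartedSpace (Fin n → ℂ) M]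

/-- The holomorphic tangent bundle `T'M` of a complex manifold of dimension `n`, identified as
usual with the tangent bundle of `M` over `ℂ`. -/
abbrev HolTangent (n : ℕ) (M : Type*) [TopologicalSpace M] [ChartedSpace (Fin n → ℂ) M] :
    Type _ := TangentBundle 𝓘(ℂ, Fin n → ℂ) M

/-- The holomorphic charts of `M`. -/
abbrev holCharts (n : ℕ) (M : Type*) [TopologicalSpace M] [ChartedSpace (Fin n → ℂ) M] :
    Set (OpenPartialHomeomorph M (Fin n → ℂ)) :=
  IsManifold.maximalAtlas 𝓘(ℂ, Fin n → ℂ) ω M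

/-- The tangent vector `η^k ∂/∂z^k` at the point of `M` with coordinates `z` in the chart `e`. -/
def tangentVec (e : OpenPartialHomeomorph M (Fin n → ℂ)) (z η : Fin n → ℂ) :
    TangentSpace 𝓘(ℂ, Fin n → ℂ) (e.symm z) :=
  mfderiv 𝓘(ℂ, Fin n → ℂ) 𝓘(ℂ, Fin n → ℂ) e.symm z η

/-- The point of `T'M` with local coordinates `(z, η)` in the chart `e`. -/
def tangentPt (e : OpenPartialHomeomorph M (Fin n → ℂ)) (p : Coord n) : HolTangent n M :=
  ⟨e.symm p.1, tangentVec e p.1 p.2⟩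

/-- The function `L = F²` in the local coordinates of the chart `e`. -/
def localL (F : HolTangent n M → ℝ) (e : OpenPartialHomeomorph M (Fin n → ℂ))
    (p : Coord n) : ℂ :=
  ((F (tangentPt e p) ^ 2 : ℝ) : ℂ)

/-- The local coordinates, in the chart `e`, of the points of a subset `R` of `T'M`. -/
def localDom (R : Set (HolTangent n M)) (e : OpenPartialHomeomorph M (Fin n → ℂ)) :
    Set (Coord n) :=
  {p | p.1 ∈ e.target ∧ tangentPt e p ∈ R}

/-- The metric `F` is Kähler over `R`: `T^i_{jk} η^j = 0`. -/
def IsKahler (F : HolTangent n M → ℝ) (R : Set (HolTangent n M)) : Prop :=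
  ∀ e ∈ holCharts n M, ∀ p ∈ localDom R e, ∀ i k : Fin n,
    ∑ j, torsion (localL F e) i j k p * p.2 j = 0

/-- The metric `F` is generalized Berwald over `R`: `∂G^i/∂η̄^h = 0`. -/
def IsGeneralizedBerwald (F : HolTangent n M → ℝ) (R : Set (HolTangent n M)) : Prop :=
  ∀ e ∈ holCharts n M, ∀ p ∈ localDom R e, ∀ i h : Fin n,
    dEtaBar h (spray (localL F e) i) p = 0

/-- The metric `F` is complex Berwald over `R`: Kähler and generalized Berwald. -/
def IsComplexBerwald (F : HolTangent n M → ℝ) (R : Set (HolTangent n M)) : Prop :=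
  IsKahler F R ∧ IsGeneralizedBerwald F R

/-- `γ`, restricted to `J`, is a complex geodesic of `F` with velocities in `R`: it is `C²` and
satisfies `d²z^i/ds² + 2 G^i(z, dz/ds) = θ^{*i}(z, dz/ds)` in every holomorphic chart. -/
structure IsComplexGeodesicOn (F : HolTangent n M → ℝ) (R : Set (HolTangent n M))
    (γ : ℝ → M) (J : Set ℝ) : Prop where
  continuousOn : ContinuousOn γ J
  contDiffAt : ∀ e ∈ holCharts n M, ∀ s ∈ J, γ s ∈ e.source →
    ContDiffAt ℝ 2 (fun t => e (γ t)) s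
  velocity_mem : ∀ e ∈ holCharts n M, ∀ s ∈ J, γ s ∈ e.source →
    (e (γ s), deriv (fun t => e (γ t)) s) ∈ localDom R e
  equation : ∀ e ∈ holCharts n M, ∀ s ∈ J, γ s ∈ e.source → ∀ i : Fin n,
    deriv (deriv fun t => e (γ t)) s i
        + 2 * spray (localL F e) i (e (γ s), deriv (fun t => e (γ t)) s)
      = thetaStar (localL F e) i (e (γ s), deriv (fun t => e (γ t)) s)

/-- Every complex geodesic of `F₁` (over an open interval, with velocities in `R`) becomes a complex
geodesic of `F₂` after a change of parameter `φ` with `φ' > 0`. -/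
def GeodesicsReparam (F₁ F₂ : HolTangent n M → ℝ) (R : Set (HolTangent n M)) : Prop :=
  ∀ (γ : ℝ → M) (J : Set ℝ), IsOpen J → J.OrdConnected → IsComplexGeodesicOn F₁ R γ J →
    ∃ (φ : ℝ → ℝ) (γ' : ℝ → M),
      (∀ s ∈ J, ContDiffAt ℝ 2 φ s ∧ 0 < deriv φ s) ∧
      (∀ s ∈ J, γ' (φ s) = γ s) ∧
      IsComplexGeodesicOn F₂ R γ' (φ '' J)

/-- `F₁` and `F₂` are projectively related over `R`: they have the same complex geodesics as point
sets, i.e. up to changes of parameter with positive derivative. -/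
def ProjectivelyRelated (F₁ F₂ : HolTangent n M → ℝ) (R : Set (HolTangent n M)) : Prop :=
  GeodesicsReparam F₁ F₂ R ∧ GeodesicsReparam F₂ F₁ R

/-! ## Complex Randers metrics -/

/-- A smooth Hermitian metric on the complex manifold `M`. -/
structure HermitianMetric (n : ℕ) (M : Type*) [TopologicalSpace M]
    [ChartedSpace (Fin n → ℂ) M] where
  form : ∀ x : M, TangentSpace 𝓘(ℂ, Fin n → ℂ) x →ₗ[ℂ]
    TangentSpace 𝓘(ℂ, Fin n → ℂ) x →ₗ⋆[ℂ] ℂ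
  conj_symm : ∀ x v w, star (form x v w) = form x w v
  pos : ∀ x v, v ≠ 0 → 0 < (form x v v).re
  smooth : ∀ e ∈ holCharts n M, ∀ i j : Fin n,
    ContDiffOn ℝ ∞ (fun z : Fin n → ℂ =>
      form (e.symm z) (tangentVec e z (Pi.single i 1)) (tangentVec e z (Pi.single j 1))) e.target

/-- A smooth (not necessarily holomorphic) differential `(1,0)`-form on `M`. -/
structure OneZeroForm (n : ℕ) (M : Type*) [TopologicalSpace M]
    [ChartedSpace (Fin n → ℂ) M] where
  form : ∀ x : M, TangentSpace 𝓘(ℂ, Fin n → ℂ) x →ₗ[ℂ] ℂ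
  smooth : ∀ e ∈ holCharts n M, ∀ i : Fin n,
    ContDiffOn ℝ ∞ (fun z : Fin n → ℂ =>
      form (e.symm z) (tangentVec e z (Pi.single i 1))) e.target

/-- The components `a_{i j̄}(z)` of a Hermitian metric in the chart `e`. -/
def HermitianMetric.coeff (a : HermitianMetric n M) (e : OpenPartialHomeomorph M (Fin n → ℂ))
    (i j : Fin n) (z : Fin n → ℂ) : ℂ :=
  a.form (e.symm z) (tangentVec e z (Pi.single i 1)) (tangentVec e z (Pi.single j 1))

/-- The components `b_i(z)` of a `(1,0)`-form in the chart `e`. -/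
def OneZeroForm.coeff (b : OneZeroForm n M) (e : OpenPartialHomeomorph M (Fin n → ℂ))
    (i : Fin n) (z : Fin n → ℂ) : ℂ :=
  b.form (e.symm z) (tangentVec e z (Pi.single i 1))

/-- The purely Hermitian metric `α = √(a_{i j̄} η^i η̄^j)`. -/
def HermitianMetric.alpha (a : HermitianMetric n M) (u : HolTangent n M) : ℝ :=
  √((a.form u.1 u.2 u.2).re)

/-- The function `β = b_i η^i` on `T'M`. -/
def OneZeroForm.beta (b : OneZeroForm n M) (u : HolTangent n M) : ℂ := b.form u.1 u.2

/-- The complex Randers metric `α + |β|`. -/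
def randers (a : HermitianMetric n M) (b : OneZeroForm n M) (u : HolTangent n M) : ℝ :=
  a.alpha u + ‖b.beta u‖

/-- `T'M` without its zero section, where `α²` is a regular metric. -/
def slitBundle (n : ℕ) (M : Type*) [TopologicalSpace M] [ChartedSpace (Fin n → ℂ) M] :
    Set (HolTangent n M) := {u | u.2 ≠ 0}

/-- The part `β ≠ 0` of `T'M`, where `(α + |β|)²` is smooth. -/
def OneZeroForm.regularDom (b : OneZeroForm n M) : Set (HolTangent n M) := {u | b.beta u ≠ 0}

/-- `Γ^k_{i j̄} = (1/2) a^{m̄ k} (∂a_{i m̄}/∂z̄^j - ∂a_{i j̄}/∂z̄^m)`. -/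
def HermitianMetric.gamma (a : HermitianMetric n M) (e : OpenPartialHomeomorph M (Fin n → ℂ))
    (k i j : Fin n) (z : Fin n → ℂ) : ℂ :=
  (1 / 2) * ∑ m, (Matrix.of fun r s => a.coeff e r s z)⁻¹ m k *
    (wirtBar (Pi.single j 1) (a.coeff e i m) z - wirtBar (Pi.single m 1) (a.coeff e i j) z)

/-- `P = -(β̄ / (2 F̃ |β|)) Γ^k_{i j̄} b_k η^i η̄^j` for `F̃ = α + |β|`, in the chart `e`. -/
def randersP (a : HermitianMetric n M) (b : OneZeroForm n M)
    (e : OpenPartialHomeomorph M (Fin n → ℂ)) (p : Coord n) : ℂ :=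
  -(star (b.beta (tangentPt e p)) /
      (2 * (randers a b (tangentPt e p) : ℂ) * (‖b.beta (tangentPt e p)‖ : ℂ))) *
    ∑ k, ∑ i, ∑ j, a.gamma e k i j p.1 * b.coeff e k p.1 * p.2 i * star (p.2 j)

/-- `B^i = (1/2) (θ̃^{*i} - θ^{*i})`, with `θ^{*i}` of the metric `F` and `θ̃^{*i}` of `F'`. -/
def thetaDiff (F F' : HolTangent n M → ℝ) (e : OpenPartialHomeomorph M (Fin n → ℂ))
    (i : Fin n) (p : Coord n) : ℂ :=
  (1 / 2) * (thetaStar (localL F' e) i p - thetaStar (localL F e) i p)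

/-- The spray coefficients of `F` and `F'` agree over `R`. -/
def SameSpray (F F' : HolTangent n M → ℝ) (R : Set (HolTangent n M)) : Prop :=
  ∀ e ∈ holCharts n M, ∀ p ∈ localDom R e, ∀ i : Fin n,
    spray (localL F' e) i p = spray (localL F e) i p

end CFinsler

end

noncomputable section

namespace CFinsler

/-! ## Wirtinger calculus -/

/-! The argument is local and fibrewise. The spray of a metric with L = F² is handled through its
field X = η^j ∂/∂z^j − 2G^i ∂/∂η^i. Euler's relations turn the definition of G into X(∂L/∂η̄^m) = 0,
which determines G since the fundamental tensor is nondegenerate, and they give X L = 0. With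
lowered indices, the Kähler tensor and θ* become simple expressions in X (`lower_torsion`,
`lower_thetaStar`).

The engine is an irrationality statement, `eq_zero_of_abs_mul_eq`. If |β| A_m η̄^m = α C_m η̄^m on β
≠ 0 with A_m, C_m holomorphic in η, then all A_m and C_m vanish. Since n ≥ 2, the kernel of b
contains some v ≠ 0; the operator ∂̄_v annihilates |β| but not α, and three applications of it force
the coefficients to vanish. Hence a field with fibrewise holomorphic components that annihilates F̃²
also annihilates the covector a_{i m̄} η^i (`wirt_low_eq_zero`). For F̃ generalized Berwald this
applies to its spray field and gives G̃ = G. Conversely G is a quadratic polynomial in η, so G̃ = G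
makes F̃ generalized Berwald.

If the geodesics of α are geodesics of F̃ up to parameter, the two geodesic equations differ by a
real multiple of η at every velocity with β ≠ 0. Comparing η with iη, where G has bidegree (2,0) and
θ* bidegree (1,1), separates this into 2(G̃ − G) = dη and θ̃* − θ* = −d̄η (`exists_factor`).
Orthogonality of θ* to the velocity expresses d through b_k θ^{*k}, and X(∂F̃/∂η̄^m) gives a second
equation for d. Eliminating d leaves another relation of the irrational type, whence b_k θ^{*k} = 0
and d = 0 (`eq_of_projective`). So projectively related metrics have equal sprays and equal θ*. The
condition B^i = −Pη^i says the same about θ*: by orthogonality it forces P = 0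
(`thetaStar_eq_of_diff`). This is (i).

For (ii), a Kähler metric has θ* = 0, and a generalized Berwald metric with θ* = 0 is Kähler
(`kahler_of_thetaStar_eq_zero`); this transfers the Kähler property from α to F̃. Conversely, for F̃
complex Berwald, the fields ∂/∂z^k − (∂G^i/∂η^k) ∂/∂η^i annihilate F̃², hence preserve a_{i m̄} η^i,
so the torsion of α vanishes where b ≠ 0 (`torsion_A_eq_zero`) and then everywhere by density.

Using the geodesics of α requires their existence through every point and their independence of the
chart. The former is Picard–Lindelöf; the latter follows by rewriting the equation as the
Euler–Lagrange equation of α². -/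

theorem fderiv_star_apply {V : Type*} [NormedAddCommGroup V] [NormedSpace ℝ V]
    (f : V → ℂ) (p v : V) :
    fderiv ℝ (fun q => star (f q)) p v = star (fderiv ℝ f p v) := by
  have := (Complex.conjCLE).comp_fderiv (f := f) (x := p)
  have h2 := DFunLike.congr_fun this v
  simpa [Function.comp_def] using h2

theorem fderiv_fderiv_comm {V : Type*} [NormedAddCommGroup V] [NormedSpace ℝ V]
    {f : V → ℂ} {p : V} (hf : ContDiffAt ℝ ∞ f p) (v w : V) :
    fderiv ℝ (fun q => fderiv ℝ f q v) p w = fderiv ℝ (fun q => fderiv ℝ f q w) p v := by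
  have h : ContDiffAt ℝ ∞ (fderiv ℝ f) p := hf.fderiv_right (by simp)
  have hd : DifferentiableAt ℝ (fderiv ℝ f) p := h.differentiableAt (by simp)
  have hs : IsSymmSndFDerivAt ℝ f p := hf.isSymmSndFDerivAt (by simpa using ENat.LEInfty.out)
  rw [fderiv_clm_apply hd (by fun_prop), fderiv_clm_apply hd (by fun_prop)]
  simpa using (hs v w).symm

section Wirtinger

variable {V : Type*} [NormedAddCommGroup V] [NormedSpace ℝ V] [Module ℂ V]

theorem wirt_congr {f g : V → ℂ} {p : V} (h : f =ᶠ[𝓝 p] g) (v : V) : wirt v f p = wirt v g p := by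
  simp only [wirt, h.fderiv_eq]

theorem wirtBar_congr {f g : V → ℂ} {p : V} (h : f =ᶠ[𝓝 p] g) (v : V) :
    wirtBar v f p = wirtBar v g p := by
  simp only [wirtBar, h.fderiv_eq]

@[simp] theorem wirt_const (c : ℂ) (v p : V) : wirt v (fun _ => c) p = 0 := by simp [wirt]

@[simp] theorem wirtBar_const (c : ℂ) (v p : V) : wirtBar v (fun _ => c) p = 0 := by simp [wirtBar]

theorem wirt_eq_zero_of_eventually {f : V → ℂ} {p : V} (h : ∀ᶠ q in 𝓝 p, f q = 0) (v : V) :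
    wirt v f p = 0 := by
  rw [wirt_congr (g := fun _ => 0) h, wirt_const]

theorem wirt_add {f g : V → ℂ} {p : V} (hf : DifferentiableAt ℝ f p) (hg : DifferentiableAt ℝ g p)
    (v : V) : wirt v (fun q => f q + g q) p = wirt v f p + wirt v g p := by
  simp only [wirt, fderiv_fun_add hf hg, add_apply]; ring

theorem wirtBar_add {f g : V → ℂ} {p : V} (hf : DifferentiableAt ℝ f p)
    (hg : DifferentiableAt ℝ g p) (v : V) :
    wirtBar v (fun q => f q + g q) p = wirtBar v f p + wirtBar v g p := by
  simp only [wirtBar, fderiv_fun_add hf hg, add_apply]; ring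

theorem wirt_sub {f g : V → ℂ} {p : V} (hf : DifferentiableAt ℝ f p) (hg : DifferentiableAt ℝ g p)
    (v : V) : wirt v (fun q => f q - g q) p = wirt v f p - wirt v g p := by
  simp only [wirt, fderiv_fun_sub hf hg, sub_apply]; ring

theorem wirtBar_sub {f g : V → ℂ} {p : V} (hf : DifferentiableAt ℝ f p)
    (hg : DifferentiableAt ℝ g p) (v : V) :
    wirtBar v (fun q => f q - g q) p = wirtBar v f p - wirtBar v g p := by
  simp only [wirtBar, fderiv_fun_sub hf hg, sub_apply]; ring

theorem wirt_mul {f g : V → ℂ} {p : V} (hf : DifferentiableAt ℝ f p) (hg : DifferentiableAt ℝ g p)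
    (v : V) : wirt v (fun q => f q * g q) p = wirt v f p * g p + f p * wirt v g p := by
  simp only [wirt, fderiv_fun_mul hf hg, add_apply, smul_apply, smul_eq_mul]; ring

theorem wirtBar_mul {f g : V → ℂ} {p : V} (hf : DifferentiableAt ℝ f p)
    (hg : DifferentiableAt ℝ g p) (v : V) :
    wirtBar v (fun q => f q * g q) p = wirtBar v f p * g p + f p * wirtBar v g p := by
  simp only [wirtBar, fderiv_fun_mul hf hg, add_apply, smul_apply, smul_eq_mul]; ring

theorem wirt_const_mul {f : V → ℂ} {p : V} (hf : DifferentiableAt ℝ f p) (c : ℂ) (v : V) :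
    wirt v (fun q => c * f q) p = c * wirt v f p := by
  rw [wirt_mul (by fun_prop) hf]; simp

theorem wirtBar_const_mul {f : V → ℂ} {p : V} (hf : DifferentiableAt ℝ f p) (c : ℂ) (v : V) :
    wirtBar v (fun q => c * f q) p = c * wirtBar v f p := by
  rw [wirtBar_mul (by fun_prop) hf]; simp

theorem wirt_sum {ι : Type*} (s : Finset ι) {f : ι → V → ℂ} {p : V}
    (hf : ∀ i ∈ s, DifferentiableAt ℝ (f i) p) (v : V) :
    wirt v (fun q => ∑ i ∈ s, f i q) p = ∑ i ∈ s, wirt v (f i) p := by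
  simp only [wirt, fderiv_fun_sum hf, sum_apply, Finset.mul_sum, ← Finset.sum_sub_distrib]

theorem wirtBar_sum {ι : Type*} (s : Finset ι) {f : ι → V → ℂ} {p : V}
    (hf : ∀ i ∈ s, DifferentiableAt ℝ (f i) p) (v : V) :
    wirtBar v (fun q => ∑ i ∈ s, f i q) p = ∑ i ∈ s, wirtBar v (f i) p := by
  simp only [wirtBar, fderiv_fun_sum hf, sum_apply, Finset.mul_sum, ← Finset.sum_add_distrib]

theorem wirt_star (f : V → ℂ) (p v : V) :
    wirt v (fun q => star (f q)) p = star (wirtBar v f p) := by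
  simp only [wirt, wirtBar, fderiv_star_apply, star_mul', star_add]
  simp [sub_eq_add_neg]

theorem wirtBar_star (f : V → ℂ) (p v : V) :
    wirtBar v (fun q => star (f q)) p = star (wirt v f p) := by
  simp only [wirt, wirtBar, fderiv_star_apply, star_mul', star_sub]
  simp

theorem wirtBar_eq_star_wirt {f : V → ℂ} (hf : ∀ q, star (f q) = f q) (p v : V) :
    wirtBar v f p = star (wirt v f p) := by
  rw [← wirtBar_star]; simp only [hf]

theorem wirt_eq_star_wirtBar {f : V → ℂ} (hf : ∀ q, star (f q) = f q) (p v : V) :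
    wirt v f p = star (wirtBar v f p) := by
  rw [← wirt_star]; simp only [hf]

theorem wirt_add_left (v w : V) (f : V → ℂ) (p : V) :
    wirt (v + w) f p = wirt v f p + wirt w f p := by
  simp only [wirt, smul_add, map_add]; ring

theorem wirtBar_add_left (v w : V) (f : V → ℂ) (p : V) :
    wirtBar (v + w) f p = wirtBar v f p + wirtBar w f p := by
  simp only [wirtBar, smul_add, map_add]; ring

theorem wirt_zero_left (f : V → ℂ) (p : V) : wirt 0 f p = 0 := by simp [wirt]

theorem wirtBar_zero_left (f : V → ℂ) (p : V) : wirtBar 0 f p = 0 := by simp [wirtBar]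

theorem fderiv_eq_wirt_add_wirtBar (f : V → ℂ) (p v : V) :
    fderiv ℝ f p v = wirt v f p + wirtBar v f p := by
  simp only [wirt, wirtBar]; ring

theorem wirt_sum_left {ι : Type*} (s : Finset ι) (v : ι → V) (f : V → ℂ) (p : V) :
    wirt (∑ i ∈ s, v i) f p = ∑ i ∈ s, wirt (v i) f p := by
  classical
  induction s using Finset.induction_on with
  | empty => simp [wirt_zero_left]
  | insert i s hi ih => rw [Finset.sum_insert hi, Finset.sum_insert hi, wirt_add_left, ih]

theorem wirtBar_sum_left {ι : Type*} (s : Finset ι) (v : ι → V) (f : V → ℂ) (p : V) :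
    wirtBar (∑ i ∈ s, v i) f p = ∑ i ∈ s, wirtBar (v i) f p := by
  classical
  induction s using Finset.induction_on with
  | empty => simp [wirtBar_zero_left]
  | insert i s hi ih => rw [Finset.sum_insert hi, Finset.sum_insert hi, wirtBar_add_left, ih]

section Tower

variable [IsScalarTower ℝ ℂ V]

theorem complex_smul_eq (c : ℂ) (v : V) : c • v = c.re • v + c.im • (Complex.I • v) := by
  rw [← smul_assoc, ← IsScalarTower.algebraMap_smul ℂ c.re v, ← add_smul]
  congr 1
  simp [Complex.re_add_im]

theorem wirt_smul_left (c : ℂ) (v : V) (f : V → ℂ) (p : V) :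
    wirt (c • v) f p = c * wirt v f p := by
  have h : Complex.I • c • v = (-c.im) • v + c.re • (Complex.I • v) := by
    rw [smul_smul, complex_smul_eq]; simp
  simp only [wirt, h]
  rw [complex_smul_eq c v]
  simp only [map_add, map_smul, Complex.real_smul]
  nth_rewrite 5 [← Complex.re_add_im c]
  push_cast
  linear_combination ((1/2) * c.im * fderiv ℝ f p (Complex.I • v)) * Complex.I_sq

theorem wirtBar_smul_left (c : ℂ) (v : V) (f : V → ℂ) (p : V) :
    wirtBar (c • v) f p = star c * wirtBar v f p := by
  have h : star (wirt (c • v) (fun q => star (f q)) p) =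
      star (c * wirt v (fun q => star (f q)) p) := by rw [wirt_smul_left]
  rw [star_mul', ← wirtBar_star, ← wirtBar_star] at h
  simpa using h

end Tower

theorem contDiffAt_wirt {f : V → ℂ} {p : V} (hf : ContDiffAt ℝ ∞ f p) (v : V) :
    ContDiffAt ℝ ∞ (fun q => wirt v f q) p := by
  have h : ContDiffAt ℝ ∞ (fderiv ℝ f) p := hf.fderiv_right (by simp)
  unfold wirt
  fun_prop

theorem contDiffAt_wirtBar {f : V → ℂ} {p : V} (hf : ContDiffAt ℝ ∞ f p) (v : V) :
    ContDiffAt ℝ ∞ (fun q => wirtBar v f q) p := by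
  have h : ContDiffAt ℝ ∞ (fderiv ℝ f) p := hf.fderiv_right (by simp)
  unfold wirtBar
  fun_prop

theorem wirt_fderiv {f : V → ℂ} {p : V} (hf : ContDiffAt ℝ ∞ f p) (v w : V) :
    fderiv ℝ (fun q => wirt v f q) p w = wirt v (fun q => fderiv ℝ f q w) p := by
  have h : ContDiffAt ℝ ∞ (fderiv ℝ f) p := hf.fderiv_right (by simp)
  have hd : DifferentiableAt ℝ (fderiv ℝ f) p := h.differentiableAt (by simp)
  simp only [wirt]
  rw [fderiv_const_mul (by fun_prop), fderiv_fun_sub (by fun_prop) (by fun_prop),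
    fderiv_const_mul (by fun_prop)]
  simp only [smul_apply, sub_apply, smul_eq_mul, fderiv_fderiv_comm hf _ w]

theorem wirtBar_fderiv {f : V → ℂ} {p : V} (hf : ContDiffAt ℝ ∞ f p) (v w : V) :
    fderiv ℝ (fun q => wirtBar v f q) p w = wirtBar v (fun q => fderiv ℝ f q w) p := by
  have h : ContDiffAt ℝ ∞ (fderiv ℝ f) p := hf.fderiv_right (by simp)
  have hd : DifferentiableAt ℝ (fderiv ℝ f) p := h.differentiableAt (by simp)
  simp only [wirtBar]
  rw [fderiv_const_mul (by fun_prop), fderiv_fun_add (by fun_prop) (by fun_prop),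
    fderiv_const_mul (by fun_prop)]
  simp only [smul_apply, add_apply, smul_eq_mul, fderiv_fderiv_comm hf _ w]

theorem wirt_comm {f : V → ℂ} {p : V} (hf : ContDiffAt ℝ ∞ f p) (v w : V) :
    wirt v (fun q => wirt w f q) p = wirt w (fun q => wirt v f q) p := by
  have h : ContDiffAt ℝ ∞ (fderiv ℝ f) p := hf.fderiv_right (by simp)
  have hd : DifferentiableAt ℝ (fderiv ℝ f) p := h.differentiableAt (by simp)
  rw [wirt, wirt_fderiv hf, wirt_fderiv hf]
  conv_rhs => enter [2]; ext q; rw [wirt]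
  rw [wirt_const_mul (by fun_prop), wirt_sub (by fun_prop) (by fun_prop),
    wirt_const_mul (by fun_prop)]

theorem wirt_wirtBar_comm {f : V → ℂ} {p : V} (hf : ContDiffAt ℝ ∞ f p) (v w : V) :
    wirt v (fun q => wirtBar w f q) p = wirtBar w (fun q => wirt v f q) p := by
  have h : ContDiffAt ℝ ∞ (fderiv ℝ f) p := hf.fderiv_right (by simp)
  have hd : DifferentiableAt ℝ (fderiv ℝ f) p := h.differentiableAt (by simp)
  rw [wirt, wirtBar_fderiv hf, wirtBar_fderiv hf]
  conv_rhs => enter [2]; ext q; rw [wirt]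
  rw [wirtBar_const_mul (by fun_prop), wirtBar_sub (by fun_prop) (by fun_prop),
    wirtBar_const_mul (by fun_prop)]

end Wirtinger

/-! ### Holomorphic functions and the chain rule along holomorphic maps. -/

section Holomorphic

variable {V : Type*} [NormedAddCommGroup V] [NormedSpace ℝ V] [NormedSpace ℂ V]
  [IsScalarTower ℝ ℂ V]

theorem wirtBar_of_differentiableAt {f : V → ℂ} {p : V} (hf : DifferentiableAt ℂ f p) (v : V) :
    wirtBar v f p = 0 := by
  have h : fderiv ℝ f p = (fderiv ℂ f p).restrictScalars ℝ :=
    (hf.hasFDerivAt.restrictScalars ℝ).fderiv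
  simp only [wirtBar, h, ContinuousLinearMap.coe_restrictScalars', map_smul, smul_eq_mul]
  linear_combination (1/2) * fderiv ℂ f p v * Complex.I_sq

theorem wirt_of_differentiableAt {f : V → ℂ} {p : V} (hf : DifferentiableAt ℂ f p) (v : V) :
    wirt v f p = fderiv ℂ f p v := by
  have h : fderiv ℝ f p = (fderiv ℂ f p).restrictScalars ℝ :=
    (hf.hasFDerivAt.restrictScalars ℝ).fderiv
  simp only [wirt, h, ContinuousLinearMap.coe_restrictScalars', map_smul, smul_eq_mul]
  linear_combination (-1/2) * fderiv ℂ f p v * Complex.I_sq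

/-- These are the Cauchy–Riemann equations: vanishing of all conjugate derivatives says that the
real derivative commutes with multiplication by i, hence is complex linear. -/
theorem differentiableAt_of_wirtBar {f : V → ℂ} {p : V} (hf : DifferentiableAt ℝ f p)
    (h : ∀ v, wirtBar v f p = 0) : DifferentiableAt ℂ f p := by
  rw [differentiableAt_iff_restrictScalars ℝ hf]
  have hI : ∀ v, fderiv ℝ f p (Complex.I • v) = Complex.I * fderiv ℝ f p v := by
    intro v
    have := h v
    simp only [wirtBar] at this
    linear_combination (-2 * Complex.I) * this + fderiv ℝ f p (Complex.I • v) * Complex.I_sq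
  refine ⟨{ toFun := fderiv ℝ f p, map_add' := map_add _, map_smul' := ?_, cont := (fderiv ℝ f p).cont }, ?_⟩
  · intro c v
    rw [complex_smul_eq, map_add, map_smul, map_smul, hI]
    simp only [Complex.real_smul, smul_eq_mul, RingHom.id_apply]
    nth_rewrite 3 [← Complex.re_add_im c]
    ring
  · ext v; rfl

/-- Chain rule for a Wirtinger derivative along a holomorphic map. -/
theorem wirtBar_comp {W : Type*} [NormedAddCommGroup W] [NormedSpace ℝ W] [NormedSpace ℂ W]
    [IsScalarTower ℝ ℂ W] {f : W → ℂ} {g : V → W} {p : V} (hf : DifferentiableAt ℝ f (g p))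
    (hg : DifferentiableAt ℂ g p) (v : V) :
    wirtBar v (fun q => f (g q)) p = wirtBar (fderiv ℂ g p v) f (g p) := by
  have h : HasFDerivAt g ((fderiv ℂ g p).restrictScalars ℝ) p :=
    hg.hasFDerivAt.restrictScalars ℝ
  have h2 : fderiv ℝ (fun q => f (g q)) p = (fderiv ℝ f (g p)).comp ((fderiv ℂ g p).restrictScalars ℝ) :=
    (hf.hasFDerivAt.comp p h).fderiv
  simp only [wirtBar, h2, ContinuousLinearMap.comp_apply,
    ContinuousLinearMap.coe_restrictScalars', map_smul]

theorem wirt_comp {W : Type*} [NormedAddCommGroup W] [NormedSpace ℝ W] [NormedSpace ℂ W]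
    [IsScalarTower ℝ ℂ W] {f : W → ℂ} {g : V → W} {p : V} (hf : DifferentiableAt ℝ f (g p))
    (hg : DifferentiableAt ℂ g p) (v : V) :
    wirt v (fun q => f (g q)) p = wirt (fderiv ℂ g p v) f (g p) := by
  have h : HasFDerivAt g ((fderiv ℂ g p).restrictScalars ℝ) p :=
    hg.hasFDerivAt.restrictScalars ℝ
  have h2 : fderiv ℝ (fun q => f (g q)) p = (fderiv ℝ f (g p)).comp ((fderiv ℂ g p).restrictScalars ℝ) :=
    (hf.hasFDerivAt.comp p h).fderiv
  simp only [wirt, h2, ContinuousLinearMap.comp_apply,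
    ContinuousLinearMap.coe_restrictScalars', map_smul]

end Holomorphic

end CFinsler

end

noncomputable section

namespace CFinsler

variable {n : ℕ}

/-! ## Sesquilinear forms in coordinates -/

/-- The linear form with components `b`. -/
def linForm (b : Fin n → ℂ) (ξ : Fin n → ℂ) : ℂ := ∑ i, b i * ξ i

/-- The conjugate-linear form with components `c`. -/
def conjForm (c : Fin n → ℂ) (ζ : Fin n → ℂ) : ℂ := ∑ m, c m * star (ζ m)

/-- The sesquilinear form with components `a`. -/
def sesqForm (a : Fin n → Fin n → ℂ) (ξ ζ : Fin n → ℂ) : ℂ :=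
  ∑ i, ∑ j, a i j * ξ i * star (ζ j)

theorem sesqForm_eq_conjForm (a : Fin n → Fin n → ℂ) (ξ ζ : Fin n → ℂ) :
    sesqForm a ξ ζ = conjForm (fun m => ∑ i, a i m * ξ i) ζ := by
  simp only [sesqForm, conjForm, Finset.sum_mul]
  exact Finset.sum_comm

theorem conjForm_add (c ζ ζ' : Fin n → ℂ) : conjForm c (ζ + ζ') = conjForm c ζ + conjForm c ζ' := by
  simp [conjForm, mul_add, Finset.sum_add_distrib]

theorem conjForm_smul (c : Fin n → ℂ) (k : ℂ) (ζ : Fin n → ℂ) :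
    conjForm c (k • ζ) = star k * conjForm c ζ := by
  simp only [conjForm, Pi.smul_apply, smul_eq_mul, star_mul', Finset.mul_sum]
  exact Finset.sum_congr rfl fun i _ => by ring

theorem conjForm_single (c : Fin n → ℂ) (m : Fin n) : conjForm c (Pi.single m 1) = c m := by
  simp only [conjForm, Pi.single_apply]
  rw [Finset.sum_eq_single m] <;> simp +contextual

theorem linForm_add (b ξ ξ' : Fin n → ℂ) : linForm b (ξ + ξ') = linForm b ξ + linForm b ξ' := by
  simp [linForm, mul_add, Finset.sum_add_distrib]

theorem linForm_smul (b : Fin n → ℂ) (k : ℂ) (ξ : Fin n → ℂ) :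
    linForm b (k • ξ) = k * linForm b ξ := by
  simp only [linForm, Pi.smul_apply, smul_eq_mul, Finset.mul_sum]
  exact Finset.sum_congr rfl fun i _ => by ring

theorem linForm_single (b : Fin n → ℂ) (m : Fin n) : linForm b (Pi.single m 1) = b m := by
  simp only [linForm, Pi.single_apply]
  rw [Finset.sum_eq_single m] <;> simp +contextual

theorem sesqForm_add_left (a : Fin n → Fin n → ℂ) (ξ ξ' ζ : Fin n → ℂ) :
    sesqForm a (ξ + ξ') ζ = sesqForm a ξ ζ + sesqForm a ξ' ζ := by
  simp [sesqForm, mul_add, add_mul, Finset.sum_add_distrib]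

theorem sesqForm_smul_left (a : Fin n → Fin n → ℂ) (k : ℂ) (ξ ζ : Fin n → ℂ) :
    sesqForm a (k • ξ) ζ = k * sesqForm a ξ ζ := by
  simp only [sesqForm, Pi.smul_apply, smul_eq_mul, Finset.mul_sum]
  exact Finset.sum_congr rfl fun i _ => Finset.sum_congr rfl fun j _ => by ring

theorem sesqForm_smul_right (a : Fin n → Fin n → ℂ) (k : ℂ) (ξ ζ : Fin n → ℂ) :
    sesqForm a ξ (k • ζ) = star k * sesqForm a ξ ζ := by
  rw [sesqForm_eq_conjForm, conjForm_smul, ← sesqForm_eq_conjForm]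

/-- Every use of `2 ≤ n` comes down to this: a direction in which |β| is constant from the point of
view of ∂̄. -/
theorem exists_linForm_eq_zero (hn : 2 ≤ n) (b : Fin n → ℂ) : ∃ v ≠ 0, linForm b v = 0 := by
  have h01 : (⟨0, by omega⟩ : Fin n) ≠ ⟨1, by omega⟩ := by simp
  set i : Fin n := ⟨0, by omega⟩
  set j : Fin n := ⟨1, by omega⟩
  by_cases hb : b i = 0
  · exact ⟨Pi.single i 1, by simp, by rw [linForm_single, hb]⟩
  · refine ⟨b j • Pi.single i 1 + (-b i) • Pi.single j 1, fun h => ?_, ?_⟩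
    · have := congr_fun h j
      simp [h01.symm, hb] at this
    · rw [linForm_add, linForm_smul, linForm_smul, linForm_single, linForm_single]; ring

/-! ### Independence of `|β|` and `α` over fibrewise holomorphic functions. -/

theorem continuous_sesqForm_left (a : Fin n → Fin n → ℂ) (v : Fin n → ℂ) :
    Continuous fun η => sesqForm a η v := by
  unfold sesqForm; fun_prop

theorem differentiableAt_conjForm {A : Fin n → (Fin n → ℂ) → ℂ} {η : Fin n → ℂ}
    (hA : ∀ m, DifferentiableAt ℂ (A m) η) :
    DifferentiableAt ℝ (fun ξ => conjForm (fun m => A m ξ) ξ) η := by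
  have : ∀ m, DifferentiableAt ℝ (A m) η := fun m => (hA m).restrictScalars ℝ
  unfold conjForm
  refine DifferentiableAt.fun_sum fun m _ => (this m).mul ?_
  have : (fun ξ : Fin n → ℂ => star (ξ m)) = fun ξ => Complex.conjCLE (ξ m) := by ext; simp
  rw [this]; fun_prop

theorem wirtBar_conjForm {A : Fin n → (Fin n → ℂ) → ℂ} {η : Fin n → ℂ}
    (hA : ∀ m, DifferentiableAt ℂ (A m) η) (v : Fin n → ℂ) :
    wirtBar v (fun ξ => conjForm (fun m => A m ξ) ξ) η = conjForm (fun m => A m η) v := by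
  have hR : ∀ m, DifferentiableAt ℝ (A m) η := fun m => (hA m).restrictScalars ℝ
  have hs : ∀ m, DifferentiableAt ℝ (fun ξ : Fin n → ℂ => star (ξ m)) η := fun m => by
    have : (fun ξ : Fin n → ℂ => star (ξ m)) = fun ξ => Complex.conjCLE (ξ m) := by ext; simp
    rw [this]; fun_prop
  have hd : ∀ m, wirt v (fun ξ : Fin n → ℂ => ξ m) η = v m := fun m => by
    rw [wirt_of_differentiableAt (by fun_prop), fderiv_apply (by fun_prop)]; simp
  have hm : ∀ m, DifferentiableAt ℝ (fun ξ => A m ξ * star (ξ m)) η := fun m => (hR m).mul (hs m)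
  unfold conjForm
  rw [wirtBar_sum _ fun m _ => hm m]
  refine Finset.sum_congr rfl fun m _ => ?_
  rw [wirtBar_mul (hR m) (hs m), wirtBar_of_differentiableAt (hA m), wirtBar_star, hd]
  ring

theorem wirtBar_conjForm_const {A : Fin n → (Fin n → ℂ) → ℂ} {η : Fin n → ℂ}
    (hA : ∀ m, DifferentiableAt ℂ (A m) η) (w v : Fin n → ℂ) :
    wirtBar v (fun ξ => conjForm (fun m => A m ξ) w) η = 0 := by
  apply wirtBar_of_differentiableAt
  unfold conjForm
  fun_prop

theorem differentiable_sesqForm_left (a : Fin n → Fin n → ℂ) (v : Fin n → ℂ) :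
    Differentiable ℂ fun η => sesqForm a η v := by
  unfold sesqForm; fun_prop

theorem differentiable_linForm (b : Fin n → ℂ) : Differentiable ℂ (linForm b) := by
  unfold linForm; fun_prop

/-- A function continuous at `η` that vanishes wherever `a(·, v) ≠ 0` vanishes at `η`. -/
theorem eq_zero_of_sesqForm_ne_zero {a : Fin n → Fin n → ℂ}
    {v : Fin n → ℂ} (hv : sesqForm a v v ≠ 0) {g : (Fin n → ℂ) → ℂ} {η : Fin n → ℂ}
    (hg : ContinuousAt g η) (h : ∀ᶠ ξ in 𝓝 η, sesqForm a ξ v ≠ 0 → g ξ = 0) : g η = 0 := by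
  have ht : Filter.Tendsto (fun t : ℂ => η + t • v) (𝓝[≠] 0) (𝓝 η) := by
    have : Continuous fun t : ℂ => η + t • v := by fun_prop
    simpa using (this.tendsto 0).mono_left nhdsWithin_le_nhds
  -- Along η + tv the form a(·, v) equals a(η, v) + t a(v, v), which has at most one zero in t.
  have hne : ∀ᶠ t in 𝓝[≠] (0 : ℂ), sesqForm a (η + t • v) v ≠ 0 := by
    by_cases h0 : sesqForm a η v = 0
    · filter_upwards [self_mem_nhdsWithin] with t ht
      rw [sesqForm_add_left, sesqForm_smul_left, h0, zero_add]
      exact mul_ne_zero ht hv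
    · exact ht.eventually ((continuous_sesqForm_left a v).continuousAt.eventually_ne h0)
  have hz : ∀ᶠ t in 𝓝[≠] (0 : ℂ), g (η + t • v) = 0 := by
    filter_upwards [ht.eventually h, hne] with t h1 h2 using h1 h2
  exact tendsto_nhds_unique_of_eventuallyEq (hg.tendsto.comp ht) tendsto_const_nhds hz

/-- The product `|β| α` is irrational over the functions that are holomorphic in `η` and linear in
`η̄`: a relation `|β| A_m η̄^m = α C_m η̄^m` with holomorphic coefficients is trivial. -/
theorem eq_zero_of_abs_mul_eq (hn : 2 ≤ n) {a : Fin n → Fin n → ℂ} {b : Fin n → ℂ}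
    (ha : ∀ η, η ≠ 0 → sesqForm a η η ≠ 0) {α ν : (Fin n → ℂ) → ℂ}
    (hα : ∀ η, linForm b η ≠ 0 → DifferentiableAt ℝ α η)
    (hα2 : ∀ η, α η * α η = sesqForm a η η)
    (hν : ∀ η, linForm b η ≠ 0 → DifferentiableAt ℝ ν η)
    (hν2 : ∀ η, ν η * ν η = linForm b η * star (linForm b η))
    {A C : Fin n → (Fin n → ℂ) → ℂ}
    (hA : ∀ m η, linForm b η ≠ 0 → DifferentiableAt ℂ (A m) η)
    (hC : ∀ m η, linForm b η ≠ 0 → DifferentiableAt ℂ (C m) η)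
    (h : ∀ η, linForm b η ≠ 0 →
      ν η * conjForm (fun m => A m η) η = α η * conjForm (fun m => C m η) η)
    {η : Fin n → ℂ} (hη : linForm b η ≠ 0) (m : Fin n) : A m η = 0 ∧ C m η = 0 := by
  have hW : IsOpen {η | linForm b η ≠ 0} :=
    isOpen_ne_fun (differentiable_linForm b).continuous continuous_const
  have hν0 : ∀ η, linForm b η ≠ 0 → ν η ≠ 0 := fun η hb h0 => by
    have := hν2 η; simp_all
  have hα0 : ∀ η, linForm b η ≠ 0 → α η ≠ 0 := fun η hb h0 => by
    have h1 := hα2 η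
    rw [h0, zero_mul] at h1
    exact ha η (fun h2 => hb (by simp [h2, linForm])) h1.symm
  have hdA := fun v η hb => wirtBar_conjForm_const (fun m => hA m η hb) v v
  have hdC := fun v η hb => wirtBar_conjForm_const (fun m => hC m η hb) v v
  have hRA : ∀ v η, linForm b η ≠ 0 →
      DifferentiableAt ℝ (fun ξ => conjForm (fun m => A m ξ) v) η := fun v η hb => by
    have := fun m => (hA m η hb).restrictScalars ℝ
    unfold conjForm; fun_prop
  have hRC : ∀ v η, linForm b η ≠ 0 →
      DifferentiableAt ℝ (fun ξ => conjForm (fun m => C m ξ) v) η := fun v η hb => by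
    have := fun m => (hC m η hb).restrictScalars ℝ
    unfold conjForm; fun_prop
  have hRa : ∀ v η, DifferentiableAt ℝ (fun ξ => sesqForm a ξ v) η := fun v η =>
    (differentiable_sesqForm_left a v η).restrictScalars ℝ
  have haa : ∀ η, DifferentiableAt ℝ (fun ξ => sesqForm a ξ ξ) η := fun η => by
    simp only [sesqForm_eq_conjForm]
    exact differentiableAt_conjForm fun m => by fun_prop
  have hda : ∀ v η, wirtBar v (fun ξ => sesqForm a ξ ξ) η = sesqForm a η v := fun v η => by
    simp only [sesqForm_eq_conjForm]
    exact wirtBar_conjForm (fun m => by fun_prop) v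
  have hdα : ∀ v η, linForm b η ≠ 0 → 2 * α η * wirtBar v α η = sesqForm a η v :=
    fun v η hb => by
    rw [← hda, ← funext hα2, wirtBar_mul (hα η hb) (hα η hb)]; ring
  -- Since |β|² = β β̄ and ∂̄_v β̄ is the conjugate of b(v), |β| is invisible to ∂̄_v for v in the
  -- kernel of b.
  have hdν : ∀ v, linForm b v = 0 → ∀ η, linForm b η ≠ 0 → wirtBar v ν η = 0 :=
    fun v hv η hb => by
    have hbd := differentiable_linForm b η
    have hbs : DifferentiableAt ℝ (fun ξ => star (linForm b ξ)) η := by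
      have : (fun ξ => star (linForm b ξ)) = fun ξ => Complex.conjCLE (linForm b ξ) := by ext; simp
      rw [this]; exact Complex.conjCLE.differentiableAt.comp η (hbd.restrictScalars ℝ)
    have h1 : wirtBar v (fun ξ => ν ξ * ν ξ) η = 0 := by
      rw [funext hν2, wirtBar_mul (hbd.restrictScalars ℝ) hbs, wirtBar_of_differentiableAt hbd,
        wirtBar_star, wirt_of_differentiableAt hbd]
      have : fderiv ℂ (linForm b) η v = linForm b v := by
        unfold linForm
        rw [fderiv_fun_sum (by fun_prop), sum_apply]
        refine Finset.sum_congr rfl fun i _ => ?_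
        rw [fderiv_const_mul (by fun_prop), fderiv_apply (by fun_prop)]; simp
      rw [this, hv]; simp
    rw [wirtBar_mul (hν η hb) (hν η hb)] at h1
    have h2 : 2 * ν η * wirtBar v ν η = 0 := by linear_combination h1
    simpa [hν0 η hb] using h2
  -- First application of ∂̄_v, multiplied by 2α: the coefficients are holomorphic, so only η̄ and α
  -- are differentiated.
  have h2 : ∀ v, linForm b v = 0 → ∀ η, linForm b η ≠ 0 →
      2 * α η * ν η * conjForm (fun m => A m η) v = sesqForm a η v * conjForm (fun m => C m η) η
        + 2 * sesqForm a η η * conjForm (fun m => C m η) v := fun v hv η hb => by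
    have e := wirtBar_congr (Filter.eventuallyEq_of_mem (hW.mem_nhds hb) h) v
    have e1 := differentiableAt_conjForm (fun m => hA m η hb)
    have e2 := differentiableAt_conjForm (fun m => hC m η hb)
    rw [wirtBar_mul (hν η hb) e1, wirtBar_mul (hα η hb) e2, hdν v hv η hb,
      wirtBar_conjForm fun m => hA m η hb, wirtBar_conjForm fun m => hC m η hb] at e
    linear_combination 2 * α η * e + conjForm (fun m => C m η) η * hdα v η hb
      + 2 * conjForm (fun m => C m η) v * hα2 η
  -- Second application of ∂̄_v. The diagonal term C(η) becomes C(v), and the contributions 1 and 2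
  -- add up to the factor 3; a common factor a(η, v) is cancelled.
  have h3 : ∀ v, linForm b v = 0 → ∀ η, linForm b η ≠ 0 → sesqForm a η v ≠ 0 →
      ν η * conjForm (fun m => A m η) v = 3 * α η * conjForm (fun m => C m η) v :=
    fun v hv η hb hav => by
    have e := wirtBar_congr (Filter.eventuallyEq_of_mem (hW.mem_nhds hb) (h2 v hv)) v
    have e2 := differentiableAt_conjForm (fun m => hC m η hb)
    have d1 := hα η hb
    have d2 := hν η hb
    have d3 := hRA v η hb
    have d4 := hRC v η hb
    have d5 := hRa v η
    have d6 := haa η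
    rw [wirtBar_mul (by fun_prop) d3, wirtBar_mul (by fun_prop) d2, wirtBar_const_mul d1,
      wirtBar_add (by fun_prop) (by fun_prop), wirtBar_mul d5 e2, wirtBar_mul (by fun_prop) d4,
      wirtBar_const_mul d6, hdν v hv η hb, hdA v η hb, hdC v η hb, hda,
      wirtBar_conjForm (fun m => hC m η hb),
      wirtBar_of_differentiableAt (differentiable_sesqForm_left a v η)] at e
    apply mul_left_cancel₀ hav
    linear_combination α η * e - ν η * conjForm (fun m => A m η) v * hdα v η hb
  -- Third application: the left side has no η̄-dependence left along v, while α on the right still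
  -- contributes a(η, v)/(2α).
  have h4 : ∀ v, linForm b v = 0 → ∀ η, linForm b η ≠ 0 → sesqForm a η v ≠ 0 →
      conjForm (fun m => C m η) v = 0 := fun v hv η hb hav => by
    have hO : IsOpen {η | linForm b η ≠ 0 ∧ sesqForm a η v ≠ 0} :=
      hW.inter (isOpen_ne_fun (continuous_sesqForm_left a v) continuous_const)
    have e := wirtBar_congr (Filter.eventuallyEq_of_mem (hO.mem_nhds ⟨hb, hav⟩)
      fun ξ hξ => h3 v hv ξ hξ.1 hξ.2) v
    have d1 := hα η hb
    have d2 := hν η hb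
    have d3 := hRA v η hb
    have d4 := hRC v η hb
    rw [wirtBar_mul d2 d3, wirtBar_mul (by fun_prop) d4, wirtBar_const_mul d1,
      hdν v hv η hb, hdA v η hb, hdC v η hb] at e
    apply mul_left_cancel₀ hav
    linear_combination (-2 / 3) * α η * e - conjForm (fun m => C m η) v * hdα v η hb
  have h5 : ∀ v, linForm b v = 0 → ∀ η, linForm b η ≠ 0 → sesqForm a η v ≠ 0 →
      conjForm (fun m => A m η) v = 0 ∧ conjForm (fun m => A m η) η = 0 ∧
        conjForm (fun m => C m η) η = 0 := fun v hv η hb hav => by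
    have e4 := h4 v hv η hb hav
    have e5 : conjForm (fun m => A m η) v = 0 := by
      have := h3 v hv η hb hav
      simpa [e4, hν0 η hb] using this
    have e6 : conjForm (fun m => C m η) η = 0 := by
      have := h2 v hv η hb
      simpa [e4, e5, hav] using this
    refine ⟨e5, ?_, e6⟩
    have := h η hb
    simpa [e6, hν0 η hb] using this
  have hnear : ∀ᶠ ξ in 𝓝 η, linForm b ξ ≠ 0 := hW.mem_nhds hη
  have hcA := differentiableAt_conjForm (fun m => hA m η hη)
  have hcC := differentiableAt_conjForm (fun m => hC m η hη)
  -- The restriction a(η, v) ≠ 0 is removed by continuity, as its complement contains no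
  -- neighbourhood of a point when v ≠ 0.
  have ker : ∀ v, linForm b v = 0 →
      conjForm (fun m => A m η) v = 0 ∧ conjForm (fun m => C m η) v = 0 := fun v hv => by
    by_cases hv0 : v = 0
    · simp [hv0, conjForm]
    constructor
    · refine eq_zero_of_sesqForm_ne_zero (ha v hv0)
        (g := fun ξ => conjForm (fun m => A m ξ) v) (hRA v η hη).continuousAt ?_
      filter_upwards [hnear] with ξ hξ h0 using (h5 v hv ξ hξ h0).1
    · refine eq_zero_of_sesqForm_ne_zero (ha v hv0)
        (g := fun ξ => conjForm (fun m => C m ξ) v) (hRC v η hη).continuousAt ?_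
      filter_upwards [hnear] with ξ hξ h0 using h4 v hv ξ hξ h0
  obtain ⟨v, hv0, hv⟩ := exists_linForm_eq_zero hn b
  have diag : conjForm (fun m => A m η) η = 0 ∧ conjForm (fun m => C m η) η = 0 := by
    constructor
    · refine eq_zero_of_sesqForm_ne_zero (ha v hv0)
        (g := fun ξ => conjForm (fun m => A m ξ) ξ) hcA.continuousAt ?_
      filter_upwards [hnear] with ξ hξ h0 using (h5 v hv ξ hξ h0).2.1
    · refine eq_zero_of_sesqForm_ne_zero (ha v hv0)
        (g := fun ξ => conjForm (fun m => C m ξ) ξ) hcC.continuousAt ?_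
      filter_upwards [hnear] with ξ hξ h0 using (h5 v hv ξ hξ h0).2.2
  -- As β(η) ≠ 0, the kernel of b together with η spans the fibre, and both forms are now known to
  -- vanish on each of the two pieces.
  obtain ⟨k, w, hw, hkw⟩ : ∃ (k : ℂ) (w : Fin n → ℂ), linForm b w = 0 ∧
      (Pi.single m 1 : Fin n → ℂ) = w + k • η := by
    refine ⟨b m / linForm b η, Pi.single m 1 + (-(b m / linForm b η)) • η, ?_, ?_⟩
    · rw [linForm_add, linForm_smul, linForm_single]; field_simp; ring
    · ext; simp
  rw [← conjForm_single (fun m => A m η) m, ← conjForm_single (fun m => C m η) m, hkw]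
  simp only [conjForm_add, conjForm_smul, ker w hw, diag, mul_zero, add_zero, and_self]

end CFinsler

end

noncomputable section

namespace CFinsler

variable {n : ℕ}

/-! ## Wirtinger derivatives in the coordinates `(z, η)` -/

theorem coord_eq_sum (u w : Fin n → ℂ) : ((u, w) : Coord n) =
    ∑ i, u i • ((Pi.single i 1, 0) : Coord n) + ∑ i, w i • ((0, Pi.single i 1) : Coord n) := by
  have h : ∀ u : Fin n → ℂ, u = ∑ i, u i • (Pi.single i 1 : Fin n → ℂ) := fun u => by
    ext j
    simp [Finset.sum_apply, Pi.single_apply]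
  ext1
  · simpa [Prod.fst_sum] using h u
  · simpa [Prod.snd_sum] using h w

theorem wirt_coord (u w : Fin n → ℂ) (f : Coord n → ℂ) (p : Coord n) :
    wirt (u, w) f p = ∑ i, u i * dz i f p + ∑ i, w i * dEta i f p := by
  rw [coord_eq_sum u w, wirt_add_left, wirt_sum_left, wirt_sum_left]
  simp only [wirt_smul_left, dz, dEta]

theorem wirtBar_eta (w : Fin n → ℂ) (f : Coord n → ℂ) (p : Coord n) :
    wirtBar (0, w) f p = ∑ i, star (w i) * dEtaBar i f p := by
  rw [coord_eq_sum 0 w, wirtBar_add_left, wirtBar_sum_left, wirtBar_sum_left]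
  simp only [wirtBar_smul_left, dEtaBar, Pi.zero_apply, star_zero, zero_mul, Finset.sum_const_zero,
    zero_add]

theorem differentiableAt_star {V : Type*} [NormedAddCommGroup V] [NormedSpace ℝ V]
    {f : V → ℂ} {p : V} (hf : DifferentiableAt ℝ f p) :
    DifferentiableAt ℝ (fun q => star (f q)) p := by
  have : (fun q => star (f q)) = fun q => Complex.conjCLE (f q) := by ext; simp
  rw [this]; exact Complex.conjCLE.differentiableAt.comp p hf

theorem contDiffAt_star {V : Type*} [NormedAddCommGroup V] [NormedSpace ℝ V]
    {f : V → ℂ} {p : V} (hf : ContDiffAt ℝ ∞ f p) : ContDiffAt ℝ ∞ (fun q => star (f q)) p := by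
  have : (fun q => star (f q)) = fun q => Complex.conjCLE (f q) := by ext; simp
  rw [this]; exact Complex.conjCLE.contDiff.contDiffAt.comp p hf

theorem wirt_eta (i : Fin n) (v p : Coord n) : wirt v (fun q : Coord n => q.2 i) p = v.2 i := by
  rw [wirt_of_differentiableAt (by fun_prop)]
  have : HasFDerivAt (fun q : Coord n => q.2 i)
    ((ContinuousLinearMap.proj (R := ℂ) (φ := fun _ : Fin n => ℂ) i).comp
      (ContinuousLinearMap.snd ℂ (Fin n → ℂ) (Fin n → ℂ))) p :=
    ((ContinuousLinearMap.proj (R := ℂ) (φ := fun _ : Fin n => ℂ) i).comp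
      (ContinuousLinearMap.snd ℂ (Fin n → ℂ) (Fin n → ℂ))).hasFDerivAt
  rw [this.fderiv]; simp

theorem wirtBar_eta_apply (i : Fin n) (v p : Coord n) :
    wirtBar v (fun q : Coord n => q.2 i) p = 0 :=
  wirtBar_of_differentiableAt (by fun_prop) v

theorem wirt_eta_star (i : Fin n) (v p : Coord n) :
    wirt v (fun q : Coord n => star (q.2 i)) p = 0 := by
  rw [wirt_star, wirtBar_eta_apply, star_zero]

theorem wirtBar_eta_star (i : Fin n) (v p : Coord n) :
    wirtBar v (fun q : Coord n => star (q.2 i)) p = star (v.2 i) := by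
  rw [wirtBar_star, wirt_eta]

/-! ## Homogeneity -/

/-- The fibrewise scaling `(z, η) ↦ (z, c η)`. -/
def scale (c : ℂ) (p : Coord n) : Coord n := (p.1, c • p.2)

@[simp] theorem scale_fst (c : ℂ) (p : Coord n) : (scale c p).1 = p.1 := rfl

@[simp] theorem scale_snd (c : ℂ) (p : Coord n) : (scale c p).2 = c • p.2 := rfl

/-- Scaling by a nonzero number, as a continuous linear equivalence. -/
def scaleEquiv (c : ℂ) (hc : c ≠ 0) : Coord n ≃L[ℝ] Coord n :=
  (ContinuousLinearEquiv.refl ℝ (Fin n → ℂ)).prodCongr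
    ((ContinuousLinearEquiv.smulLeft (R₁ := ℂ) (M₁ := Fin n → ℂ) (Units.mk0 c hc)).restrictScalars ℝ)

/-- Scaling is a linear automorphism, so the chain rule holds without any differentiability of `f`.
Homogeneity of all derived quantities is therefore available at every point, not only on the regular
domain. -/
theorem fderiv_scale {f : Coord n → ℂ} {c k : ℂ} (hc : c ≠ 0)
    (h : ∀ p, f (scale c p) = k * f p) (p v : Coord n) :
    fderiv ℝ f (scale c p) (scale c v) = k * fderiv ℝ f p v := by
  have h1 := (scaleEquiv (n := n) c hc).comp_right_fderiv (f := f) (x := p)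
  have h2 : f ∘ (scaleEquiv (n := n) c hc) = fun q => k • f q := funext h
  have h3 : fderiv ℝ (fun q => k • f q) p = k • fderiv ℝ f p :=
    congr_fun (fderiv_const_smul_field (𝕜 := ℝ) (f := f) k) p
  rw [h2, h3] at h1
  exact (DFunLike.congr_fun h1 v).symm

theorem wirt_scale {f : Coord n → ℂ} {c k : ℂ} (hc : c ≠ 0)
    (h : ∀ p, f (scale c p) = k * f p) (p v : Coord n) :
    wirt (scale c v) f (scale c p) = k * wirt v f p := by
  have : Complex.I • scale c v = scale c (Complex.I • v) := by
    ext1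
    · rfl
    · exact smul_comm _ _ _
  simp only [wirt, this, fderiv_scale hc h]; ring

theorem wirtBar_scale {f : Coord n → ℂ} {c k : ℂ} (hc : c ≠ 0)
    (h : ∀ p, f (scale c p) = k * f p) (p v : Coord n) :
    wirtBar (scale c v) f (scale c p) = k * wirtBar v f p := by
  have : Complex.I • scale c v = scale c (Complex.I • v) := by
    ext1
    · rfl
    · exact smul_comm _ _ _
  simp only [wirtBar, this, fderiv_scale hc h]; ring

theorem dz_scale {f : Coord n → ℂ} {c k : ℂ} (hc : c ≠ 0)
    (h : ∀ p, f (scale c p) = k * f p) (i : Fin n) (p : Coord n) :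
    dz i f (scale c p) = k * dz i f p := by
  have := wirt_scale hc h p (Pi.single i 1, 0)
  have h2 : scale c ((Pi.single i 1, 0) : Coord n) = (Pi.single i 1, 0) := by simp [scale]
  rwa [h2] at this

theorem dEta_scale {f : Coord n → ℂ} {c k : ℂ} (hc : c ≠ 0)
    (h : ∀ p, f (scale c p) = k * f p) (i : Fin n) (p : Coord n) :
    dEta i f (scale c p) = k / c * dEta i f p := by
  have h1 := wirt_scale hc h p (0, Pi.single i 1)
  have h2 : scale c ((0, Pi.single i 1) : Coord n) = c • ((0, Pi.single i 1) : Coord n) := by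
    ext1 <;> simp
  rw [h2, wirt_smul_left] at h1
  simp only [dEta]
  field_simp
  linear_combination h1

theorem dEtaBar_scale {f : Coord n → ℂ} {c k : ℂ} (hc : c ≠ 0)
    (h : ∀ p, f (scale c p) = k * f p) (i : Fin n) (p : Coord n) :
    dEtaBar i f (scale c p) = k / star c * dEtaBar i f p := by
  have h1 := wirtBar_scale hc h p (0, Pi.single i 1)
  have h2 : scale c ((0, Pi.single i 1) : Coord n) = c • ((0, Pi.single i 1) : Coord n) := by
    ext1 <;> simp
  rw [h2, wirtBar_smul_left] at h1
  have hc' : star c ≠ 0 := star_ne_zero.2 hc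
  simp only [dEtaBar]
  field_simp
  linear_combination h1

/-- Euler's relation in general form: c ↦ f(z, cη) is differentiated at c = 1, once by the chain
rule and once from homogeneity. The choices K(c) = c, c̄ and c c̄ serve the three bidegrees needed
later. -/
theorem wirt_fibre {f : Coord n → ℂ} {p : Coord n} (hf : DifferentiableAt ℝ f p) {K : ℂ → ℂ}
    (h : ∀ c ≠ 0, f (scale c p) = K c * f p) (hK : DifferentiableAt ℝ K 1) :
    wirt (0, p.2) f p = wirt 1 K 1 * f p ∧ wirtBar (0, p.2) f p = wirtBar 1 K 1 * f p := by
  have hp : scale 1 p = p := by simp [scale]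
  have hg : HasFDerivAt (fun c : ℂ => scale c p)
      ((ContinuousLinearMap.id ℂ ℂ).smulRight ((0, p.2) : Coord n)) 1 := by
    have h1 : HasFDerivAt (fun c : ℂ => c • p.2)
      ((ContinuousLinearMap.id ℂ ℂ).smulRight p.2) 1 := (hasFDerivAt_id (𝕜 := ℂ) (1 : ℂ)).smul_const p.2
    have h2 := (hasFDerivAt_const (𝕜 := ℂ) p.1 (1 : ℂ)).prodMk h1
    refine h2.congr_fderiv ?_
    ext <;> simp
  have hd : fderiv ℂ (fun c : ℂ => scale c p) 1 1 = ((0, p.2) : Coord n) := by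
    rw [hg.fderiv]; simp
  have hf' : DifferentiableAt ℝ f (scale 1 p) := by rwa [hp]
  have he : (fun c => f (scale c p)) =ᶠ[𝓝 1] fun c => K c * f p := by
    filter_upwards [isOpen_ne.mem_nhds (one_ne_zero : (1 : ℂ) ≠ 0)] with c hc using h c hc
  have e1 := wirt_comp (g := fun c : ℂ => scale c p) hf' hg.differentiableAt 1
  have e2 := wirtBar_comp (g := fun c : ℂ => scale c p) hf' hg.differentiableAt 1
  rw [hd, hp, wirt_congr he, wirt_mul hK (by fun_prop), wirt_const] at e1
  rw [hd, hp, wirtBar_congr he, wirtBar_mul hK (by fun_prop), wirtBar_const] at e2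
  constructor
  · rw [← e1]; ring
  · rw [← e2]; ring

theorem wirt_id_one : wirt 1 (fun c : ℂ => c) 1 = 1 ∧ wirtBar 1 (fun c : ℂ => c) 1 = 0 := by
  constructor
  · rw [wirt_of_differentiableAt (by fun_prop)]; simp
  · exact wirtBar_of_differentiableAt (by fun_prop) _

theorem wirt_fibre_linear {f : Coord n → ℂ} {p : Coord n} (hf : DifferentiableAt ℝ f p)
    (h : ∀ c ≠ 0, f (scale c p) = c * f p) : ∑ i, p.2 i * dEta i f p = f p := by
  have := (wirt_fibre hf h (by fun_prop)).1
  rw [wirt_id_one.1, one_mul, wirt_coord] at this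
  simpa using this

theorem wirtBar_fibre_antilinear {f : Coord n → ℂ} {p : Coord n} (hf : DifferentiableAt ℝ f p)
    (h : ∀ c ≠ 0, f (scale c p) = star c * f p) : ∑ i, star (p.2 i) * dEtaBar i f p = f p := by
  have := (wirt_fibre hf h (differentiableAt_star (by fun_prop))).2
  rw [wirtBar_star, wirt_id_one.1, star_one, one_mul, wirtBar_eta] at this
  exact this

theorem wirt_fibre_hermitian {f : Coord n → ℂ} {p : Coord n} (hf : DifferentiableAt ℝ f p)
    (h : ∀ c ≠ 0, f (scale c p) = c * star c * f p) :
    ∑ i, p.2 i * dEta i f p = f p ∧ ∑ i, star (p.2 i) * dEtaBar i f p = f p := by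
  have hs : DifferentiableAt ℝ (fun c : ℂ => star c) 1 := differentiableAt_star (by fun_prop)
  have := wirt_fibre hf h (DifferentiableAt.fun_mul (by fun_prop) hs)
  rw [wirt_mul (by fun_prop) hs, wirtBar_mul (by fun_prop) hs, wirtBar_star, wirt_star,
    wirt_id_one.1, wirt_id_one.2, wirtBar_eta, wirt_coord] at this
  simpa using this

/-! ## Strongly pseudoconvex complex Finsler metrics in coordinates -/

/-- `L` is, over the open set `Ω`, the square of a regular complex Finsler metric. -/
structure IsFinslerOn (L : Coord n → ℂ) (Ω : Set (Coord n)) : Prop where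
  isOpen : IsOpen Ω
  smooth : ∀ p ∈ Ω, ContDiffAt ℝ ∞ L p
  homog : ∀ c ≠ 0, ∀ p, L (scale c p) = c * star c * L p
  real : ∀ p, star (L p) = L p
  det : ∀ p ∈ Ω, IsUnit (Matrix.of fun a b => fundTensor L a b p).det

/-- The horizontal field `η^j ∂/∂z^j - 2 G^i ∂/∂η^i` of the spray. -/
def sprayField (L : Coord n → ℂ) (p : Coord n) : Coord n := (p.2, fun i => -(2 * spray L i p))

theorem horDeriv_eq_wirt (L : Coord n → ℂ) (k : Fin n) (f : Coord n → ℂ) (p : Coord n) :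
    horDeriv L k f p = wirt (Pi.single k 1, fun j => -nonlinConn L j k p) f p := by
  have : ∑ i, (Pi.single k 1 : Fin n → ℂ) i * dz i f p = dz k f p := by
    rw [Finset.sum_eq_single k] <;> simp +contextual
  rw [wirt_coord, horDeriv, this]
  simp [sub_eq_add_neg]

theorem sum_horDeriv (L : Coord n → ℂ) (f : Coord n → ℂ) (p : Coord n) :
    ∑ j, p.2 j * horDeriv L j f p = wirt (sprayField L p) f p := by
  simp only [sprayField, wirt_coord, horDeriv, spray, mul_sub, Finset.sum_sub_distrib]
  rw [sub_eq_add_neg, ← Finset.sum_neg_distrib]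
  simp only [Finset.mul_sum, Finset.sum_mul, ← Finset.sum_neg_distrib]
  rw [Finset.sum_comm]
  congr 1
  exact Finset.sum_congr rfl fun i _ => Finset.sum_congr rfl fun j _ => by ring

namespace IsFinslerOn

variable {L : Coord n → ℂ} {Ω : Set (Coord n)}

theorem mem_nhds (h : IsFinslerOn L Ω) {p : Coord n} (hp : p ∈ Ω) : Ω ∈ 𝓝 p := h.isOpen.mem_nhds hp

theorem smooth_dEtaBar (h : IsFinslerOn L Ω) {p : Coord n} (hp : p ∈ Ω) (m : Fin n) :
    ContDiffAt ℝ ∞ (dEtaBar m L) p := contDiffAt_wirtBar (h.smooth p hp) _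

theorem smooth_dEta (h : IsFinslerOn L Ω) {p : Coord n} (hp : p ∈ Ω) (m : Fin n) :
    ContDiffAt ℝ ∞ (dEta m L) p := contDiffAt_wirt (h.smooth p hp) _

theorem smooth_fundTensor (h : IsFinslerOn L Ω) {p : Coord n} (hp : p ∈ Ω) (l m : Fin n) :
    ContDiffAt ℝ ∞ (fundTensor L l m) p := contDiffAt_wirt (h.smooth_dEtaBar hp m) _

theorem smooth_fundInv (h : IsFinslerOn L Ω) {p : Coord n} (hp : p ∈ Ω) (m i : Fin n) :
    ContDiffAt ℝ ∞ (fundInv L m i) p := by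
  have hdet : ∀ N : Coord n → Matrix (Fin n) (Fin n) ℂ,
      (∀ a b, ContDiffAt ℝ ∞ (fun q => N q a b) p) → ContDiffAt ℝ ∞ (fun q => (N q).det) p := by
    intro N hN
    simp only [Matrix.det_apply]
    refine ContDiffAt.sum fun σ _ => ?_
    simp only [Units.smul_def, zsmul_eq_mul]
    exact contDiffAt_const.mul (contDiffAt_prod fun a _ => hN _ _)
  -- Cramer's rule reduces smoothness of the inverse matrix to that of determinants.
  have h1 : (fundInv L m i) = fun q => ((Matrix.of fun a b => fundTensor L a b q).det)⁻¹ *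
      ((Matrix.of fun a b => fundTensor L a b q).updateRow i (Pi.single m 1)).det := by
    funext q
    simp [fundInv, Matrix.inv_def, Matrix.adjugate_apply, Ring.inverse_eq_inv']
  rw [h1]
  refine ContDiffAt.mul (ContDiffAt.inv (hdet _ fun a b => h.smooth_fundTensor hp a b)
    (h.det p hp).ne_zero) (hdet _ fun a b => ?_)
  by_cases hai : a = i
  · subst hai; simpa using contDiffAt_const
  · simpa [Matrix.updateRow_ne hai] using h.smooth_fundTensor hp a b

theorem smooth_spray (h : IsFinslerOn L Ω) {p : Coord n} (hp : p ∈ Ω) (i : Fin n) :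
    ContDiffAt ℝ ∞ (spray L i) p := by
  have hη : ∀ i, ContDiffAt ℝ ∞ (fun q : Coord n => q.2 i) p := fun i => by fun_prop
  have h1 := fun m i => h.smooth_fundInv hp m i
  have h2 : ∀ j l m, ContDiffAt ℝ ∞ (fun q => dz j (fundTensor L l m) q) p :=
    fun j l m => contDiffAt_wirt (h.smooth_fundTensor hp l m) _
  unfold spray nonlinConn
  refine contDiffAt_const.mul (ContDiffAt.sum fun j _ => ?_)
  refine ContDiffAt.mul (ContDiffAt.sum fun m _ => ContDiffAt.sum fun l _ => ?_) (hη j)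
  exact ((h1 m i).mul (h2 j l m)).mul (hη l)

theorem fundInv_mul_fundTensor (h : IsFinslerOn L Ω) {p : Coord n} (hp : p ∈ Ω) (m k : Fin n) :
    ∑ i, fundInv L m i p * fundTensor L i k p = if m = k then 1 else 0 := by
  have := congr_fun₂ (Matrix.nonsing_inv_mul _ (h.det p hp)) m k
  rw [Matrix.mul_apply, Matrix.one_apply] at this
  exact this

/-- Lowering an index raised by the inverse of the fundamental tensor. -/
theorem lower_raise (h : IsFinslerOn L Ω) {p : Coord n} (hp : p ∈ Ω) (Y : Fin n → ℂ) (k : Fin n) :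
    ∑ i, (∑ m, fundInv L m i p * Y m) * fundTensor L i k p = Y k := by
  simp only [Finset.sum_mul]
  rw [Finset.sum_comm]
  have : ∀ m, ∑ i, fundInv L m i p * Y m * fundTensor L i k p = if m = k then Y m else 0 := by
    intro m
    simp only [mul_right_comm _ (Y m), ← Finset.sum_mul, h.fundInv_mul_fundTensor hp]
    simp
  simp [this]

/-- The fundamental tensor is nondegenerate. -/
theorem eq_zero_of_lower (h : IsFinslerOn L Ω) {p : Coord n} (hp : p ∈ Ω) {x : Fin n → ℂ}
    (hx : ∀ m, ∑ i, x i * fundTensor L i m p = 0) (i : Fin n) : x i = 0 := by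
  have h1 : Matrix.vecMul x (Matrix.of fun a b => fundTensor L a b p) = 0 := by
    ext m; simpa [Matrix.vecMul, dotProduct] using hx m
  exact congr_fun (Matrix.eq_zero_of_vecMul_eq_zero (h.det p hp).ne_zero h1) i

theorem star_fundTensor (h : IsFinslerOn L Ω) {p : Coord n} (hp : p ∈ Ω) (i j : Fin n) :
    star (fundTensor L i j p) = fundTensor L j i p := by
  have h1 : ∀ v : Coord n, (fun q => wirtBar v L q) = fun q => star (wirt v L q) :=
    fun v => funext fun q => wirtBar_eq_star_wirt h.real q v
  have e : fundTensor L i j p = star (wirtBar (0, Pi.single i 1) (dEta j L) p) := by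
    rw [← wirt_star]
    exact congr_arg (fun f => wirt (0, Pi.single i 1) f p) (h1 _)
  rw [e, star_star]
  exact (wirt_wirtBar_comm (h.smooth p hp) _ _).symm

theorem dEtaBar_scale (h : IsFinslerOn L Ω) {c : ℂ} (hc : c ≠ 0) (m : Fin n) (p : Coord n) :
    dEtaBar m L (scale c p) = c * dEtaBar m L p := by
  rw [CFinsler.dEtaBar_scale hc (h.homog c hc), mul_div_cancel_right₀ _ (star_ne_zero.2 hc)]

theorem dEta_scale (h : IsFinslerOn L Ω) {c : ℂ} (hc : c ≠ 0) (m : Fin n) (p : Coord n) :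
    dEta m L (scale c p) = star c * dEta m L p := by
  rw [CFinsler.dEta_scale hc (h.homog c hc), mul_div_cancel_left₀ _ hc]

theorem fundTensor_scale (h : IsFinslerOn L Ω) {c : ℂ} (hc : c ≠ 0) (l m : Fin n) (p : Coord n) :
    fundTensor L l m (scale c p) = fundTensor L l m p := by
  rw [fundTensor, CFinsler.dEta_scale hc (h.dEtaBar_scale hc m), div_self hc, one_mul]

theorem fundInv_scale (h : IsFinslerOn L Ω) {c : ℂ} (hc : c ≠ 0) (m i : Fin n) (p : Coord n) :
    fundInv L m i (scale c p) = fundInv L m i p := by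
  simp only [fundInv, h.fundTensor_scale hc]

theorem nonlinConn_scale (h : IsFinslerOn L Ω) {c : ℂ} (hc : c ≠ 0) (i j : Fin n) (p : Coord n) :
    nonlinConn L i j (scale c p) = c * nonlinConn L i j p := by
  have : ∀ l m, dz j (fundTensor L l m) (scale c p) = dz j (fundTensor L l m) p := fun l m => by
    rw [dz_scale hc (k := 1) (fun q => by rw [h.fundTensor_scale hc, one_mul]), one_mul]
  simp only [nonlinConn, h.fundInv_scale hc, this, scale_snd, Pi.smul_apply, smul_eq_mul,
    Finset.mul_sum]
  exact Finset.sum_congr rfl fun i _ => Finset.sum_congr rfl fun j _ => by ring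

theorem spray_scale (h : IsFinslerOn L Ω) {c : ℂ} (hc : c ≠ 0) (i : Fin n) (p : Coord n) :
    spray L i (scale c p) = c ^ 2 * spray L i p := by
  simp only [spray, h.nonlinConn_scale hc, scale_snd, Pi.smul_apply, smul_eq_mul, Finset.mul_sum]
  exact Finset.sum_congr rfl fun i _ => by ring

theorem torsion_scale (h : IsFinslerOn L Ω) {c : ℂ} (hc : c ≠ 0) (i j k : Fin n) (p : Coord n) :
    torsion L i j k (scale c p) = torsion L i j k p := by
  have h1 : ∀ l m q, fundTensor L l m (scale c q) = 1 * fundTensor L l m q := fun l m q => by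
    rw [h.fundTensor_scale hc, one_mul]
  have h2 : ∀ k l m, horDeriv L k (fundTensor L l m) (scale c p) =
      horDeriv L k (fundTensor L l m) p := fun k l m => by
    simp only [horDeriv, h.nonlinConn_scale hc, dz_scale hc (h1 _ _),
      CFinsler.dEta_scale hc (h1 _ _), one_mul]
    congr 1
    refine Finset.sum_congr rfl fun j _ => ?_
    field_simp
  simp only [torsion, horCoeff, h2, h.fundInv_scale hc]

theorem thetaStar_scale (h : IsFinslerOn L Ω) {c : ℂ} (hc : c ≠ 0) (k : Fin n) (p : Coord n) :
    thetaStar L k (scale c p) = c * star c * thetaStar L k p := by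
  simp only [thetaStar, h.fundInv_scale hc, h.fundTensor_scale hc, h.torsion_scale hc, scale_snd,
    Pi.smul_apply, smul_eq_mul, star_mul', Finset.mul_sum]
  refine Finset.sum_congr rfl fun _ _ => Finset.sum_congr rfl fun _ _ =>
    Finset.sum_congr rfl fun _ _ => Finset.sum_congr rfl fun _ _ => by ring

theorem euler (h : IsFinslerOn L Ω) {p : Coord n} (hp : p ∈ Ω) :
    ∑ i, p.2 i * dEta i L p = L p ∧ ∑ i, star (p.2 i) * dEtaBar i L p = L p :=
  wirt_fibre_hermitian ((h.smooth p hp).differentiableAt (by simp)) fun c hc => h.homog c hc p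

theorem euler_fundTensor_left (h : IsFinslerOn L Ω) {p : Coord n} (hp : p ∈ Ω) (m : Fin n) :
    ∑ i, p.2 i * fundTensor L i m p = dEtaBar m L p :=
  wirt_fibre_linear ((h.smooth_dEtaBar hp m).differentiableAt (by simp)) fun _ hc =>
    h.dEtaBar_scale hc m p

theorem euler_fundTensor_right (h : IsFinslerOn L Ω) {p : Coord n} (hp : p ∈ Ω) (l : Fin n) :
    ∑ m, star (p.2 m) * fundTensor L l m p = dEta l L p := by
  rw [← wirtBar_fibre_antilinear ((h.smooth_dEta hp l).differentiableAt (by simp)) fun _ hc =>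
    h.dEta_scale hc l p]
  refine Finset.sum_congr rfl fun m _ => ?_
  congr 1
  exact wirt_wirtBar_comm (h.smooth p hp) _ _

end IsFinslerOn

end CFinsler

end

noncomputable section

namespace CFinsler

variable {n : ℕ}

/-! ## The spray, torsion and `θ*` with lowered indices -/

namespace IsFinslerOn

variable {L : Coord n → ℂ} {Ω : Set (Coord n)}

/-- Euler's relation writes ∂L/∂η̄^m as η^l g_{l m̄}, and ∂/∂z^j does not act on η^l; lowering the
index cancels the inverse tensor in N. -/
theorem lower_nonlinConn (h : IsFinslerOn L Ω) {p : Coord n} (hp : p ∈ Ω) (j m : Fin n) :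
    ∑ i, nonlinConn L i j p * fundTensor L i m p = dz j (dEtaBar m L) p := by
  have h1 : ∀ i, nonlinConn L i j p =
      ∑ m, fundInv L m i p * ∑ l, dz j (fundTensor L l m) p * p.2 l := fun i => by
    simp only [nonlinConn, Finset.mul_sum, mul_assoc]
  simp only [h1]
  rw [h.lower_raise hp fun m => ∑ l, dz j (fundTensor L l m) p * p.2 l]
  have hd : ∀ l, DifferentiableAt ℝ (fundTensor L l m) p := fun l =>
    (h.smooth_fundTensor hp l m).differentiableAt (by simp)
  have h2 : dz j (dEtaBar m L) p = dz j (fun q => ∑ l, q.2 l * fundTensor L l m q) p := by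
    refine wirt_congr ?_ _
    filter_upwards [h.mem_nhds hp] with q hq using (h.euler_fundTensor_left hq m).symm
  rw [h2, dz, wirt_sum _ fun l _ => DifferentiableAt.fun_mul (by fun_prop) (hd l)]
  refine Finset.sum_congr rfl fun l _ => ?_
  rw [wirt_mul (by fun_prop) (hd l), wirt_eta]
  simp [dz, mul_comm]

/-- Contraction of `lower_nonlinConn` with the velocity. By nondegeneracy of the fundamental tensor
this equation determines G, and sprays are compared through it. -/
theorem lower_spray (h : IsFinslerOn L Ω) {p : Coord n} (hp : p ∈ Ω) (m : Fin n) :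
    wirt (sprayField L p) (dEtaBar m L) p = 0 := by
  have h1 : ∑ i, 2 * spray L i p * fundTensor L i m p = ∑ j, p.2 j * dz j (dEtaBar m L) p := by
    simp only [← h.lower_nonlinConn hp, spray, Finset.mul_sum, Finset.sum_mul]
    rw [Finset.sum_comm]
    exact Finset.sum_congr rfl fun i _ => Finset.sum_congr rfl fun j _ => by ring
  rw [sprayField, wirt_coord, ← h1, ← Finset.sum_add_distrib]
  exact Finset.sum_eq_zero fun i _ => by rw [fundTensor]; ring

/-- `L` is constant along the horizontal field of its spray. -/
theorem sprayField_self (h : IsFinslerOn L Ω) {p : Coord n} (hp : p ∈ Ω) :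
    wirt (sprayField L p) L p = 0 := by
  have hd : ∀ m, DifferentiableAt ℝ (dEtaBar m L) p := fun m =>
    (h.smooth_dEtaBar hp m).differentiableAt (by simp)
  have h1 : wirt (sprayField L p) L p =
      wirt (sprayField L p) (fun q => ∑ m, star (q.2 m) * dEtaBar m L q) p := by
    refine wirt_congr ?_ _
    filter_upwards [h.mem_nhds hp] with q hq using (h.euler hq).2.symm
  have hs : ∀ m, DifferentiableAt ℝ (fun q : Coord n => star (q.2 m)) p := fun m =>
    differentiableAt_star (by fun_prop)
  rw [h1, wirt_sum _ fun m _ => DifferentiableAt.fun_mul (hs m) (hd m)]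
  refine Finset.sum_eq_zero fun m _ => ?_
  rw [wirt_mul (hs m) (hd m), h.lower_spray hp, wirt_eta_star]
  ring

theorem lower_horCoeff (h : IsFinslerOn L Ω) {p : Coord n} (hp : p ∈ Ω) (j k m : Fin n) :
    ∑ i, horCoeff L i j k p * fundTensor L i m p = horDeriv L k (fundTensor L j m) p :=
  h.lower_raise hp (fun l => horDeriv L k (fundTensor L j l) p) m

/-- Apply δ_k to ∂L/∂η̄^m = η^j g_{j m̄}. The term from δ_k η^j = −N^j_k cancels the vertical part
of δ_k on the left, leaving only ∂/∂z^k. -/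
theorem sum_horDeriv_fundTensor (h : IsFinslerOn L Ω) {p : Coord n} (hp : p ∈ Ω) (k m : Fin n) :
    ∑ j, p.2 j * horDeriv L k (fundTensor L j m) p = dz k (dEtaBar m L) p := by
  have hd : ∀ l, DifferentiableAt ℝ (fundTensor L l m) p := fun l =>
    (h.smooth_fundTensor hp l m).differentiableAt (by simp)
  have h2 : horDeriv L k (dEtaBar m L) p =
      horDeriv L k (fun q => ∑ l, q.2 l * fundTensor L l m q) p := by
    rw [horDeriv_eq_wirt, horDeriv_eq_wirt]
    refine wirt_congr ?_ _
    filter_upwards [h.mem_nhds hp] with q hq using (h.euler_fundTensor_left hq m).symm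
  rw [horDeriv_eq_wirt L k fun q => ∑ l, q.2 l * fundTensor L l m q,
    wirt_sum _ fun l _ => DifferentiableAt.fun_mul (by fun_prop) (hd l)] at h2
  have h3 : ∀ l, wirt (Pi.single k 1, fun j => -nonlinConn L j k p)
      (fun q : Coord n => q.2 l * fundTensor L l m q) p =
      -(nonlinConn L l k p * fundTensor L l m p) +
        p.2 l * horDeriv L k (fundTensor L l m) p := fun l => by
    rw [wirt_mul (by fun_prop) (hd l), wirt_eta, horDeriv_eq_wirt]
    ring
  simp only [h3, Finset.sum_add_distrib, Finset.sum_neg_distrib] at h2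
  rw [horDeriv] at h2
  have h4 : ∑ j, nonlinConn L j k p * dEta j (dEtaBar m L) p =
    ∑ j, nonlinConn L j k p * fundTensor L j m p := rfl
  rw [h4] at h2
  linear_combination -h2

/-- The Kähler tensor with its upper index lowered. -/
theorem lower_torsion (h : IsFinslerOn L Ω) {p : Coord n} (hp : p ∈ Ω) (k m : Fin n) :
    ∑ i, (∑ j, torsion L i j k p * p.2 j) * fundTensor L i m p =
      dz k (dEtaBar m L) p - wirt (sprayField L p) (fundTensor L k m) p := by
  have h1 : ∀ j, ∑ i, torsion L i j k p * fundTensor L i m p =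
      horDeriv L k (fundTensor L j m) p - horDeriv L j (fundTensor L k m) p := fun j => by
    simp only [torsion, sub_mul, Finset.sum_sub_distrib, h.lower_horCoeff hp]
  rw [← h.sum_horDeriv_fundTensor hp, ← sum_horDeriv, ← Finset.sum_sub_distrib]
  simp only [← mul_sub, ← h1, Finset.sum_mul, Finset.mul_sum]
  rw [Finset.sum_comm]
  exact Finset.sum_congr rfl fun i _ => Finset.sum_congr rfl fun j _ => by ring

theorem lower_thetaStar_aux (h : IsFinslerOn L Ω) {q : Coord n} (hq : q ∈ Ω) (m : Fin n) :
    ∑ k, thetaStar L k q * fundTensor L k m q =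
      ∑ i, ∑ p, ∑ j, fundTensor L i p q * star (torsion L p j m q) * q.2 i * star (q.2 j) := by
  rw [← h.lower_raise hq
    (fun m => ∑ i, ∑ p, ∑ j, fundTensor L i p q * star (torsion L p j m q) * q.2 i * star (q.2 j))]
  simp only [thetaStar, Finset.mul_sum, mul_assoc]

/-- `θ*` is orthogonal to the velocity. -/
theorem thetaStar_orthogonal (h : IsFinslerOn L Ω) {q : Coord n} (hq : q ∈ Ω) :
    ∑ k, thetaStar L k q * dEta k L q = 0 := by
  have h1 : ∑ k, thetaStar L k q * dEta k L q =
      ∑ m, star (q.2 m) * ∑ k, thetaStar L k q * fundTensor L k m q := by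
    simp only [← h.euler_fundTensor_right hq, Finset.mul_sum]
    rw [Finset.sum_comm]
    exact Finset.sum_congr rfl fun i _ => Finset.sum_congr rfl fun j _ => by ring
  -- The torsion is skew in its lower indices, both of which are contracted with η̄; exchanging them
  -- changes the sign of the sum.
  have h2 : ∑ k, thetaStar L k q * dEta k L q = -∑ k, thetaStar L k q * dEta k L q := by
    rw [h1]
    simp only [h.lower_thetaStar_aux hq, Finset.mul_sum, ← Finset.sum_neg_distrib]
    have hc : ∀ f : Fin n → Fin n → Fin n → Fin n → ℂ,
        ∑ m, ∑ i, ∑ p, ∑ j, f m i p j = ∑ i, ∑ p, ∑ m, ∑ j, f m i p j := fun f => by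
      rw [Finset.sum_comm]
      exact Finset.sum_congr rfl fun i _ => Finset.sum_comm
    have hsw : ∀ f : Fin n → Fin n → Fin n → Fin n → ℂ,
        ∑ m, ∑ i, ∑ p, ∑ j, f m i p j = ∑ m, ∑ i, ∑ p, ∑ j, f j i p m := fun f => by
      rw [hc, hc fun m i p j => f j i p m]
      exact Finset.sum_congr rfl fun i _ => Finset.sum_congr rfl fun p _ => Finset.sum_comm
    rw [hsw]
    refine Finset.sum_congr rfl fun m _ => Finset.sum_congr rfl fun i _ =>
      Finset.sum_congr rfl fun p _ => Finset.sum_congr rfl fun j _ => ?_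
    simp only [torsion, star_sub]
    ring
  linear_combination h2 / 2

/-- The lowered torsion is δ_m g_{j ī} − δ_j g_{m ī}. Contracted with η^j and η̄^i, Euler's
relations collapse the first term to ∂L/∂z^m and the second to X(∂L/∂η^m), with X the spray field;
θ* is the conjugate. -/
theorem lower_thetaStar (h : IsFinslerOn L Ω) {q : Coord n} (hq : q ∈ Ω) (m : Fin n) :
    ∑ k, thetaStar L k q * fundTensor L k m q =
      star (dz m L q - wirt (sprayField L q) (dEta m L) q) := by
  rw [h.lower_thetaStar_aux hq]
  have hs : ∀ m, DifferentiableAt ℝ (fun q : Coord n => star (q.2 m)) q := fun m =>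
    differentiableAt_star (by fun_prop)
  have hd : ∀ l m, DifferentiableAt ℝ (fundTensor L l m) q := fun l m =>
    (h.smooth_fundTensor hq l m).differentiableAt (by simp)
  have hdL : ∀ l, DifferentiableAt ℝ (dEta l L) q := fun l =>
    (h.smooth_dEta hq l).differentiableAt (by simp)
  have hor : ∀ j k, horDeriv L k (dEta j L) q =
      ∑ i, star (q.2 i) * horDeriv L k (fundTensor L j i) q := fun j k => by
    have : horDeriv L k (dEta j L) q =
        horDeriv L k (fun p => ∑ i, star (p.2 i) * fundTensor L j i p) q := by
      rw [horDeriv_eq_wirt, horDeriv_eq_wirt]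
      refine wirt_congr ?_ _
      filter_upwards [h.mem_nhds hq] with p hp using (h.euler_fundTensor_right hp j).symm
    rw [this, horDeriv_eq_wirt, wirt_sum _ fun i _ => DifferentiableAt.fun_mul (hs i) (hd j i)]
    refine Finset.sum_congr rfl fun i _ => ?_
    rw [wirt_mul (hs i) (hd j i), wirt_eta_star, horDeriv_eq_wirt]
    ring
  have hdz : ∑ j, q.2 j * horDeriv L m (dEta j L) q = dz m L q := by
    have h1 : horDeriv L m L q = horDeriv L m (fun p => ∑ j, p.2 j * dEta j L p) q := by
      rw [horDeriv_eq_wirt, horDeriv_eq_wirt]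
      refine wirt_congr ?_ _
      filter_upwards [h.mem_nhds hq] with p hp using (h.euler hp).1.symm
    rw [horDeriv_eq_wirt L m fun p => ∑ j, p.2 j * dEta j L p,
      wirt_sum _ fun j _ => DifferentiableAt.fun_mul (by fun_prop) (hdL j)] at h1
    have h3 : ∀ j, wirt (Pi.single m 1, fun i => -nonlinConn L i m q)
        (fun p : Coord n => p.2 j * dEta j L p) q =
        -(nonlinConn L j m q * dEta j L q) + q.2 j * horDeriv L m (dEta j L) q := fun j => by
      rw [wirt_mul (by fun_prop) (hdL j), wirt_eta, horDeriv_eq_wirt]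
      ring
    simp only [h3, Finset.sum_add_distrib, Finset.sum_neg_distrib] at h1
    rw [horDeriv] at h1
    linear_combination -h1
  have key : dz m L q - wirt (sprayField L q) (dEta m L) q =
      ∑ i, ∑ p, ∑ j, fundTensor L p i q * torsion L p j m q * star (q.2 i) * q.2 j := by
    have h1 : ∀ j i, ∑ p, torsion L p j m q * fundTensor L p i q =
        horDeriv L m (fundTensor L j i) q - horDeriv L j (fundTensor L m i) q := fun j i => by
      simp only [torsion, sub_mul, Finset.sum_sub_distrib, h.lower_horCoeff hq]
    rw [← hdz, ← sum_horDeriv, ← Finset.sum_sub_distrib]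
    have h2 : ∀ j, q.2 j * horDeriv L m (dEta j L) q - q.2 j * horDeriv L j (dEta m L) q =
        ∑ i, q.2 j * star (q.2 i) * ∑ p, torsion L p j m q * fundTensor L p i q := fun j => by
      simp only [hor, h1, Finset.mul_sum, ← Finset.sum_sub_distrib]
      exact Finset.sum_congr rfl fun i _ => by ring
    simp only [h2, Finset.mul_sum]
    rw [Finset.sum_comm]
    refine Finset.sum_congr rfl fun i _ => ?_
    rw [Finset.sum_comm]
    exact Finset.sum_congr rfl fun p _ => Finset.sum_congr rfl fun j _ => by ring
  rw [key]
  simp only [star_sum, star_mul', star_star]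
  refine Finset.sum_congr rfl fun i _ => Finset.sum_congr rfl fun p _ =>
    Finset.sum_congr rfl fun j _ => ?_
  rw [h.star_fundTensor hq]

theorem thetaStar_eq_zero_of_kahler {q : Coord n}
    (hK : ∀ i k, ∑ j, torsion L i j k q * q.2 j = 0) (k : Fin n) : thetaStar L k q = 0 := by
  rw [thetaStar]
  refine Finset.sum_eq_zero fun m _ => Finset.sum_eq_zero fun i _ => Finset.sum_eq_zero fun p _ => ?_
  have : ∑ j, fundInv L m k q * fundTensor L i p q * star (torsion L p j m q) * q.2 i
      * star (q.2 j) = fundInv L m k q * fundTensor L i p q * q.2 i *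
        star (∑ j, torsion L p j m q * q.2 j) := by
    simp only [star_sum, star_mul', Finset.mul_sum]
    exact Finset.sum_congr rfl fun j _ => by ring
  rw [this, hK, star_zero, mul_zero]

/-- The `η^k`-derivative of a function that is constant along the spray field. -/
theorem dEta_sprayField (h : IsFinslerOn L Ω) {p : Coord n} (hp : p ∈ Ω) {f : Coord n → ℂ}
    (hf : ContDiffAt ℝ ∞ f p) (h0 : ∀ q ∈ Ω, wirt (sprayField L q) f q = 0) (k : Fin n) :
    dz k f p + wirt (sprayField L p) (dEta k f) p
      - 2 * ∑ i, dEta k (spray L i) p * dEta i f p = 0 := by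
  have hfz : ∀ j, ContDiffAt ℝ ∞ (dz j f) p := fun j => contDiffAt_wirt hf _
  have hfe : ∀ j, ContDiffAt ℝ ∞ (dEta j f) p := fun j => contDiffAt_wirt hf _
  have dfz : ∀ j, DifferentiableAt ℝ (dz j f) p := fun j => (hfz j).differentiableAt (by simp)
  have dfe : ∀ j, DifferentiableAt ℝ (dEta j f) p := fun j => (hfe j).differentiableAt (by simp)
  have dG : ∀ i, DifferentiableAt ℝ (spray L i) p := fun i =>
    (h.smooth_spray hp i).differentiableAt (by simp)
  have dη : ∀ j, DifferentiableAt ℝ (fun q : Coord n => q.2 j) p := fun j => by fun_prop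
  have h1 : dEta k (fun q => ∑ j, q.2 j * dz j f q - 2 * ∑ i, spray L i q * dEta i f q) p = 0 := by
    refine wirt_eq_zero_of_eventually ?_ _
    filter_upwards [h.mem_nhds hp] with q hq
    have := h0 q hq
    rw [sprayField, wirt_coord] at this
    simpa [Finset.mul_sum, mul_assoc, sub_eq_add_neg] using this
  have d1 : ∀ j, DifferentiableAt ℝ (fun q : Coord n => q.2 j * dz j f q) p := fun j =>
    (dη j).fun_mul (dfz j)
  have d2 : ∀ j, DifferentiableAt ℝ (fun q : Coord n => spray L j q * dEta j f q) p := fun j =>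
    (dG j).fun_mul (dfe j)
  have e1 : ∀ j, wirt (0, Pi.single k 1) (fun q : Coord n => q.2 j * dz j f q) p =
      (Pi.single k 1 : Fin n → ℂ) j * dz j f p + p.2 j * dz j (dEta k f) p := fun j => by
    rw [wirt_mul (dη j) (dfz j), wirt_eta]
    congr 2
    exact wirt_comm hf _ _
  have e2 : ∀ j, wirt (0, Pi.single k 1) (fun q : Coord n => spray L j q * dEta j f q) p =
      dEta k (spray L j) p * dEta j f p + spray L j p * dEta j (dEta k f) p := fun j => by
    rw [wirt_mul (dG j) (dfe j)]
    congr 2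
    exact wirt_comm hf _ _
  have e3 : ∑ i, (Pi.single k 1 : Fin n → ℂ) i * dz i f p = dz k f p := by
    rw [Finset.sum_eq_single k] <;> simp +contextual
  rw [dEta, wirt_sub (DifferentiableAt.fun_sum fun j _ => d1 j)
    ((DifferentiableAt.fun_sum fun j _ => d2 j).const_mul 2),
    wirt_const_mul (DifferentiableAt.fun_sum fun j _ => d2 j), wirt_sum _ fun j _ => d1 j,
    wirt_sum _ fun j _ => d2 j] at h1
  simp only [e1, e2, Finset.sum_add_distrib, e3] at h1
  rw [sprayField, wirt_coord]
  simp only [neg_mul, Finset.sum_neg_distrib, mul_assoc, ← Finset.mul_sum]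
  linear_combination h1

/-- A weakly Kähler metric satisfies `∂L/∂z^k = (∂G^i/∂η^k) ∂L/∂η^i`. -/
theorem dz_eq_of_thetaStar_eq_zero (h : IsFinslerOn L Ω)
    (hθ : ∀ p ∈ Ω, ∀ k, thetaStar L k p = 0) {p : Coord n} (hp : p ∈ Ω) (k : Fin n) :
    dz k L p = ∑ i, dEta k (spray L i) p * dEta i L p := by
  have h1 := h.dEta_sprayField hp (h.smooth p hp) (fun q hq => h.sprayField_self hq) k
  have h2 := h.lower_thetaStar hp k
  simp only [hθ p hp, zero_mul, Finset.sum_const_zero] at h2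
  have h3 := star_eq_zero.1 h2.symm
  -- Vanishing of θ* replaces X(∂L/∂η^k) by ∂L/∂z^k in the derivative of X L = 0, so the base
  -- derivative appears twice.
  linear_combination (h1 + h3) / 2

/-- A generalized Berwald metric that is weakly Kähler is Kähler. -/
theorem kahler_of_thetaStar_eq_zero (h : IsFinslerOn L Ω)
    (hB : ∀ p ∈ Ω, ∀ i k, dEtaBar k (spray L i) p = 0)
    (hθ : ∀ p ∈ Ω, ∀ k, thetaStar L k p = 0) {p : Coord n} (hp : p ∈ Ω) (i k : Fin n) :
    ∑ j, torsion L i j k p * p.2 j = 0 := by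
  refine h.eq_zero_of_lower hp (x := fun i => ∑ j, torsion L i j k p * p.2 j) (fun m => ?_) i
  rw [h.lower_torsion hp]
  have dG : ∀ i, DifferentiableAt ℝ (dEta k (spray L i)) p := fun i =>
    (contDiffAt_wirt (h.smooth_spray hp i) _).differentiableAt (by simp)
  have dL : ∀ i, DifferentiableAt ℝ (dEta i L) p := fun i =>
    (h.smooth_dEta hp i).differentiableAt (by simp)
  -- The weakly Kähler identity is differentiated in η̄^m; ∂G^i/∂η^k contributes nothing because G
  -- is holomorphic in the fibre.
  have h1 : dz k (dEtaBar m L) p = ∑ i, dEta k (spray L i) p * fundTensor L i m p := by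
    have e1 : dz k (dEtaBar m L) p = dEtaBar m (dz k L) p := wirt_wirtBar_comm (h.smooth p hp) _ _
    have e2 : dEtaBar m (dz k L) p =
        dEtaBar m (fun q => ∑ i, dEta k (spray L i) q * dEta i L q) p := by
      refine wirtBar_congr ?_ _
      filter_upwards [h.mem_nhds hp] with q hq using h.dz_eq_of_thetaStar_eq_zero hθ hq k
    rw [e1, e2, dEtaBar, wirtBar_sum _ fun i _ => (dG i).fun_mul (dL i)]
    refine Finset.sum_congr rfl fun i _ => ?_
    have e3 : wirtBar (0, Pi.single m 1) (dEta k (spray L i)) p = 0 := by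
      have : wirtBar (0, Pi.single m 1) (dEta k (spray L i)) p =
        dEta k (dEtaBar m (spray L i)) p := (wirt_wirtBar_comm (h.smooth_spray hp i) _ _).symm
      rw [this]
      refine wirt_eq_zero_of_eventually ?_ _
      filter_upwards [h.mem_nhds hp] with q hq using hB q hq i m
    have e4 : wirtBar (0, Pi.single m 1) (dEta i L) p = fundTensor L i m p :=
      (wirt_wirtBar_comm (h.smooth p hp) _ _).symm
    rw [wirtBar_mul (dG i) (dL i), e3, e4]
    ring
  -- A second expression for the same quantity, from X(∂L/∂η̄^m) = 0. Combined with `h1` it gives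
  -- ∂_k(∂L/∂η̄^m) = X(g_{k m̄}), which is the vanishing of the lowered Kähler tensor.
  have h2 := h.dEta_sprayField hp (h.smooth_dEtaBar hp m) (fun q hq => h.lower_spray hq m) k
  have h3 : ∑ i, dEta k (spray L i) p * dEta i (dEtaBar m L) p = dz k (dEtaBar m L) p := h1.symm
  rw [h3] at h2
  have h4 : wirt (sprayField L p) (fundTensor L k m) p =
    wirt (sprayField L p) (dEta k (dEtaBar m L)) p := rfl
  rw [h4]
  linear_combination -h2

end IsFinslerOn

end CFinsler

end

noncomputable section

namespace CFinsler

variable {n : ℕ}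

/-! ## Complex Randers metrics in coordinates -/

theorem wirt_fst {f : (Fin n → ℂ) → ℂ} {p : Coord n} (hf : DifferentiableAt ℝ f p.1) (v : Coord n) :
    wirt v (fun q : Coord n => f q.1) p = wirt v.1 f p.1 := by
  rw [wirt_comp (g := fun q : Coord n => q.1) hf (by fun_prop)]
  have : HasFDerivAt (fun q : Coord n => q.1)
    (ContinuousLinearMap.fst ℂ (Fin n → ℂ) (Fin n → ℂ)) p := hasFDerivAt_fst
  rw [this.fderiv]; rfl

theorem wirtBar_fst {f : (Fin n → ℂ) → ℂ} {p : Coord n} (hf : DifferentiableAt ℝ f p.1)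
    (v : Coord n) : wirtBar v (fun q : Coord n => f q.1) p = wirtBar v.1 f p.1 := by
  rw [wirtBar_comp (g := fun q : Coord n => q.1) hf (by fun_prop)]
  have : HasFDerivAt (fun q : Coord n => q.1)
    (ContinuousLinearMap.fst ℂ (Fin n → ℂ) (Fin n → ℂ)) p := hasFDerivAt_fst
  rw [this.fderiv]; rfl

theorem differentiableAt_div {V : Type*} [NormedAddCommGroup V] [NormedSpace ℝ V] {f g : V → ℂ}
    {p : V} (hf : DifferentiableAt ℝ f p) (hg : DifferentiableAt ℝ g p) (h : g p ≠ 0) :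
    DifferentiableAt ℝ (fun q => f q / g q) p := by
  simp only [div_eq_mul_inv]
  exact hf.fun_mul (hg.inv h)

/-- A Hermitian metric and a `(1,0)`-form in coordinates over an open set `V`. -/
structure LocalRanders (n : ℕ) where
  V : Set (Fin n → ℂ)
  isOpen : IsOpen V
  a : Fin n → Fin n → (Fin n → ℂ) → ℂ
  b : Fin n → (Fin n → ℂ) → ℂ
  smooth_a : ∀ i j, ∀ z ∈ V, ContDiffAt ℝ ∞ (a i j) z
  smooth_b : ∀ i, ∀ z ∈ V, ContDiffAt ℝ ∞ (b i) z
  herm : ∀ i j z, star (a i j z) = a j i z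
  pos : ∀ z ∈ V, ∀ η, η ≠ 0 → 0 < (sesqForm (fun i j => a i j z) η η).re
  nonneg : ∀ z η, 0 ≤ (sesqForm (fun i j => a i j z) η η).re

namespace LocalRanders

variable (R : LocalRanders n)

/-- The matrix `a_{i j̄}(z)`. -/
abbrev aAt (z : Fin n → ℂ) (i j : Fin n) : ℂ := R.a i j z

/-- The covector `b_i(z)`. -/
abbrev bAt (z : Fin n → ℂ) (i : Fin n) : ℂ := R.b i z

/-- `α² = a_{i j̄} η^i η̄^j`. -/
def A (p : Coord n) : ℂ := sesqForm (R.aAt p.1) p.2 p.2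

/-- `β = b_i η^i`. -/
def beta (p : Coord n) : ℂ := linForm (R.bAt p.1) p.2

/-- `α`, as a complex-valued function. -/
def alpha (p : Coord n) : ℂ := ((√(R.A p).re : ℝ) : ℂ)

/-- `|β|`, as a complex-valued function. -/
def nu (p : Coord n) : ℂ := ((‖R.beta p‖ : ℝ) : ℂ)

/-- The Randers metric `α + |β|`. -/
def F (p : Coord n) : ℂ := R.alpha p + R.nu p

/-- The square of the Randers metric. -/
def L (p : Coord n) : ℂ := R.F p * R.F p

/-- The coordinate domain of the holomorphic tangent bundle. -/
def U : Set (Coord n) := {p | p.1 ∈ R.V}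

/-- The domain `β ≠ 0`. -/
def Om : Set (Coord n) := {p | p.1 ∈ R.V ∧ R.beta p ≠ 0}

/-- The lowered velocity `a_{i m̄} η^i`. -/
def low (m : Fin n) (p : Coord n) : ℂ := ∑ i, R.a i m p.1 * p.2 i

variable {R}

theorem star_sesqForm (z ξ ζ : Fin n → ℂ) :
    star (sesqForm (R.aAt z) ξ ζ) = sesqForm (R.aAt z) ζ ξ := by
  simp only [sesqForm, star_sum, star_mul', star_star, R.herm]
  rw [Finset.sum_comm]
  exact Finset.sum_congr rfl fun i _ => Finset.sum_congr rfl fun j _ => by ring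

theorem A_eq_conjForm (p : Coord n) : R.A p = conjForm (fun m => R.low m p) p.2 :=
  sesqForm_eq_conjForm _ _ _

theorem star_A (p : Coord n) : star (R.A p) = R.A p := star_sesqForm p.1 p.2 p.2

theorem A_re (p : Coord n) : R.A p = ((R.A p).re : ℂ) :=
  (Complex.conj_eq_iff_re.1 (star_A p)).symm

/-- The identity holds at every point because `herm` and `nonneg` are not restricted to `V`; it can
thus be differentiated as an equality of functions. -/
theorem alpha_mul_alpha (p : Coord n) : R.alpha p * R.alpha p = R.A p := by
  have h : 0 ≤ (R.A p).re := R.nonneg p.1 p.2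
  rw [A_re, alpha, ← Complex.ofReal_mul, Real.mul_self_sqrt h]

theorem nu_mul_nu (p : Coord n) : R.nu p * R.nu p = R.beta p * star (R.beta p) := by
  have := Complex.mul_conj (R.beta p)
  rw [nu, ← Complex.ofReal_mul, ← sq, ← Complex.normSq_eq_norm_sq, ← this]; rfl

theorem Om_subset_U : R.Om ⊆ R.U := fun _ hp => hp.1

theorem snd_ne_zero {p : Coord n} (hp : p ∈ R.Om) : p.2 ≠ 0 := fun h => hp.2 (by
  simp [beta, linForm, h])

theorem A_re_pos {p : Coord n} (hp : p ∈ R.Om) : 0 < (R.A p).re :=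
  R.pos p.1 hp.1 p.2 (snd_ne_zero hp)

theorem alpha_ne_zero {p : Coord n} (hp : p ∈ R.Om) : R.alpha p ≠ 0 := by
  simpa [alpha] using (Real.sqrt_pos.2 (A_re_pos hp)).ne'

theorem nu_ne_zero {p : Coord n} (hp : p ∈ R.Om) : R.nu p ≠ 0 := by
  simpa [nu] using hp.2

theorem F_pos {p : Coord n} (hp : p ∈ R.Om) : ∃ r : ℝ, 0 < r ∧ R.F p = r :=
  ⟨√(R.A p).re + ‖R.beta p‖, add_pos_of_pos_of_nonneg (Real.sqrt_pos.2 (A_re_pos hp)) (norm_nonneg _),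
    by simp [F, alpha, nu]⟩

theorem F_ne_zero {p : Coord n} (hp : p ∈ R.Om) : R.F p ≠ 0 := by
  obtain ⟨r, hr, h⟩ := F_pos hp
  rw [h]; exact_mod_cast hr.ne'

theorem star_alpha (p : Coord n) : star (R.alpha p) = R.alpha p := Complex.conj_ofReal _

theorem star_nu (p : Coord n) : star (R.nu p) = R.nu p := Complex.conj_ofReal _

theorem star_F (p : Coord n) : star (R.F p) = R.F p := by rw [F, star_add, star_alpha, star_nu]

theorem star_L (p : Coord n) : star (R.L p) = R.L p := by rw [L, star_mul', star_F]

theorem smooth_a_fst (i j : Fin n) {p : Coord n} (hp : p ∈ R.U) :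
    ContDiffAt ℝ ∞ (fun q : Coord n => R.a i j q.1) p :=
  (R.smooth_a i j p.1 hp).comp p contDiffAt_fst

theorem smooth_b_fst (i : Fin n) {p : Coord n} (hp : p ∈ R.U) :
    ContDiffAt ℝ ∞ (fun q : Coord n => R.b i q.1) p :=
  (R.smooth_b i p.1 hp).comp p contDiffAt_fst

theorem smooth_eta (i : Fin n) (p : Coord n) : ContDiffAt ℝ ∞ (fun q : Coord n => q.2 i) p := by
  fun_prop

theorem smooth_low (m : Fin n) {p : Coord n} (hp : p ∈ R.U) : ContDiffAt ℝ ∞ (R.low m) p :=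
  ContDiffAt.sum fun i _ => (smooth_a_fst i m hp).mul (smooth_eta i p)

theorem smooth_A {p : Coord n} (hp : p ∈ R.U) : ContDiffAt ℝ ∞ R.A p := by
  rw [funext A_eq_conjForm]
  exact ContDiffAt.sum fun m _ => (smooth_low m hp).mul (contDiffAt_star (smooth_eta m p))

theorem smooth_beta {p : Coord n} (hp : p ∈ R.U) : ContDiffAt ℝ ∞ R.beta p := by
  have : R.beta = fun q : Coord n => ∑ i, R.b i q.1 * q.2 i := rfl
  rw [this]
  exact ContDiffAt.sum fun i _ => (smooth_b_fst i hp).mul (smooth_eta i p)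

theorem smooth_alpha {p : Coord n} (hp : p ∈ R.Om) : ContDiffAt ℝ ∞ R.alpha p := by
  have h1 : ContDiffAt ℝ ∞ (fun q => (R.A q).re) p :=
    Complex.reCLM.contDiff.contDiffAt.comp p (smooth_A hp.1)
  exact Complex.ofRealCLM.contDiff.contDiffAt.comp p (h1.sqrt (A_re_pos hp).ne')

theorem smooth_nu {p : Coord n} (hp : p ∈ R.Om) : ContDiffAt ℝ ∞ R.nu p :=
  Complex.ofRealCLM.contDiff.contDiffAt.comp p ((smooth_beta hp.1).norm ℝ hp.2)

theorem smooth_F {p : Coord n} (hp : p ∈ R.Om) : ContDiffAt ℝ ∞ R.F p :=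
  (smooth_alpha hp).add (smooth_nu hp)

theorem smooth_L {p : Coord n} (hp : p ∈ R.Om) : ContDiffAt ℝ ∞ R.L p :=
  (smooth_F hp).mul (smooth_F hp)

theorem isOpen_U : IsOpen R.U := R.isOpen.preimage continuous_fst

theorem isOpen_Om : IsOpen R.Om := by
  rw [isOpen_iff_mem_nhds]
  intro p hp
  filter_upwards [isOpen_U.mem_nhds (Om_subset_U hp),
    (smooth_beta hp.1).continuousAt.eventually_ne hp.2] with q h1 h2 using ⟨h1, h2⟩

/-! ### First derivatives -/

theorem diff_a (i j : Fin n) {z : Fin n → ℂ} (hz : z ∈ R.V) : DifferentiableAt ℝ (R.a i j) z :=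
  (R.smooth_a i j z hz).differentiableAt (by simp)

theorem diff_b (i : Fin n) {z : Fin n → ℂ} (hz : z ∈ R.V) : DifferentiableAt ℝ (R.b i) z :=
  (R.smooth_b i z hz).differentiableAt (by simp)

theorem diff_low (m : Fin n) {p : Coord n} (hp : p ∈ R.U) : DifferentiableAt ℝ (R.low m) p :=
  (smooth_low m hp).differentiableAt (by simp)

theorem diff_beta {p : Coord n} (hp : p ∈ R.U) : DifferentiableAt ℝ R.beta p :=
  (smooth_beta hp).differentiableAt (by simp)

theorem diff_alpha {p : Coord n} (hp : p ∈ R.Om) : DifferentiableAt ℝ R.alpha p :=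
  (smooth_alpha hp).differentiableAt (by simp)

theorem diff_nu {p : Coord n} (hp : p ∈ R.Om) : DifferentiableAt ℝ R.nu p :=
  (smooth_nu hp).differentiableAt (by simp)

theorem diff_F {p : Coord n} (hp : p ∈ R.Om) : DifferentiableAt ℝ R.F p :=
  (smooth_F hp).differentiableAt (by simp)

theorem wirt_low {p : Coord n} (hp : p ∈ R.U) (v : Coord n) (m : Fin n) :
    wirt v (R.low m) p = ∑ i, (wirt v.1 (R.a i m) p.1 * p.2 i + R.a i m p.1 * v.2 i) := by
  have d1 : ∀ i, DifferentiableAt ℝ (fun q : Coord n => R.a i m q.1) p := fun i =>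
    (smooth_a_fst i m hp).differentiableAt (by simp)
  have d2 : ∀ i, DifferentiableAt ℝ (fun q : Coord n => q.2 i) p := fun i => by fun_prop
  unfold low
  rw [wirt_sum _ fun i _ => (d1 i).fun_mul (d2 i)]
  refine Finset.sum_congr rfl fun i _ => ?_
  rw [wirt_mul (d1 i) (d2 i), wirt_fst (diff_a i m hp), wirt_eta]

theorem wirtBar_low {p : Coord n} (hp : p ∈ R.U) (w : Fin n → ℂ) (m : Fin n) :
    wirtBar (0, w) (R.low m) p = 0 := by
  have d1 : ∀ i, DifferentiableAt ℝ (fun q : Coord n => R.a i m q.1) p := fun i =>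
    (smooth_a_fst i m hp).differentiableAt (by simp)
  have d2 : ∀ i, DifferentiableAt ℝ (fun q : Coord n => q.2 i) p := fun i => by fun_prop
  unfold low
  rw [wirtBar_sum _ fun i _ => (d1 i).fun_mul (d2 i)]
  refine Finset.sum_eq_zero fun i _ => ?_
  rw [wirtBar_mul (d1 i) (d2 i), wirtBar_fst (diff_a i m hp), wirtBar_eta_apply, wirtBar_zero_left]
  ring

theorem wirt_A {p : Coord n} (hp : p ∈ R.U) (v : Coord n) :
    wirt v R.A p = conjForm
      (fun m => ∑ i, (wirt v.1 (R.a i m) p.1 * p.2 i + R.a i m p.1 * v.2 i)) p.2 := by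
  have hs : ∀ m, DifferentiableAt ℝ (fun q : Coord n => star (q.2 m)) p := fun m =>
    differentiableAt_star (by fun_prop)
  rw [funext A_eq_conjForm]
  unfold conjForm
  rw [wirt_sum _ fun m _ => (diff_low m hp).fun_mul (hs m)]
  refine Finset.sum_congr rfl fun m _ => ?_
  rw [wirt_mul (diff_low m hp) (hs m), wirt_low hp, wirt_eta_star]
  ring

theorem wirtBar_A {p : Coord n} (hp : p ∈ R.U) (w : Fin n → ℂ) :
    wirtBar (0, w) R.A p = conjForm (fun m => R.low m p) w := by
  have hs : ∀ m, DifferentiableAt ℝ (fun q : Coord n => star (q.2 m)) p := fun m =>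
    differentiableAt_star (by fun_prop)
  rw [funext A_eq_conjForm]
  unfold conjForm
  rw [wirtBar_sum _ fun m _ => (diff_low m hp).fun_mul (hs m)]
  refine Finset.sum_congr rfl fun m _ => ?_
  rw [wirtBar_mul (diff_low m hp) (hs m), wirtBar_low hp, wirtBar_eta_star]
  ring

theorem dEtaBar_A {p : Coord n} (hp : p ∈ R.U) (m : Fin n) : dEtaBar m R.A p = R.low m p := by
  rw [dEtaBar, wirtBar_A hp, conjForm_single]

theorem dEta_A {p : Coord n} (hp : p ∈ R.U) (m : Fin n) : dEta m R.A p = star (R.low m p) := by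
  rw [dEta, wirt_eq_star_wirtBar star_A, wirtBar_A hp, conjForm_single]

theorem wirt_beta {p : Coord n} (hp : p ∈ R.U) (v : Coord n) :
    wirt v R.beta p = ∑ i, (wirt v.1 (R.b i) p.1 * p.2 i + R.b i p.1 * v.2 i) := by
  have d1 : ∀ i, DifferentiableAt ℝ (fun q : Coord n => R.b i q.1) p := fun i =>
    (smooth_b_fst i hp).differentiableAt (by simp)
  have d2 : ∀ i, DifferentiableAt ℝ (fun q : Coord n => q.2 i) p := fun i => by fun_prop
  have : R.beta = fun q : Coord n => ∑ i, R.b i q.1 * q.2 i := rfl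
  rw [this, wirt_sum _ fun i _ => (d1 i).fun_mul (d2 i)]
  refine Finset.sum_congr rfl fun i _ => ?_
  rw [wirt_mul (d1 i) (d2 i), wirt_fst (diff_b i hp), wirt_eta]

theorem wirtBar_beta {p : Coord n} (hp : p ∈ R.U) (v : Coord n) :
    wirtBar v R.beta p = ∑ i, wirtBar v.1 (R.b i) p.1 * p.2 i := by
  have d1 : ∀ i, DifferentiableAt ℝ (fun q : Coord n => R.b i q.1) p := fun i =>
    (smooth_b_fst i hp).differentiableAt (by simp)
  have d2 : ∀ i, DifferentiableAt ℝ (fun q : Coord n => q.2 i) p := fun i => by fun_prop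
  have : R.beta = fun q : Coord n => ∑ i, R.b i q.1 * q.2 i := rfl
  rw [this, wirtBar_sum _ fun i _ => (d1 i).fun_mul (d2 i)]
  refine Finset.sum_congr rfl fun i _ => ?_
  rw [wirtBar_mul (d1 i) (d2 i), wirtBar_fst (diff_b i hp), wirtBar_eta_apply, mul_zero, add_zero]

theorem wirt_star_beta {p : Coord n} (hp : p ∈ R.U) (v : Coord n) :
    wirt v (fun q => star (R.beta q)) p =
      conjForm (fun m => wirt v.1 (fun z => star (R.b m z)) p.1) p.2 := by
  rw [wirt_star, wirtBar_beta hp]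
  simp only [conjForm, star_sum, star_mul', wirt_star]

theorem wirt_alpha {p : Coord n} (hp : p ∈ R.Om) (v : Coord n) :
    wirt v R.alpha p = wirt v R.A p / (2 * R.alpha p) := by
  have h := alpha_ne_zero hp
  rw [← funext alpha_mul_alpha, wirt_mul (diff_alpha hp) (diff_alpha hp)]
  field_simp; ring

theorem wirt_nu {p : Coord n} (hp : p ∈ R.Om) (v : Coord n) :
    wirt v R.nu p = (wirt v R.beta p * star (R.beta p) +
      R.beta p * wirt v (fun q => star (R.beta q)) p) / (2 * R.nu p) := by
  have h := nu_ne_zero hp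
  have hb := diff_beta hp.1
  rw [← wirt_mul hb (differentiableAt_star hb), ← funext nu_mul_nu,
    wirt_mul (diff_nu hp) (diff_nu hp)]
  field_simp; ring

theorem wirt_L {p : Coord n} (hp : p ∈ R.Om) (v : Coord n) :
    wirt v R.L p = 2 * R.F p * wirt v R.F p := by
  have : R.L = fun q => R.F q * R.F q := rfl
  rw [this, wirt_mul (diff_F hp) (diff_F hp)]; ring

theorem wirt_F {p : Coord n} (hp : p ∈ R.Om) (v : Coord n) :
    wirt v R.F p = wirt v R.alpha p + wirt v R.nu p :=
  wirt_add (diff_alpha hp) (diff_nu hp) v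

theorem dEta_alpha {p : Coord n} (hp : p ∈ R.Om) (i : Fin n) :
    wirt (0, Pi.single i 1) R.alpha p = star (R.low i p) / (2 * R.alpha p) := by
  rw [wirt_alpha hp, ← dEta_A hp.1]; rfl

theorem sum_mul_single (f : Fin n → ℂ) (i : Fin n) :
    ∑ j, f j * (Pi.single i 1 : Fin n → ℂ) j = f i := by
  rw [Finset.sum_eq_single i] <;> simp +contextual

theorem dEta_beta {p : Coord n} (hp : p ∈ R.U) (i : Fin n) :
    wirt (0, Pi.single i 1) R.beta p = R.b i p.1 := by
  rw [wirt_beta hp]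
  simp only [wirt_zero_left, zero_mul, zero_add, sum_mul_single]

theorem dEta_nu {p : Coord n} (hp : p ∈ R.Om) (i : Fin n) :
    wirt (0, Pi.single i 1) R.nu p = R.b i p.1 * star (R.beta p) / (2 * R.nu p) := by
  rw [wirt_nu hp, dEta_beta hp.1, wirt_star_beta hp.1]
  simp [wirt_zero_left, conjForm]

theorem dEta_F {p : Coord n} (hp : p ∈ R.Om) (i : Fin n) :
    wirt (0, Pi.single i 1) R.F p =
      (star (R.low i p) / R.alpha p + R.b i p.1 * star (R.beta p) / R.nu p) / 2 := by
  rw [wirt_F hp, dEta_alpha hp, dEta_nu hp]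
  have := alpha_ne_zero hp
  have := nu_ne_zero hp
  field_simp

theorem dEta_L {p : Coord n} (hp : p ∈ R.Om) (i : Fin n) :
    dEta i R.L p =
      R.F p * (star (R.low i p) / R.alpha p + R.b i p.1 * star (R.beta p) / R.nu p) := by
  rw [dEta, wirt_L hp, dEta_F hp]; ring

variable (R) in
/-- `K_m = 2 ∂F/∂η̄^m`. -/
def K (m : Fin n) (p : Coord n) : ℂ :=
  R.low m p / R.alpha p + R.beta p * star (R.b m p.1) / R.nu p

theorem dEtaBar_L {p : Coord n} (hp : p ∈ R.Om) (m : Fin n) :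
    dEtaBar m R.L p = R.F p * R.K m p := by
  rw [dEtaBar, wirtBar_eq_star_wirt star_L]
  have := dEta_L hp m
  rw [dEta] at this
  rw [this, K]
  simp only [star_mul', star_add, star_div₀, star_star, star_F, star_alpha, star_nu]
  ring

theorem wirt_K {p : Coord n} (hp : p ∈ R.Om) (v : Coord n) (m : Fin n) :
    wirt v (R.K m) p =
      wirt v (R.low m) p / R.alpha p - R.low m p * wirt v R.alpha p / R.alpha p ^ 2
      + (wirt v R.beta p / R.nu p - R.beta p * wirt v R.nu p / R.nu p ^ 2) * star (R.b m p.1)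
      + R.beta p / R.nu p * wirt v.1 (fun z => star (R.b m z)) p.1 := by
  have hα := alpha_ne_zero hp
  have hν := nu_ne_zero hp
  have d1 : DifferentiableAt ℝ (fun q => R.low m q / R.alpha q) p :=
    differentiableAt_div (diff_low m hp.1) (diff_alpha hp) hα
  have d2 : DifferentiableAt ℝ (fun q => R.beta q / R.nu q) p :=
    differentiableAt_div (diff_beta hp.1) (diff_nu hp) hν
  have db : DifferentiableAt ℝ (fun z => star (R.b m z)) p.1 := differentiableAt_star (diff_b m hp.1)
  have db' : DifferentiableAt ℝ (fun q : Coord n => star (R.b m q.1)) p :=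
    db.comp p differentiableAt_fst
  -- The quotient rule, read off from the product rule for (u/α)·α = u, valid near `p`.
  have e1 : wirt v (R.low m) p = wirt v (fun q => R.low m q / R.alpha q) p * R.alpha p
      + R.low m p / R.alpha p * wirt v R.alpha p := by
    rw [← wirt_mul d1 (diff_alpha hp)]
    refine wirt_congr ?_ _
    filter_upwards [isOpen_Om.mem_nhds hp] with q hq
    rw [div_mul_cancel₀ _ (alpha_ne_zero hq)]
  have e2 : wirt v R.beta p = wirt v (fun q => R.beta q / R.nu q) p * R.nu p
      + R.beta p / R.nu p * wirt v R.nu p := by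
    rw [← wirt_mul d2 (diff_nu hp)]
    refine wirt_congr ?_ _
    filter_upwards [isOpen_Om.mem_nhds hp] with q hq
    rw [div_mul_cancel₀ _ (nu_ne_zero hq)]
  have e3 : wirt v (R.K m) p = wirt v (fun q => R.low m q / R.alpha q) p +
      (wirt v (fun q => R.beta q / R.nu q) p * star (R.b m p.1)
        + R.beta p / R.nu p * wirt v.1 (fun z => star (R.b m z)) p.1) := by
    have : R.K m = fun q => R.low m q / R.alpha q + R.beta q / R.nu q * star (R.b m q.1) := by
      funext q; rw [K]; ring
    rw [this, wirt_add d1 (d2.fun_mul db'), wirt_mul d2 db', wirt_fst db]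
  rw [e3, e1, e2]
  field_simp
  ring

theorem fundTensor_A {p : Coord n} (hp : p ∈ R.U) (i m : Fin n) :
    fundTensor R.A i m p = R.a i m p.1 := by
  have : fundTensor R.A i m p = dEta i (R.low m) p := by
    refine wirt_congr ?_ _
    filter_upwards [isOpen_U.mem_nhds hp] with q hq using dEtaBar_A hq m
  rw [this, dEta, wirt_low hp]
  simp only [wirt_zero_left, zero_mul, zero_add, sum_mul_single]

theorem fundTensor_L {p : Coord n} (hp : p ∈ R.Om) (i m : Fin n) :
    fundTensor R.L i m p =
      (star (R.low i p) / R.alpha p + R.b i p.1 * star (R.beta p) / R.nu p) / 2 * R.K m p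
      + R.F p * (R.a i m p.1 / R.alpha p - R.low m p * star (R.low i p) / (2 * R.alpha p ^ 3)
        + R.b i p.1 * star (R.b m p.1) / (2 * R.nu p)) := by
  have hα := alpha_ne_zero hp
  have hν := nu_ne_zero hp
  have dK : DifferentiableAt ℝ (R.K m) p := by
    have h1 := differentiableAt_div (diff_low m hp.1) (diff_alpha hp) hα
    have db' : DifferentiableAt ℝ (fun q : Coord n => star (R.b m q.1)) p :=
      (differentiableAt_star (diff_b m hp.1)).comp p differentiableAt_fst
    have h2 := differentiableAt_div ((diff_beta hp.1).fun_mul db') (diff_nu hp) hν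
    exact h1.fun_add h2
  have e : fundTensor R.L i m p = wirt (0, Pi.single i 1) (fun q => R.F q * R.K m q) p := by
    refine wirt_congr ?_ _
    filter_upwards [isOpen_Om.mem_nhds hp] with q hq using dEtaBar_L hq m
  have e1 : wirt (0, Pi.single i 1) (R.low m) p = R.a i m p.1 := by
    rw [wirt_low hp.1]
    simp only [wirt_zero_left, zero_mul, zero_add, sum_mul_single]
  rw [e, wirt_mul (diff_F hp) dK, dEta_F hp, wirt_K hp, dEta_alpha hp, dEta_beta hp.1, dEta_nu hp, e1,
    wirt_zero_left]
  have h2 : R.beta p * star (R.beta p) = R.nu p ^ 2 := by rw [sq, nu_mul_nu]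
  congr 2
  field_simp
  linear_combination (- R.alpha p ^ 3 * R.b i p.1 * star (R.b m p.1)) * h2

end LocalRanders

end CFinsler

end

noncomputable section

namespace CFinsler

variable {n : ℕ}
namespace LocalRanders
variable {R : LocalRanders n}

/-! ### Strong pseudoconvexity -/

theorem det_isUnit_of_pos {G : Fin n → Fin n → ℂ}
    (h : ∀ x : Fin n → ℂ, x ≠ 0 → ∑ m, (∑ i, x i * G i m) * star (x m) ≠ 0) : IsUnit (Matrix.of G).det := by
  rw [isUnit_iff_ne_zero]
  intro h0
  obtain ⟨x, hx, hx0⟩ := Matrix.exists_vecMul_eq_zero_iff.2 h0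
  apply h x hx
  refine Finset.sum_eq_zero fun m _ => ?_
  have : ∑ i, x i * G i m = 0 := by simpa [Matrix.vecMul, dotProduct] using congr_fun hx0 m
  rw [this, zero_mul]

theorem sum_low (p : Coord n) (x : Fin n → ℂ) :
    ∑ m, R.low m p * star (x m) = sesqForm (R.aAt p.1) p.2 x :=
  (sesqForm_eq_conjForm _ _ _).symm

theorem sum_star_low (p : Coord n) (x : Fin n → ℂ) :
    ∑ m, x m * star (R.low m p) = sesqForm (R.aAt p.1) x p.2 := by
  rw [← star_sesqForm, ← sum_low]
  simp [star_sum, star_mul', mul_comm]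

theorem beta_scale (c : ℂ) (p : Coord n) : R.beta (scale c p) = c * R.beta p :=
  linForm_smul _ _ _

theorem A_scale (c : ℂ) (p : Coord n) : R.A (scale c p) = c * star c * R.A p := by
  simp only [A, scale_fst, scale_snd, sesqForm_smul_left, sesqForm_smul_right]; ring

theorem scale_mem_Om {p : Coord n} (hp : p ∈ R.Om) {c : ℂ} (hc : c ≠ 0) : scale c p ∈ R.Om :=
  ⟨hp.1, by rw [beta_scale]; exact mul_ne_zero hc hp.2⟩

theorem F_scale (c : ℂ) (p : Coord n) : R.F (scale c p) = ‖c‖ * R.F p := by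
  have h1 : (R.A (scale c p)).re = ‖c‖ ^ 2 * (R.A p).re := by
    have : c * star c = ((‖c‖ ^ 2 : ℝ) : ℂ) := by
      rw [← Complex.normSq_eq_norm_sq]; exact Complex.mul_conj c
    rw [A_scale, this, Complex.re_ofReal_mul]
  simp only [F, alpha, nu, h1, beta_scale, norm_mul]
  rw [Real.sqrt_mul (by positivity), Real.sqrt_sq (norm_nonneg _)]
  push_cast; ring

theorem isFinslerOn_A : IsFinslerOn R.A R.U where
  isOpen := isOpen_U
  smooth _ hp := smooth_A hp
  homog c _ p := A_scale c p
  real := star_A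
  det p hp := by
    refine det_isUnit_of_pos fun x hx => ?_
    have h1 : ∑ m, (∑ i, x i * fundTensor R.A i m p) * star (x m) = sesqForm (R.aAt p.1) x x := by
      rw [sesqForm_eq_conjForm]
      simp only [fundTensor_A hp, conjForm, mul_comm (x _)]
    intro h0
    have := R.pos p.1 hp x hx
    rw [← h1, h0] at this
    simp at this

theorem cauchy_schwarz {z : Fin n → ℂ} (hz : z ∈ R.V) (x η : Fin n → ℂ) (hη : η ≠ 0) :
    ‖sesqForm (R.aAt z) x η‖ ^ 2 ≤
      (sesqForm (R.aAt z) x x).re * (sesqForm (R.aAt z) η η).re := by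
  set s := sesqForm (R.aAt z) x η
  set r := (sesqForm (R.aAt z) η η).re
  have hr : 0 < r := R.pos z hz η hη
  have hrr : sesqForm (R.aAt z) η η = r := (Complex.conj_eq_iff_re.1 (star_sesqForm z η η)).symm
  have hxx : sesqForm (R.aAt z) x x = (sesqForm (R.aAt z) x x).re :=
    (Complex.conj_eq_iff_re.1 (star_sesqForm z x x)).symm
  have hs : sesqForm (R.aAt z) η x = star s := (star_sesqForm z x η).symm
  -- With r = a(η, η) and s = a(x, η), the vector r x − s η is orthogonal to η; its squared length
  -- is r times the Cauchy–Schwarz defect.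
  have h0 := R.nonneg z ((r : ℂ) • x + (-s) • η)
  have h1 : sesqForm (R.aAt z) ((r : ℂ) • x + (-s) • η) ((r : ℂ) • x + (-s) • η) =
      ((r * (r * (sesqForm (R.aAt z) x x).re - ‖s‖ ^ 2) : ℝ) : ℂ) := by
    have hsr : ∀ u, sesqForm (R.aAt z) u ((r : ℂ) • x + (-s) • η) =
        r * sesqForm (R.aAt z) u x + -star s * sesqForm (R.aAt z) u η := fun u => by
      rw [sesqForm_eq_conjForm, conjForm_add, conjForm_smul, conjForm_smul,
        ← sesqForm_eq_conjForm, ← sesqForm_eq_conjForm]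
      simp
    have hss : s * star s = ((‖s‖ ^ 2 : ℝ) : ℂ) := by
      rw [← Complex.normSq_eq_norm_sq]; exact Complex.mul_conj s
    rw [sesqForm_add_left, sesqForm_smul_left, sesqForm_smul_left, hsr, hsr, hs, hrr, hxx]
    push_cast at hss ⊢
    change r * (r * _ + -star s * s) + -s * (r * star s + -star s * r) = _
    linear_combination (-(r : ℂ)) * hss
  rw [h1, Complex.ofReal_re] at h0
  nlinarith [(mul_nonneg_iff_of_pos_left hr).1 h0]

theorem isFinslerOn_L : IsFinslerOn R.L R.Om where
  isOpen := isOpen_Om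
  smooth _ hp := smooth_L hp
  homog c _ p := by
    have : c * star c = ((‖c‖ ^ 2 : ℝ) : ℂ) := by
      rw [← Complex.normSq_eq_norm_sq]; exact Complex.mul_conj c
    rw [L, F_scale, this, L]; push_cast; ring
  real := star_L
  det p hp := by
    refine det_isUnit_of_pos fun x hx => ?_
    obtain ⟨f, hf, hfF⟩ := F_pos hp
    obtain ⟨r, hr, hrα⟩ : ∃ r : ℝ, 0 < r ∧ R.alpha p = r := ⟨_, Real.sqrt_pos.2 (A_re_pos hp), rfl⟩
    obtain ⟨t, ht, htν⟩ : ∃ t : ℝ, 0 < t ∧ R.nu p = t := ⟨_, norm_pos_iff.2 hp.2, rfl⟩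
    set s := sesqForm (R.aAt p.1) x p.2 with hs
    set c := linForm (R.bAt p.1) x with hc
    set y := s / R.alpha p + c * star (R.beta p) / R.nu p with hy
    have hyx : ∑ m, R.K m p * star (x m) = star y := by
      simp only [K, add_mul, Finset.sum_add_distrib, hy, star_add, star_div₀, star_mul', star_star,
        star_alpha, star_nu, hs, star_sesqForm, ← sum_low, hc, linForm, star_sum, Finset.sum_div,
        Finset.sum_mul]
      congr 1
      · exact Finset.sum_congr rfl fun i _ => by ring
      · exact Finset.sum_congr rfl fun i _ => by ring
    have hg : ∀ m, ∑ i, x i * fundTensor R.L i m p = y / 2 * R.K m p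
        + R.F p * ((∑ i, R.a i m p.1 * x i) / R.alpha p - R.low m p * s / (2 * R.alpha p ^ 3)
          + c * star (R.b m p.1) / (2 * R.nu p)) := fun m => by
      simp only [fundTensor_L hp, hy, hs, ← sum_star_low, hc, linForm, Finset.sum_div,
        Finset.sum_mul, Finset.mul_sum, ← Finset.sum_add_distrib, ← Finset.sum_sub_distrib]
      exact Finset.sum_congr rfl fun i _ => by ring
    have hxx : sesqForm (R.aAt p.1) x x = (sesqForm (R.aAt p.1) x x).re :=
      (Complex.conj_eq_iff_re.1 (star_sesqForm p.1 x x)).symm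
    have hsq : ∀ w : ℂ, w * star w = ((‖w‖ ^ 2 : ℝ) : ℂ) := fun w => by
      rw [← Complex.normSq_eq_norm_sq]; exact Complex.mul_conj w
    have e1 : ∑ m, (∑ i, R.a i m p.1 * x i) * star (x m) = (sesqForm (R.aAt p.1) x x).re := by
      rw [← hxx, sesqForm_eq_conjForm]; rfl
    have e2 : ∑ m, R.low m p * star (x m) = star s := by rw [sum_low, hs, star_sesqForm]
    have e3 : ∑ m, star (R.b m p.1) * star (x m) = star c := by
      simp [hc, linForm, star_sum, star_mul']
    -- The Hermitian form of the fundamental tensor at x is |y|²/2 plus F̃ times a bracket. By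
    -- Cauchy–Schwarz the negative term of the bracket is at most half of the first, so the form is
    -- positive definite.
    have key : ∑ m, (∑ i, x i * fundTensor R.L i m p) * star (x m) =
        ((‖y‖ ^ 2 / 2 + f * ((sesqForm (R.aAt p.1) x x).re / r - ‖s‖ ^ 2 / (2 * r ^ 3)
          + ‖c‖ ^ 2 / (2 * t)) : ℝ) : ℂ) := by
      have : ∑ m, (∑ i, x i * fundTensor R.L i m p) * star (x m) =
          y / 2 * ∑ m, R.K m p * star (x m) +
          R.F p * ((∑ m, (∑ i, R.a i m p.1 * x i) * star (x m)) / R.alpha p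
            - (∑ m, R.low m p * star (x m)) * s / (2 * R.alpha p ^ 3)
            + c * (∑ m, star (R.b m p.1) * star (x m)) / (2 * R.nu p)) := by
        simp only [hg, Finset.mul_sum, Finset.sum_div, Finset.sum_mul, ← Finset.sum_add_distrib,
          ← Finset.sum_sub_distrib]
        refine Finset.sum_congr rfl fun m _ => ?_
        simp only [← Finset.sum_div, ← Finset.sum_mul]
        ring
      rw [this, hyx, e1, e2, e3, hfF, hrα, htν]
      push_cast
      have h1 := hsq y
      have h2 := hsq s
      have h3 := hsq c
      push_cast at h1 h2 h3
      linear_combination h1 / 2 - f / (2 * r ^ 3) * h2 + f / (2 * t) * h3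
    rw [key]
    have hr2 : (R.A p).re = r ^ 2 := by
      have := alpha_mul_alpha (R := R) p
      rw [hrα] at this
      have h2 := congr_arg Complex.re this
      rw [← h2, ← Complex.ofReal_mul, Complex.ofReal_re, sq]
    have hcs := cauchy_schwarz hp.1 x p.2 (snd_ne_zero hp)
    have hcs' : ‖s‖ ^ 2 ≤ (sesqForm (R.aAt p.1) x x).re * r ^ 2 := by rw [← hr2]; exact hcs
    have hpos := R.pos p.1 hp.1 x hx
    change 0 < (sesqForm (R.aAt p.1) x x).re at hpos
    have h1 : ‖s‖ ^ 2 / (2 * r ^ 3) ≤ (sesqForm (R.aAt p.1) x x).re / (2 * r) := by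
      rw [div_le_div_iff₀ (by positivity) (by positivity)]
      nlinarith [mul_le_mul_of_nonneg_right hcs' (by positivity : 0 ≤ 2 * r)]
    have h2 : 0 < (sesqForm (R.aAt p.1) x x).re / r - ‖s‖ ^ 2 / (2 * r ^ 3) := by
      have : (sesqForm (R.aAt p.1) x x).re / r = 2 * ((sesqForm (R.aAt p.1) x x).re / (2 * r)) := by
        field_simp
      have h3 : 0 < (sesqForm (R.aAt p.1) x x).re / (2 * r) := by positivity
      linarith
    have h3 : 0 ≤ ‖c‖ ^ 2 / (2 * t) := by positivity
    have h4 : 0 < ‖y‖ ^ 2 / 2 + f * ((sesqForm (R.aAt p.1) x x).re / r - ‖s‖ ^ 2 / (2 * r ^ 3)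
          + ‖c‖ ^ 2 / (2 * t)) := by
      have := mul_pos hf (add_pos_of_pos_of_nonneg h2 h3)
      positivity
    exact_mod_cast h4.ne'

/-! ### The spray and torsion of the Hermitian metric -/

variable (R) in
/-- The inverse matrix `a^{m̄ i}`. -/
def inv (z : Fin n → ℂ) (m i : Fin n) : ℂ := (Matrix.of (R.aAt z))⁻¹ m i

variable (R) in
/-- The Chern connection coefficients `a^{m̄ i} ∂a_{l m̄}/∂z^j`. -/
def chern (i l j : Fin n) (z : Fin n → ℂ) : ℂ :=
  ∑ m, R.inv z m i * wirt (Pi.single j 1) (R.a l m) z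

variable (R) in
/-- `Γ^k_{i j̄} = (1/2) a^{m̄ k} (∂a_{i m̄}/∂z̄^j - ∂a_{i j̄}/∂z̄^m)`. -/
def gamma (k i j : Fin n) (z : Fin n → ℂ) : ℂ :=
  (1 / 2) * ∑ m, R.inv z m k *
    (wirtBar (Pi.single j 1) (R.a i m) z - wirtBar (Pi.single m 1) (R.a i j) z)

theorem fundInv_A {p : Coord n} (hp : p ∈ R.U) (m i : Fin n) :
    fundInv R.A m i p = R.inv p.1 m i := by
  simp only [fundInv, fundTensor_A hp, inv]

theorem dz_fundTensor_A {p : Coord n} (hp : p ∈ R.U) (j l m : Fin n) :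
    dz j (fundTensor R.A l m) p = wirt (Pi.single j 1) (R.a l m) p.1 := by
  rw [← wirt_fst (diff_a l m hp) ((Pi.single j 1, 0) : Coord n)]
  refine wirt_congr ?_ _
  filter_upwards [isOpen_U.mem_nhds hp] with q hq using fundTensor_A hq l m

theorem dEta_fundTensor_A {p : Coord n} (hp : p ∈ R.U) (j l m : Fin n) :
    dEta j (fundTensor R.A l m) p = 0 := by
  rw [← wirt_zero_left (R.a l m) p.1]
  refine Eq.trans ?_ (wirt_fst (diff_a l m hp) ((0, Pi.single j 1) : Coord n))
  refine wirt_congr ?_ _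
  filter_upwards [isOpen_U.mem_nhds hp] with q hq using fundTensor_A hq l m

theorem nonlinConn_A {p : Coord n} (hp : p ∈ R.U) (i j : Fin n) :
    nonlinConn R.A i j p = ∑ l, R.chern i l j p.1 * p.2 l := by
  simp only [nonlinConn, fundInv_A hp, dz_fundTensor_A hp, chern, Finset.sum_mul]
  exact Finset.sum_comm

theorem spray_A {p : Coord n} (hp : p ∈ R.U) (i : Fin n) :
    spray R.A i p = (1 / 2) * ∑ j, ∑ l, R.chern i l j p.1 * p.2 l * p.2 j := by
  simp only [spray, nonlinConn_A hp, Finset.sum_mul]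

theorem torsion_A {p : Coord n} (hp : p ∈ R.U) (i j k : Fin n) :
    torsion R.A i j k p = R.chern i j k p.1 - R.chern i k j p.1 := by
  simp only [torsion, horCoeff, horDeriv, fundInv_A hp, dz_fundTensor_A hp, dEta_fundTensor_A hp,
    mul_zero, Finset.sum_const_zero, sub_zero, chern]

theorem lower_chern {z : Fin n → ℂ} (hz : z ∈ R.V) (l j m : Fin n) :
    ∑ i, R.chern i l j z * R.a i m z = wirt (Pi.single j 1) (R.a l m) z := by
  -- The domain of α² contains the zero section, so identities in z alone can be read off at η = 0.
  have hp : ((z, 0) : Coord n) ∈ R.U := hz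
  have := isFinslerOn_A.lower_raise hp (fun m => wirt (Pi.single j 1) (R.a l m) z) m
  simpa only [fundInv_A hp, fundTensor_A hp, chern] using this

theorem eq_zero_of_lower {z : Fin n → ℂ} (hz : z ∈ R.V) {x : Fin n → ℂ}
    (hx : ∀ m, ∑ i, x i * R.a i m z = 0) (i : Fin n) : x i = 0 := by
  have hp : ((z, 0) : Coord n) ∈ R.U := hz
  exact isFinslerOn_A.eq_zero_of_lower hp (x := x) (by simpa only [fundTensor_A hp] using hx) i

theorem thetaStar_A {p : Coord n} (hp : p ∈ R.U) (k : Fin n) :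
    thetaStar R.A k p = -2 * ∑ i, ∑ j, R.gamma k i j p.1 * p.2 i * star (p.2 j) := by
  have h1 : ∀ i j m, ∑ q, R.a i q p.1 * star (torsion R.A q j m p) =
      wirtBar (Pi.single m 1) (R.a i j) p.1 - wirtBar (Pi.single j 1) (R.a i m) p.1 := by
    intro i j m
    -- Hermitian symmetry turns the conjugate of ∂a_{j ī}/∂z^m into ∂a_{i j̄}/∂z̄^m. Contracting the
    -- conjugate torsion with a therefore produces the bracket of Γ, with the opposite sign.
    have h2 : ∀ i j m, ∑ q, R.a i q p.1 * star (R.chern q j m p.1) =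
        wirtBar (Pi.single m 1) (R.a i j) p.1 := by
      intro i j m
      have h3 : R.a i j = fun z => star (R.a j i z) := funext fun z => (R.herm j i z).symm
      rw [h3, wirtBar_star, ← lower_chern hp, star_sum]
      exact Finset.sum_congr rfl fun q _ => by rw [star_mul', R.herm, mul_comm]
    simp only [torsion_A hp, star_sub, mul_sub, Finset.sum_sub_distrib, h2]
  have h4 : ∀ m i, ∑ q, ∑ j, fundInv R.A m k p * fundTensor R.A i q p * star (torsion R.A q j m p)
      * p.2 i * star (p.2 j) = ∑ j, R.inv p.1 m k *
        (wirtBar (Pi.single m 1) (R.a i j) p.1 - wirtBar (Pi.single j 1) (R.a i m) p.1)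
        * p.2 i * star (p.2 j) := fun m i => by
    rw [Finset.sum_comm]
    refine Finset.sum_congr rfl fun j _ => ?_
    rw [← h1, Finset.mul_sum, Finset.sum_mul, Finset.sum_mul]
    refine Finset.sum_congr rfl fun q _ => ?_
    rw [fundInv_A hp, fundTensor_A hp]; ring
  simp only [thetaStar, h4, gamma, Finset.mul_sum, Finset.sum_mul]
  rw [Finset.sum_comm]
  refine Finset.sum_congr rfl fun i _ => ?_
  rw [Finset.sum_comm]
  refine Finset.sum_congr rfl fun j _ => Finset.sum_congr rfl fun m _ => by ring

end LocalRanders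
end CFinsler

end

/-! ### Rigidity of the Randers spray and torsion. -/

noncomputable section

namespace CFinsler

variable {n : ℕ}

theorem wirt_eq_sum (u : Fin n → ℂ) (f : (Fin n → ℂ) → ℂ) (z : Fin n → ℂ) :
    wirt u f z = ∑ k, u k * wirt (Pi.single k 1) f z := by
  have h : u = ∑ i, u i • (Pi.single i 1 : Fin n → ℂ) := by
    ext j
    simp [Finset.sum_apply, Pi.single_apply]
  nth_rewrite 1 [h]
  rw [wirt_sum_left]
  simp only [wirt_smul_left]

theorem hasFDerivAt_fibre (z ξ : Fin n → ℂ) :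
    HasFDerivAt (fun ξ : Fin n → ℂ => ((z, ξ) : Coord n))
      (ContinuousLinearMap.inr ℂ (Fin n → ℂ) (Fin n → ℂ)) ξ :=
  hasFDerivAt_prodMk_right z ξ

theorem wirtBar_fibre {f : Coord n → ℂ} {z ξ : Fin n → ℂ} (hf : DifferentiableAt ℝ f (z, ξ))
    (v : Fin n → ℂ) : wirtBar v (fun ξ => f (z, ξ)) ξ = wirtBar (0, v) f (z, ξ) := by
  rw [wirtBar_comp (g := fun ξ : Fin n → ℂ => ((z, ξ) : Coord n)) hf
    (hasFDerivAt_fibre z ξ).differentiableAt, (hasFDerivAt_fibre z ξ).fderiv]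
  rfl

theorem differentiableAt_fibre {f : Coord n → ℂ} {z ξ : Fin n → ℂ}
    (hf : DifferentiableAt ℝ f (z, ξ)) : DifferentiableAt ℝ (fun ξ => f (z, ξ)) ξ :=
  hf.comp ξ (hasFDerivAt_prodMk_right z ξ).differentiableAt

theorem holomorphic_fibre {f : Coord n → ℂ} {z ξ : Fin n → ℂ} (hf : DifferentiableAt ℝ f (z, ξ))
    (h : ∀ i, dEtaBar i f (z, ξ) = 0) : DifferentiableAt ℂ (fun ξ => f (z, ξ)) ξ := by
  refine differentiableAt_of_wirtBar (differentiableAt_fibre hf) fun v => ?_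
  rw [wirtBar_fibre hf, wirtBar_eta]
  simp only [h, mul_zero, Finset.sum_const_zero]

namespace LocalRanders
variable {R : LocalRanders n}

theorem sesqForm_ne_zero {z : Fin n → ℂ} (hz : z ∈ R.V) (η : Fin n → ℂ) (hη : η ≠ 0) :
    sesqForm (R.aAt z) η η ≠ 0 := fun h => by
  have := R.pos z hz η hη
  change 0 < (sesqForm (R.aAt z) η η).re at this
  rw [h] at this
  simp at this

/-- `|β|` and `α` are independent over the functions holomorphic in `η` and linear in `η̄`. -/
theorem eq_zero_of_nu_mul_eq (hn : 2 ≤ n) {z : Fin n → ℂ} (hz : z ∈ R.V)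
    {A C : Fin n → (Fin n → ℂ) → ℂ}
    (hA : ∀ m η, linForm (R.bAt z) η ≠ 0 → DifferentiableAt ℂ (A m) η)
    (hC : ∀ m η, linForm (R.bAt z) η ≠ 0 → DifferentiableAt ℂ (C m) η)
    (h : ∀ η, linForm (R.bAt z) η ≠ 0 → R.nu (z, η) * conjForm (fun m => A m η) η =
      R.alpha (z, η) * conjForm (fun m => C m η) η)
    {η : Fin n → ℂ} (hη : linForm (R.bAt z) η ≠ 0) (m : Fin n) : A m η = 0 ∧ C m η = 0 :=
  eq_zero_of_abs_mul_eq hn (a := R.aAt z) (b := R.bAt z) (α := fun ξ => R.alpha (z, ξ))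
    (ν := fun ξ => R.nu (z, ξ)) (sesqForm_ne_zero hz)
    (fun ξ hξ => differentiableAt_fibre (diff_alpha (p := (z, ξ)) ⟨hz, hξ⟩))
    (fun ξ => alpha_mul_alpha (z, ξ))
    (fun ξ hξ => differentiableAt_fibre (diff_nu (p := (z, ξ)) ⟨hz, hξ⟩))
    (fun ξ => nu_mul_nu (z, ξ)) hA hC h hη m

/-- A field along which the Randers metric is constant, with components holomorphic in `η`, also
preserves the Hermitian metric. -/
theorem wirt_low_eq_zero (hn : 2 ≤ n) {z : Fin n → ℂ} (hz : z ∈ R.V)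
    {Y₁ Y₂ : (Fin n → ℂ) → Fin n → ℂ}
    (h₁ : ∀ k ξ, linForm (R.bAt z) ξ ≠ 0 → DifferentiableAt ℂ (fun ξ => Y₁ ξ k) ξ)
    (h₂ : ∀ k ξ, linForm (R.bAt z) ξ ≠ 0 → DifferentiableAt ℂ (fun ξ => Y₂ ξ k) ξ)
    (h : ∀ ξ, linForm (R.bAt z) ξ ≠ 0 → wirt (Y₁ ξ, Y₂ ξ) R.L (z, ξ) = 0)
    {ξ : Fin n → ℂ} (hξ : linForm (R.bAt z) ξ ≠ 0) (m : Fin n) :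
    ∑ i, (wirt (Y₁ ξ) (R.a i m) z * ξ i + R.a i m z * Y₂ ξ i) = 0 := by
  -- For Y = (Y₁, Y₂) the coefficients are chosen so that Y(α²) = A_m η̄^m and Y(ββ̄) = −C_m η̄^m.
  -- The relation is Y F̃ = 0 with Yα = Y(α²)/(2α) and Y|β| = Y(ββ̄)/(2|β|), cleared of
  -- denominators.
  refine (eq_zero_of_nu_mul_eq (R := R) hn hz
    (A := fun m ξ => ∑ i, (wirt (Y₁ ξ) (R.a i m) z * ξ i + R.a i m z * Y₂ ξ i))
    (C := fun m ξ => -((∑ i, (wirt (Y₁ ξ) (R.b i) z * ξ i + R.b i z * Y₂ ξ i)) * star (R.b m z)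
      + (∑ i, R.b i z * ξ i) * wirt (Y₁ ξ) (fun z => star (R.b m z)) z)) ?_ ?_ ?_ hξ m).1
  · intro m η hη
    have e1 := fun k => h₁ k η hη
    have e2 := fun k => h₂ k η hη
    simp only [wirt_eq_sum (Y₁ _)]
    fun_prop
  · intro m η hη
    have e1 := fun k => h₁ k η hη
    have e2 := fun k => h₂ k η hη
    simp only [wirt_eq_sum (Y₁ _)]
    fun_prop
  · intro η hη
    have hp : ((z, η) : Coord n) ∈ R.Om := ⟨hz, hη⟩
    have hα := alpha_ne_zero hp
    have hν := nu_ne_zero hp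
    have e := h η hη
    rw [wirt_L hp, wirt_F hp, wirt_alpha hp, wirt_nu hp] at e
    have e' := (mul_eq_zero.1 e).resolve_left (mul_ne_zero two_ne_zero (F_ne_zero hp))
    have eA := wirt_A hp.1 (Y₁ η, Y₂ η)
    have eb := wirt_beta hp.1 (Y₁ η, Y₂ η)
    have es := wirt_star_beta hp.1 (Y₁ η, Y₂ η)
    dsimp only at eA eb es
    rw [← eA]
    have eC : conjForm (fun m => -((∑ i, (wirt (Y₁ η) (R.b i) z * η i + R.b i z * Y₂ η i))
        * star (R.b m z) + (∑ i, R.b i z * η i) * wirt (Y₁ η) (fun z => star (R.b m z)) z)) η =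
        -(wirt (Y₁ η, Y₂ η) R.beta (z, η) * star (R.beta (z, η)) +
          R.beta (z, η) * wirt (Y₁ η, Y₂ η) (fun q => star (R.beta q)) (z, η)) := by
      rw [es, ← eb]
      have e3 : star (R.beta (z, η)) = ∑ m, star (R.b m z) * star (η m) := by
        simp [beta, linForm, star_sum, star_mul']
      have e4 : R.beta (z, η) = ∑ i, R.b i z * η i := rfl
      rw [e3, e4]
      simp only [conjForm, Finset.mul_sum, ← Finset.sum_add_distrib, ← Finset.sum_neg_distrib]
      exact Finset.sum_congr rfl fun i _ => by ring
    rw [eC]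
    field_simp at e'
    linear_combination e'

/-- A generalized Berwald Randers metric has the spray of its Hermitian metric. -/
theorem spray_eq_of_generalizedBerwald (hn : 2 ≤ n)
    (h : ∀ p ∈ R.Om, ∀ i k, dEtaBar k (spray R.L i) p = 0) {p : Coord n} (hp : p ∈ R.Om)
    (i : Fin n) : spray R.L i p = spray R.A i p := by
  obtain ⟨z, η⟩ := p
  have hz : z ∈ R.V := hp.1
  have hp' : ((z, η) : Coord n) ∈ R.U := hz
  -- The field is the spray field of F̃, with fibrewise holomorphic components by the generalized
  -- Berwald condition.
  have key := wirt_low_eq_zero (R := R) hn hz (Y₁ := fun ξ => ξ)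
    (Y₂ := fun ξ i => -(2 * spray R.L i (z, ξ))) (fun k ξ _ => by fun_prop)
    (fun k ξ hξ => by
      have hξ' : ((z, ξ) : Coord n) ∈ R.Om := ⟨hz, hξ⟩
      have := holomorphic_fibre (f := spray R.L k) (z := z) (ξ := ξ)
        ((isFinslerOn_L.smooth_spray hξ' k).differentiableAt (by simp)) fun i => h _ hξ' k i
      fun_prop)
    (fun ξ hξ => isFinslerOn_L.sprayField_self (p := (z, ξ)) ⟨hz, hξ⟩) (ξ := η) hp.2
  -- The spray of α solves the same linear system by its own characterization; invertibility of a
  -- gives uniqueness.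
  have keyA : ∀ m, ∑ i, (wirt η (R.a i m) z * η i + R.a i m z * (-(2 * spray R.A i (z, η)))) = 0 := by
    intro m
    have h1 := isFinslerOn_A.lower_spray hp' m
    have h2 : wirt (sprayField R.A (z, η)) (dEtaBar m R.A) (z, η) =
        wirt (sprayField R.A (z, η)) (R.low m) (z, η) := by
      refine wirt_congr ?_ _
      filter_upwards [isOpen_U.mem_nhds hp'] with q hq using dEtaBar_A hq m
    rw [h2, wirt_low hp'] at h1
    exact h1
  have := eq_zero_of_lower hz (x := fun i => spray R.L i (z, η) - spray R.A i (z, η)) (fun m => ?_) i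
  · exact sub_eq_zero.1 this
  · have e1 := key m
    have e2 := keyA m
    rw [Finset.sum_add_distrib] at e1 e2
    have e3 : ∀ f : Fin n → ℂ, ∑ i, R.a i m z * (-(2 * f i)) = -2 * ∑ i, f i * R.a i m z := fun f => by
      rw [Finset.mul_sum]
      exact Finset.sum_congr rfl fun i _ => by ring
    rw [e3] at e1 e2
    simp only [sub_mul, Finset.sum_sub_distrib]
    linear_combination (e2 - e1) / 2

theorem dEtaBar_spray_A {p : Coord n} (hp : p ∈ R.U) (i k : Fin n) :
    dEtaBar k (spray R.A i) p = 0 := by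
  have h := (isFinslerOn_A.smooth_spray hp i).differentiableAt (by simp)
  rw [dEtaBar, ← wirtBar_fibre (z := p.1) (ξ := p.2) h]
  have : (fun ξ => spray R.A i (p.1, ξ)) = fun ξ : Fin n → ℂ =>
      (1 / 2) * ∑ j, ∑ l, R.chern i l j p.1 * ξ l * ξ j := by
    funext ξ
    exact spray_A (p := (p.1, ξ)) hp i
  rw [this]
  exact wirtBar_of_differentiableAt (by fun_prop) _

/-- A Randers metric with the spray of its Hermitian metric is generalized Berwald. -/
theorem generalizedBerwald_of_spray_eq
    (h : ∀ p ∈ R.Om, ∀ i, spray R.L i p = spray R.A i p) {p : Coord n} (hp : p ∈ R.Om)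
    (i k : Fin n) : dEtaBar k (spray R.L i) p = 0 := by
  rw [← dEtaBar_spray_A hp.1 i k]
  refine wirtBar_congr ?_ _
  filter_upwards [isOpen_Om.mem_nhds hp] with q hq using h q hq i

theorem dEta_spray_A {p : Coord n} (hp : p ∈ R.U) (i k : Fin n) :
    dEta k (spray R.A i) p =
      (1 / 2) * ∑ j, (R.chern i k j p.1 + R.chern i j k p.1) * p.2 j := by
  have h := (isFinslerOn_A.smooth_spray hp i).differentiableAt (by simp)
  have e : dEta k (spray R.A i) p = wirt (Pi.single k 1) (fun ξ => spray R.A i (p.1, ξ)) p.2 := by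
    rw [wirt_comp (f := spray R.A i) (g := fun ξ : Fin n → ℂ => ((p.1, ξ) : Coord n)) h
      (hasFDerivAt_fibre p.1 p.2).differentiableAt, (hasFDerivAt_fibre p.1 p.2).fderiv]
    rfl
  have : (fun ξ => spray R.A i (p.1, ξ)) = fun ξ : Fin n → ℂ =>
      (1 / 2) * ∑ j, ∑ l, R.chern i l j p.1 * (ξ l * ξ j) := by
    funext ξ
    rw [spray_A (p := (p.1, ξ)) hp i]
    simp only [mul_assoc]
  have hη : ∀ j, wirt (Pi.single k 1) (fun ξ : Fin n → ℂ => ξ j) p.2 =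
      (Pi.single k 1 : Fin n → ℂ) j := fun j => by
    rw [wirt_of_differentiableAt (by fun_prop), fderiv_apply (by fun_prop)]; simp
  rw [e, this, wirt_const_mul (by fun_prop), wirt_sum _ fun j _ => by fun_prop]
  have h2 : ∀ j, wirt (Pi.single k 1)
      (fun ξ : Fin n → ℂ => ∑ l, R.chern i l j p.1 * (ξ l * ξ j)) p.2 =
      ∑ l, (R.chern i l j p.1 * p.2 j * (Pi.single k 1 : Fin n → ℂ) l) +
      (∑ l, R.chern i l j p.1 * p.2 l) * (Pi.single k 1 : Fin n → ℂ) j := fun j => by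
    rw [wirt_sum _ fun j _ => by fun_prop, Finset.sum_mul, ← Finset.sum_add_distrib]
    refine Finset.sum_congr rfl fun l _ => ?_
    rw [wirt_const_mul (by fun_prop), wirt_mul (by fun_prop) (by fun_prop), hη, hη]
    ring
  simp only [h2, Finset.sum_add_distrib, sum_mul_single, add_mul]

/-- If the Randers metric is generalized Berwald and weakly Kähler, then the Hermitian metric is
Kähler where `β` does not vanish. -/
theorem torsion_A_eq_zero (hn : 2 ≤ n)
    (h : ∀ p ∈ R.Om, ∀ i k, dEtaBar k (spray R.L i) p = 0)
    (hθ : ∀ p ∈ R.Om, ∀ k, thetaStar R.L k p = 0) {z : Fin n → ℂ} (hz : z ∈ R.V)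
    (hb : R.bAt z ≠ 0) (i j k : Fin n) : R.chern i j k z = R.chern i k j z := by
  have key : ∀ ξ, linForm (R.bAt z) ξ ≠ 0 → ∀ i,
      ∑ j, (R.chern i j k z - R.chern i k j z) * ξ j = 0 := by
    intro ξ hξ i
    have hp : ((z, ξ) : Coord n) ∈ R.U := hz
    -- The field is ∂/∂z^k − (∂G^i/∂η^k) ∂/∂η^i; it annihilates F̃² by the weakly Kähler identity.
    -- Its vertical part is the symmetrized Chern connection of α, so preserving a_{i m̄} η^i says
    -- that the connection equals its symmetrization.
    have e1 := wirt_low_eq_zero (R := R) hn hz (Y₁ := fun ξ => Pi.single k 1)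
      (Y₂ := fun ξ i => -((1 / 2) * ∑ j, (R.chern i k j z + R.chern i j k z) * ξ j))
      (fun k ξ _ => by fun_prop) (fun k ξ _ => by fun_prop) (fun ζ hζ => by
        have hζ' : ((z, ζ) : Coord n) ∈ R.Om := ⟨hz, hζ⟩
        have e2 := isFinslerOn_L.dz_eq_of_thetaStar_eq_zero hθ hζ' k
        have e3 : ∀ i, dEta k (spray R.L i) (z, ζ) =
            (1 / 2) * ∑ j, (R.chern i k j z + R.chern i j k z) * ζ j := fun i => by
          rw [← dEta_spray_A (p := (z, ζ)) hz]
          refine wirt_congr ?_ _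
          filter_upwards [isOpen_Om.mem_nhds hζ'] with q hq
            using spray_eq_of_generalizedBerwald hn h hq i
        simp only [e3] at e2
        have e4 : ∑ i, (Pi.single k 1 : Fin n → ℂ) i * dz i R.L (z, ζ) = dz k R.L (z, ζ) := by
          rw [Finset.sum_eq_single k] <;> simp +contextual
        rw [wirt_coord, e4, e2, ← Finset.sum_add_distrib]
        exact Finset.sum_eq_zero fun i _ => by ring) (ξ := ξ) hξ
    refine eq_zero_of_lower hz (x := fun i => ∑ j, (R.chern i j k z - R.chern i k j z) * ξ j)
      (fun m => ?_) i
    have e2 := e1 m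
    rw [Finset.sum_add_distrib] at e2
    have e3 : ∑ l, wirt (Pi.single k 1) (R.a l m) z * ξ l =
        ∑ i, (∑ l, R.chern i l k z * ξ l) * R.a i m z := by
      simp only [← lower_chern hz, Finset.sum_mul]
      rw [Finset.sum_comm]
      exact Finset.sum_congr rfl fun i _ => Finset.sum_congr rfl fun l _ => by ring
    rw [e3, ← Finset.sum_add_distrib] at e2
    have e4 : ∑ i, (∑ j, (R.chern i j k z - R.chern i k j z) * ξ j) * R.a i m z =
        2 * ∑ i, ((∑ l, R.chern i l k z * ξ l) * R.a i m z + R.a i m z *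
          -(1 / 2 * ∑ j, (R.chern i k j z + R.chern i j k z) * ξ j)) := by
      rw [Finset.mul_sum]
      refine Finset.sum_congr rfl fun i _ => ?_
      simp only [sub_mul, add_mul, Finset.sum_add_distrib, Finset.sum_sub_distrib]
      ring
    rw [e4, e2, mul_zero]
  obtain ⟨η, hη⟩ : ∃ η, linForm (R.bAt z) η ≠ 0 := by
    by_contra! h0
    exact hb (funext fun m => by rw [← linForm_single (R.bAt z) m, h0]; rfl)
  -- A linear form that vanishes off the hyperplane β = 0 vanishes on it too: ξ is the difference of
  -- ξ + η and η, both outside it.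
  have hlin : ∀ ξ, linForm (fun j => R.chern i j k z - R.chern i k j z) ξ = 0 := by
    intro ξ
    by_cases hξ : linForm (R.bAt z) ξ = 0
    · have h1 := key (ξ + η) (by rw [linForm_add, hξ, zero_add]; exact hη) i
      have h2 := key η hη i
      change linForm (fun j => R.chern i j k z - R.chern i k j z) (ξ + η) = 0 at h1
      change linForm (fun j => R.chern i j k z - R.chern i k j z) η = 0 at h2
      rw [linForm_add, h2, add_zero] at h1
      exact h1
    · exact key ξ hξ i
  have := hlin (Pi.single j 1)
  rw [linForm_single] at this
  exact sub_eq_zero.1 this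

end LocalRanders
end CFinsler

end

noncomputable section

namespace CFinsler

variable {n : ℕ}
namespace LocalRanders
variable {R : LocalRanders n}

/-! ### The functions `θ*` -/

variable (R) in
/-- `b_k θ^{*k}` for the Hermitian metric. -/
def bTheta (p : Coord n) : ℂ := ∑ k, R.b k p.1 * thetaStar R.A k p

theorem bTheta_eq {p : Coord n} (hp : p ∈ R.U) :
    R.bTheta p = -2 * ∑ k, ∑ i, ∑ j, R.gamma k i j p.1 * R.b k p.1 * p.2 i * star (p.2 j) := by
  simp only [bTheta, thetaStar_A hp, Finset.mul_sum]
  exact Finset.sum_congr rfl fun k _ => Finset.sum_congr rfl fun i _ =>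
    Finset.sum_congr rfl fun j _ => by ring

/-- If the two functions `θ*` differ by a multiple of the velocity, the factor is determined by the
orthogonality of `θ*` and the velocity. -/
theorem star_beta_mul_bTheta {p : Coord n} (hp : p ∈ R.Om) {c : ℂ}
    (h : ∀ i, thetaStar R.L i p = thetaStar R.A i p + c * p.2 i) :
    star (R.beta p) * R.bTheta p = -c * R.F p * R.nu p := by
  have hα := alpha_ne_zero hp
  have hν := nu_ne_zero hp
  have hF := F_ne_zero hp
  have e1 := isFinslerOn_L.thetaStar_orthogonal hp
  have e2 := isFinslerOn_A.thetaStar_orthogonal hp.1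
  have e3 := (isFinslerOn_L.euler hp).1
  -- The covector ∂L/∂η^k splits into a multiple of ∂α²/∂η^k, orthogonal to θ* of α, and a multiple
  -- of b_k.
  have e4 : ∑ k, thetaStar R.A k p * dEta k R.L p =
      R.F p * ((∑ k, thetaStar R.A k p * dEta k R.A p) / R.alpha p
        + star (R.beta p) * R.bTheta p / R.nu p) := by
    simp only [dEta_L hp, dEta_A hp.1, bTheta, Finset.sum_div, Finset.mul_sum,
      ← Finset.sum_add_distrib]
    exact Finset.sum_congr rfl fun i _ => by ring
  have e5 : ∑ k, thetaStar R.L k p * dEta k R.L p =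
      ∑ k, thetaStar R.A k p * dEta k R.L p + c * ∑ k, p.2 k * dEta k R.L p := by
    rw [Finset.mul_sum, ← Finset.sum_add_distrib]
    exact Finset.sum_congr rfl fun i _ => by rw [h]; ring
  rw [e5, e4, e2, e3, L, zero_div, zero_add] at e1
  have e6 : R.F p * (star (R.beta p) * R.bTheta p + c * R.F p * R.nu p) = 0 := by
    linear_combination R.nu p * e1 - R.F p * div_mul_cancel₀ (star (R.beta p) * R.bTheta p) hν
  linear_combination (mul_eq_zero.1 e6).resolve_left hF

/-- The hypothesis is B^i = −Pη^i. Orthogonality of θ* to the velocity demands a proportionality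
factor twice as large as −P, so the factor must be zero and the condition amounts to equality of the
two θ*. -/
theorem thetaStar_eq_of_diff {p : Coord n} (hp : p ∈ R.Om)
    (h : ∀ i, (1 / 2) * (thetaStar R.L i p - thetaStar R.A i p) =
      -(star (R.beta p) / (4 * R.F p * R.nu p) * R.bTheta p) * p.2 i) :
    R.bTheta p = 0 ∧ ∀ i, thetaStar R.L i p = thetaStar R.A i p := by
  have hν := nu_ne_zero hp
  have hF := F_ne_zero hp
  have e := star_beta_mul_bTheta hp
    (c := -2 * (star (R.beta p) / (4 * R.F p * R.nu p) * R.bTheta p))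
    (fun i => by linear_combination 2 * h i)
  have e2 : star (R.beta p) * R.bTheta p = 0 := by
    field_simp at e
    linear_combination e / 2
  have e3 : R.bTheta p = 0 := (mul_eq_zero.1 e2).resolve_left (star_ne_zero.2 hp.2)
  refine ⟨e3, fun i => ?_⟩
  have := h i
  rw [e3] at this
  linear_combination 2 * this

/-- If the geodesic equations differ by a real multiple of the velocity, then by homogeneity
both the sprays and the functions `θ*` differ by multiples of the velocity. -/
theorem exists_factor {p : Coord n} (hp : p ∈ R.Om)
    (h : ∀ p ∈ R.Om, ∃ r : ℝ, ∀ i, 2 * (spray R.L i p - spray R.A i p)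
      - (thetaStar R.L i p - thetaStar R.A i p) = r * p.2 i) :
    ∃ d : ℂ, (∀ i, 2 * (spray R.L i p - spray R.A i p) = d * p.2 i) ∧
      ∀ i, thetaStar R.L i p = thetaStar R.A i p + -star d * p.2 i := by
  obtain ⟨r, hr⟩ := h p hp
  -- At iη the spray changes sign while θ* does not. The factors at η and iη are both real, which
  -- makes the two resulting factors d and −d̄.
  obtain ⟨t, ht⟩ := h _ (scale_mem_Om hp Complex.I_ne_zero)
  have hI : Complex.I * star Complex.I = 1 := by simp
  have h1 : ∀ i, -(2 * (spray R.L i p - spray R.A i p))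
      - (thetaStar R.L i p - thetaStar R.A i p) = t * (Complex.I * p.2 i) := fun i => by
    have := ht i
    rw [isFinslerOn_L.spray_scale Complex.I_ne_zero, isFinslerOn_A.spray_scale Complex.I_ne_zero,
      isFinslerOn_L.thetaStar_scale Complex.I_ne_zero,
      isFinslerOn_A.thetaStar_scale Complex.I_ne_zero, hI, Complex.I_sq, scale_snd,
      Pi.smul_apply, smul_eq_mul] at this
    linear_combination this
  refine ⟨(r - t * Complex.I) / 2, fun i => ?_, fun i => ?_⟩
  · linear_combination (hr i - h1 i) / 2
  · have hs : star (((r : ℂ) - t * Complex.I) / 2) = (r + t * Complex.I) / 2 := by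
      simp
    rw [hs]
    linear_combination -(hr i + h1 i) / 2

/-- The two spray fields differ by d times the fibre Euler field. The field of F̃ annihilates L and
∂L/∂η̄^m = F̃ K_m, and both have holomorphic degree 1; so the field of α multiplies each by d, hence
F̃ by d/2 and K_m by d/2. -/
theorem wirt_K_of_factor {p : Coord n} (hp : p ∈ R.Om) {d : ℂ}
    (h : ∀ i, 2 * (spray R.L i p - spray R.A i p) = d * p.2 i) (m : Fin n) :
    wirt (sprayField R.A p) (R.K m) p = d / 2 * R.K m p := by
  have hF := F_ne_zero hp
  have hX : sprayField R.A p = sprayField R.L p + d • ((0, p.2) : Coord n) := by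
    ext i
    · simp [sprayField]
    · simp only [sprayField, Prod.snd_add, Prod.smul_snd, Pi.add_apply, Pi.smul_apply, smul_eq_mul]
      linear_combination h i
  have hv : ∀ f, wirt (0, p.2) f p = ∑ i, p.2 i * dEta i f p := fun f => by
    rw [wirt_coord]; simp
  have e1 : wirt (sprayField R.A p) R.L p = d * R.L p := by
    rw [hX, wirt_add_left, wirt_smul_left, isFinslerOn_L.sprayField_self hp, hv,
      (isFinslerOn_L.euler hp).1, zero_add]
  have e2 : wirt (sprayField R.A p) (dEtaBar m R.L) p = d * dEtaBar m R.L p := by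
    rw [hX, wirt_add_left, wirt_smul_left, isFinslerOn_L.lower_spray hp, hv, zero_add]
    congr 1
    exact isFinslerOn_L.euler_fundTensor_left hp m
  have dK : DifferentiableAt ℝ (R.K m) p := by
    have h1 := differentiableAt_div (diff_low m hp.1) (diff_alpha hp) (alpha_ne_zero hp)
    have db' : DifferentiableAt ℝ (fun q : Coord n => star (R.b m q.1)) p :=
      (differentiableAt_star (diff_b m hp.1)).comp p differentiableAt_fst
    have h2 := differentiableAt_div ((diff_beta hp.1).fun_mul db') (diff_nu hp) (nu_ne_zero hp)
    exact h1.fun_add h2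
  have e3 : wirt (sprayField R.A p) (dEtaBar m R.L) p =
      wirt (sprayField R.A p) (fun q => R.F q * R.K m q) p := by
    refine wirt_congr ?_ _
    filter_upwards [isOpen_Om.mem_nhds hp] with q hq using dEtaBar_L hq m
  rw [e3, wirt_mul (diff_F hp) dK, dEtaBar_L hp] at e2
  rw [wirt_L hp, L] at e1
  apply mul_left_cancel₀ hF
  have e4 : wirt (sprayField R.A p) R.F p = d / 2 * R.F p := by
    apply mul_left_cancel₀ hF
    linear_combination e1 / 2
  rw [e4] at e2
  linear_combination e2

/-- The spray field of α annihilates α and a_{i m̄} η^i, so in the derivative of K_m only the part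
from β survives. Pairing with v in the kernel of b removes every term proportional to the conjugate
of b_m, including the uncontrolled derivatives of β and |β|. -/
theorem factor_relation {p : Coord n} (hp : p ∈ R.Om) {d : ℂ}
    (h : ∀ i, 2 * (spray R.L i p - spray R.A i p) = d * p.2 i) {v : Fin n → ℂ}
    (hv : linForm (R.bAt p.1) v = 0) :
    2 * R.alpha p * R.beta p * conjForm (fun m => wirt p.2 (fun z => star (R.b m z)) p.1) v =
      d * R.nu p * conjForm (fun m => R.low m p) v := by
  have hα := alpha_ne_zero hp
  have hν := nu_ne_zero hp
  have hA : wirt (sprayField R.A p) R.alpha p = 0 := by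
    rw [wirt_alpha hp, isFinslerOn_A.sprayField_self hp.1, zero_div]
  have hl : ∀ m, wirt (sprayField R.A p) (R.low m) p = 0 := fun m => by
    rw [← isFinslerOn_A.lower_spray hp.1 m]
    refine wirt_congr ?_ _
    filter_upwards [isOpen_U.mem_nhds hp.1] with q hq using (dEtaBar_A hq m).symm
  have hbv : conjForm (fun m => star (R.b m p.1)) v = 0 := by
    have : conjForm (fun m => star (R.b m p.1)) v = star (linForm (R.bAt p.1) v) := by
      simp [conjForm, linForm, star_sum, star_mul']
    rw [this, hv, star_zero]
  obtain ⟨T, hT⟩ : ∃ T : ℂ, ∀ m, T * star (R.b m p.1)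
      + R.beta p / R.nu p * wirt p.2 (fun z => star (R.b m z)) p.1 =
      d / 2 * (R.low m p / R.alpha p + R.beta p * star (R.b m p.1) / R.nu p) := by
    refine ⟨wirt (sprayField R.A p) R.beta p / R.nu p
      - R.beta p * wirt (sprayField R.A p) R.nu p / R.nu p ^ 2, fun m => ?_⟩
    have := wirt_K_of_factor hp h m
    rw [wirt_K hp, hA, hl, K] at this
    rw [← this]
    simp only [sprayField]
    ring
  have hs : T * conjForm (fun m => star (R.b m p.1)) v
      + R.beta p / R.nu p * conjForm (fun m => wirt p.2 (fun z => star (R.b m z)) p.1) v =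
      d / 2 * (conjForm (fun m => R.low m p) v / R.alpha p
        + R.beta p * conjForm (fun m => star (R.b m p.1)) v / R.nu p) := by
    have h1 : ∀ m, (T * star (R.b m p.1)
      + R.beta p / R.nu p * wirt p.2 (fun z => star (R.b m z)) p.1) * star (v m) =
      d / 2 * (R.low m p / R.alpha p + R.beta p * star (R.b m p.1) / R.nu p) * star (v m) :=
      fun m => by rw [hT]
    have h2 := Finset.sum_congr (rfl : (Finset.univ : Finset (Fin n)) = Finset.univ) fun m _ => h1 m
    simp only [conjForm, Finset.mul_sum, Finset.sum_div, ← Finset.sum_add_distrib]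
    convert h2 using 2 <;> ring
  rw [hbv] at hs
  field_simp at hs
  linear_combination hs

/-- If the geodesic equations of the Randers metric and of its Hermitian metric differ by a real
multiple of the velocity, they coincide. -/
theorem eq_of_projective (hn : 2 ≤ n)
    (h : ∀ p ∈ R.Om, ∃ r : ℝ, ∀ i, 2 * (spray R.L i p - spray R.A i p)
      - (thetaStar R.L i p - thetaStar R.A i p) = r * p.2 i) {p : Coord n} (hp : p ∈ R.Om) :
    R.bTheta p = 0 ∧ (∀ i, spray R.L i p = spray R.A i p) ∧
      ∀ i, thetaStar R.L i p = thetaStar R.A i p := by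
  have hz : p.1 ∈ R.V := hp.1
  set z := p.1 with hzp
  -- The conjugate of b_k θ^{*k} is written as q_m η̄^m with q_m linear in η, the shape required by
  -- the irrationality statement.
  let q : Fin n → (Fin n → ℂ) → ℂ := fun i ξ => ∑ j, (∑ k, -2 * star (R.gamma k i j z * R.b k z)) * ξ j
  have hq : ∀ ξ, conjForm (fun m => q m ξ) ξ = star (R.bTheta (z, ξ)) := fun ξ => by
    rw [bTheta_eq (p := (z, ξ)) hz]
    simp only [q, conjForm, star_mul', star_sum, star_star, Finset.sum_mul, Finset.mul_sum, star_neg,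
      star_ofNat]
    have hc : ∀ f : Fin n → Fin n → Fin n → ℂ, ∑ i, ∑ j, ∑ k, f i j k = ∑ k, ∑ i, ∑ j, f i j k :=
      fun f => (Finset.sum_congr rfl fun i _ => Finset.sum_comm).trans Finset.sum_comm
    rw [hc]
    exact Finset.sum_congr rfl fun k _ => Finset.sum_congr rfl fun i _ =>
      Finset.sum_congr rfl fun j _ => by ring
  -- The factor d is eliminated between `factor_relation` and the conjugate of
  -- `star_beta_mul_bTheta`.
  have rel : ∀ v, linForm (R.bAt z) v = 0 → ∀ ξ, linForm (R.bAt z) ξ ≠ 0 →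
      2 * R.alpha (z, ξ) * R.F (z, ξ) * conjForm (fun m => wirt ξ (fun z => star (R.b m z)) z) v =
        star (R.bTheta (z, ξ)) * conjForm (fun m => R.low m (z, ξ)) v := by
    intro v hv ξ hξ
    have hξ' : ((z, ξ) : Coord n) ∈ R.Om := ⟨hz, hξ⟩
    obtain ⟨d, hd1, hd2⟩ := exists_factor hξ' h
    have e1 := factor_relation hξ' hd1 (v := v) hv
    have e2 := congr_arg star (star_beta_mul_bTheta hξ' hd2)
    simp only [star_mul', star_star, star_neg, star_F, star_nu] at e2
    apply mul_left_cancel₀ hξ'.2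
    dsimp only at e1
    linear_combination R.F (z, ξ) * e1 - conjForm (fun m => R.low m (z, ξ)) v * e2
  have hlow : ∀ m (ξ : Fin n → ℂ), R.low m (z, ξ) = ∑ i, R.a i m z * ξ i := fun m ξ => rfl
  have hQ0 : ∀ ξ, linForm (R.bAt z) ξ ≠ 0 → star (R.bTheta (z, ξ)) = 0 := by
    obtain ⟨v, hv0, hv⟩ := exists_linForm_eq_zero hn (R.bAt z)
    have hmain : ∀ ξ, linForm (R.bAt z) ξ ≠ 0 → ∀ m,
        conjForm (fun m => R.low m (z, ξ)) v * q m ξ = 0 := by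
      intro ξ hξ m
      let E : (Fin n → ℂ) → ℂ := fun ξ => conjForm (fun m => wirt ξ (fun z => star (R.b m z)) z) v
      have hE : ∀ ξ, E ξ = conjForm (fun m =>
          ∑ k, ξ k * wirt (Pi.single k 1) (fun z => star (R.b m z)) z) v := fun ξ => by
        simp only [E]
        congr 1
        funext m
        exact wirt_eq_sum _ _ _
      -- Substituting F̃ = α + |β| in `rel` and multiplying by α gives |β|·2Eα² = α·(a(η, v) q_m
      -- η̄^m − 2Eα²), where α² = a_{i m̄} η^i η̄^m.
      have key := fun ξ hξ m => eq_zero_of_nu_mul_eq (R := R) hn hz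
        (A := fun m ξ => 2 * E ξ * R.low m (z, ξ))
        (C := fun m ξ => conjForm (fun m => R.low m (z, ξ)) v * q m ξ - 2 * E ξ * R.low m (z, ξ))
        (fun m η _ => by
          simp only [hE, hlow, conjForm]
          fun_prop)
        (fun m η _ => by
          simp only [hE, hlow, conjForm, q]
          fun_prop)
        (fun η hη => by
          have e1 := rel v hv η hη
          have e2 := alpha_mul_alpha (R := R) (z, η)
          have e3 : conjForm (fun m => 2 * E η * R.low m (z, η)) η = 2 * E η * R.A (z, η) := by
            rw [A_eq_conjForm]
            simp only [conjForm, Finset.mul_sum, mul_assoc]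
          have e4 : conjForm (fun m => conjForm (fun m => R.low m (z, η)) v * q m η
              - 2 * E η * R.low m (z, η)) η =
              conjForm (fun m => R.low m (z, η)) v * star (R.bTheta (z, η))
                - 2 * E η * R.A (z, η) := by
            rw [← hq, ← e3]
            conv_lhs => rw [conjForm]
            conv_rhs => enter [1, 2]; rw [conjForm]
            conv_rhs => enter [2]; rw [conjForm]
            rw [Finset.mul_sum, ← Finset.sum_sub_distrib]
            exact Finset.sum_congr rfl fun i _ => by ring
          rw [e3, e4, ← e2]
          change 2 * R.alpha (z, η) * R.F (z, η) * E η = _ at e1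
          rw [F] at e1
          linear_combination R.alpha (z, η) * e1) (η := ξ) hξ m
      -- The covector a_{i m̄} η^i cannot vanish for η ≠ 0, so the vanishing of its multiple by E
      -- gives E = 0.
      have hE0 : E ξ = 0 := by
        by_contra hne
        have h0 : ∀ m, R.low m (z, ξ) = 0 := fun m => by
          simpa [hne] using (key ξ hξ m).1
        have h1 := A_eq_conjForm (R := R) (z, ξ)
        simp only [h0, conjForm, zero_mul, Finset.sum_const_zero] at h1
        exact sesqForm_ne_zero hz ξ (snd_ne_zero (p := (z, ξ)) (R := R) ⟨hz, hξ⟩) h1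
      have := (key ξ hξ m).2
      simpa only [hE0, mul_zero, zero_mul, sub_zero] using this
    intro ξ hξ
    rw [← hq]
    refine eq_zero_of_sesqForm_ne_zero (sesqForm_ne_zero hz v hv0)
      (g := fun ξ => conjForm (fun m => q m ξ) ξ) ?_ ?_
    · exact (differentiableAt_conjForm fun m => by fun_prop).continuousAt
    · filter_upwards [(isOpen_ne_fun (differentiable_linForm (R.bAt z)).continuous
        continuous_const).mem_nhds hξ] with η hη hs
      have hs' : conjForm (fun m => R.low m (z, η)) v ≠ 0 := by
        rw [sesqForm_eq_conjForm] at hs; exact hs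
      have : ∀ m, q m η = 0 := fun m => (mul_eq_zero.1 (hmain η hη m)).resolve_left hs'
      simp [this, conjForm]
  have hQ : R.bTheta p = 0 := star_eq_zero.1 (hQ0 p.2 hp.2)
  obtain ⟨d, hd1, hd2⟩ := exists_factor hp h
  have e := star_beta_mul_bTheta hp hd2
  rw [hQ, mul_zero] at e
  have hd : d = 0 := by
    have hF := F_ne_zero hp
    have hν := nu_ne_zero hp
    simpa [hF, hν] using e.symm
  refine ⟨hQ, fun i => ?_, fun i => ?_⟩
  · have := hd1 i
    rw [hd] at this
    linear_combination this / 2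
  · rw [hd2, hd]; simp

end LocalRanders
end CFinsler

end

noncomputable section

namespace CFinsler

variable {n : ℕ} {M : Type*} [TopologicalSpace M] [ChartedSpace (Fin n → ℂ) M]

/-! ## Randers metrics on a manifold in a chart -/

theorem sum_smul_single (η : Fin n → ℂ) : η = ∑ i, η i • (Pi.single i 1 : Fin n → ℂ) := by
  ext j
  simp [Finset.sum_apply, Pi.single_apply]

theorem tangentVec_eq_sum (e : OpenPartialHomeomorph M (Fin n → ℂ)) (z η : Fin n → ℂ) :
    tangentVec e z η = ∑ i, η i • tangentVec e z (Pi.single i 1) := by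
  have h : ∀ T : (Fin n → ℂ) →L[ℂ] (Fin n → ℂ), T η = ∑ i, η i • T (Pi.single i 1) := fun T => by
    nth_rewrite 1 [sum_smul_single η]
    rw [map_sum]
    simp only [map_smul]
  exact h _

theorem HermitianMetric.form_tangentVec (a : HermitianMetric n M)
    (e : OpenPartialHomeomorph M (Fin n → ℂ)) (z η ζ : Fin n → ℂ) :
    a.form (e.symm z) (tangentVec e z η) (tangentVec e z ζ) =
      sesqForm (fun i j => a.coeff e i j z) η ζ := by
  rw [tangentVec_eq_sum e z η, tangentVec_eq_sum e z ζ]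
  simp only [map_sum, LinearMap.sum_apply, map_smul, LinearMap.smul_apply, map_smulₛₗ,
    sesqForm, HermitianMetric.coeff, smul_eq_mul, Finset.mul_sum]
  rw [Finset.sum_comm]
  refine (Finset.sum_congr rfl fun i _ => Finset.sum_congr rfl fun j _ => ?_)
  rw [starRingEnd_apply]
  ring

theorem OneZeroForm.form_tangentVec (b : OneZeroForm n M)
    (e : OpenPartialHomeomorph M (Fin n → ℂ)) (z η : Fin n → ℂ) :
    b.form (e.symm z) (tangentVec e z η) = linForm (fun i => b.coeff e i z) η := by
  rw [tangentVec_eq_sum e z η]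
  simp only [map_sum, map_smul, linForm, OneZeroForm.coeff, smul_eq_mul, mul_comm]

theorem mdifferentiable_of_mem_holCharts {e : OpenPartialHomeomorph M (Fin n → ℂ)}
    (he : e ∈ holCharts n M) : e.MDifferentiable 𝓘(ℂ, Fin n → ℂ) 𝓘(ℂ, Fin n → ℂ) :=
  ⟨(contMDiffOn_of_mem_maximalAtlas he).mdifferentiableOn (by simp),
    (contMDiffOn_symm_of_mem_maximalAtlas he).mdifferentiableOn (by simp)⟩

theorem contDiffAt_transition {e e' : OpenPartialHomeomorph M (Fin n → ℂ)}
    (he : e ∈ holCharts n M) (he' : e' ∈ holCharts n M)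
    {z : Fin n → ℂ} (hz : z ∈ e.target) (hz' : e.symm z ∈ e'.source) :
    ContDiffAt ℂ ω (fun z => e' (e.symm z)) z := by
  have h1 : ContMDiffAt 𝓘(ℂ, Fin n → ℂ) 𝓘(ℂ, Fin n → ℂ) ω e.symm z :=
    contMDiffAt_symm_of_mem_maximalAtlas he hz
  have h2 : ContMDiffAt 𝓘(ℂ, Fin n → ℂ) 𝓘(ℂ, Fin n → ℂ) ω e' (e.symm z) :=
    contMDiffAt_of_mem_maximalAtlas he' hz'
  exact (h2.comp z h1).contDiffAt

theorem eventually_transition {M : Type*} [TopologicalSpace M]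
    {e e' : OpenPartialHomeomorph M (Fin n → ℂ)} {z : Fin n → ℂ} (hz : z ∈ e.target) (hz' : e.symm z ∈ e'.source) :
    ∀ᶠ w in 𝓝 z, w ∈ e.target ∧ e.symm w ∈ e'.source := by
  filter_upwards [e.open_target.mem_nhds hz,
    (e.continuousAt_symm hz).preimage_mem_nhds (e'.open_source.mem_nhds hz')] with w h1 h2
    using ⟨h1, h2⟩

theorem tangentVec_bijective {e : OpenPartialHomeomorph M (Fin n → ℂ)} (he : e ∈ holCharts n M)
    {z : Fin n → ℂ} (hz : z ∈ e.target) : Function.Bijective (tangentVec e z) :=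
  (mdifferentiable_of_mem_holCharts he).symm.mfderiv_bijective hz

/-- The coordinate expression of a Hermitian metric and a `(1,0)`-form. -/
def toLocal (a : HermitianMetric n M) (b : OneZeroForm n M)
    {e : OpenPartialHomeomorph M (Fin n → ℂ)} (he : e ∈ holCharts n M) : LocalRanders n where
  V := e.target
  isOpen := e.open_target
  a := a.coeff e
  b := b.coeff e
  smooth_a i j z hz := (a.smooth e he i j).contDiffAt (e.open_target.mem_nhds hz)
  smooth_b i z hz := (b.smooth e he i).contDiffAt (e.open_target.mem_nhds hz)
  herm i j z := a.conj_symm _ _ _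
  pos z hz η hη := by
    rw [← a.form_tangentVec]
    refine a.pos _ _ fun h => hη ?_
    apply (tangentVec_bijective he hz).1
    rw [h]
    exact (map_zero (mfderiv 𝓘(ℂ, Fin n → ℂ) 𝓘(ℂ, Fin n → ℂ) e.symm z)).symm
  nonneg z η := by
    rw [← a.form_tangentVec]
    by_cases h : tangentVec e z η = 0
    · rw [h]; simp
    · exact (a.pos _ _ h).le

variable (a : HermitianMetric n M) (b : OneZeroForm n M)
  {e : OpenPartialHomeomorph M (Fin n → ℂ)} (he : e ∈ holCharts n M)

theorem form_tangentPt (p : Coord n) :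
    a.form (tangentPt e p).1 (tangentPt e p).2 (tangentPt e p).2 = (toLocal a b he).A p :=
  a.form_tangentVec e p.1 p.2 p.2

theorem beta_tangentPt (p : Coord n) : b.beta (tangentPt e p) = (toLocal a b he).beta p :=
  b.form_tangentVec e p.1 p.2

theorem localL_alpha : localL a.alpha e = (toLocal a b he).A := by
  funext p
  rw [localL, HermitianMetric.alpha, form_tangentPt a b he, sq, Complex.ofReal_mul]
  exact LocalRanders.alpha_mul_alpha p

theorem randers_tangentPt (p : Coord n) :
    (randers a b (tangentPt e p) : ℂ) = (toLocal a b he).F p := by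
  rw [randers, HermitianMetric.alpha, form_tangentPt a b he, beta_tangentPt a b he,
    LocalRanders.F, LocalRanders.alpha, LocalRanders.nu, Complex.ofReal_add]

theorem localL_randers : localL (randers a b) e = (toLocal a b he).L := by
  funext p
  rw [localL, sq, Complex.ofReal_mul, randers_tangentPt a b he, LocalRanders.L]

theorem localDom_regularDom : localDom b.regularDom e = (toLocal a b he).Om := by
  ext p
  simp only [localDom, OneZeroForm.regularDom, Set.mem_ofPred_eq, beta_tangentPt a b he,
    LocalRanders.Om]
  rfl

/-- Since b_k θ^{*k} is −2 times the Γ-contraction, the sign disappears and the 2 in the denominator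
becomes 4. -/
theorem randersP_eq {p : Coord n} (hp : p ∈ (toLocal a b he).Om) :
    randersP a b e p = star ((toLocal a b he).beta p) /
      (4 * (toLocal a b he).F p * (toLocal a b he).nu p) * (toLocal a b he).bTheta p := by
  rw [LocalRanders.bTheta_eq hp.1, randersP, randers_tangentPt a b he, beta_tangentPt a b he]
  have h1 := LocalRanders.F_ne_zero hp
  have h2 := LocalRanders.nu_ne_zero hp
  change -(star ((toLocal a b he).beta p) / (2 * (toLocal a b he).F p * (toLocal a b he).nu p)) *
    (∑ k, ∑ i, ∑ j, (toLocal a b he).gamma k i j p.1 * (toLocal a b he).b k p.1 * p.2 i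
      * star (p.2 j)) = _
  field_simp
  ring

/-! ## Changes of charts -/

section Charts

variable {e e' : OpenPartialHomeomorph M (Fin n → ℂ)}

theorem tangentVec_transition (he : e ∈ holCharts n M) (he' : e' ∈ holCharts n M)
    {z : Fin n → ℂ} (hz : z ∈ e.target) (hz' : e.symm z ∈ e'.source) (v : Fin n → ℂ) :
    (tangentVec e z v : Fin n → ℂ) =
      tangentVec e' (e' (e.symm z)) (fderiv ℂ (fun z => e' (e.symm z)) z v) := by
  have hf : MDifferentiableAt 𝓘(ℂ, Fin n → ℂ) 𝓘(ℂ, Fin n → ℂ) (fun z => e' (e.symm z)) z :=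
    ((contDiffAt_transition he he' hz hz').differentiableAt (by simp)).mdifferentiableAt
  have hg : MDifferentiableAt 𝓘(ℂ, Fin n → ℂ) 𝓘(ℂ, Fin n → ℂ) e'.symm (e' (e.symm z)) :=
    (mdifferentiable_of_mem_holCharts he').mdifferentiableAt_symm (e'.map_source hz')
  have h1 := mfderiv_comp z hg hf
  have h2 : e.symm =ᶠ[𝓝 z] e'.symm ∘ fun z => e' (e.symm z) := by
    filter_upwards [eventually_transition (e' := e') hz hz'] with w hw
    exact (e'.left_inv hw.2).symm
  have h3 := h2.mfderiv_eq (I := 𝓘(ℂ, Fin n → ℂ)) (I' := 𝓘(ℂ, Fin n → ℂ))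
  rw [h1, mfderiv_eq_fderiv] at h3
  exact DFunLike.congr_fun h3 v

theorem tangentPt_transition (he : e ∈ holCharts n M) (he' : e' ∈ holCharts n M)
    {z : Fin n → ℂ} (hz : z ∈ e.target) (hz' : e.symm z ∈ e'.source) (v : Fin n → ℂ) :
    tangentPt e (z, v) =
      tangentPt e' (e' (e.symm z), fderiv ℂ (fun z => e' (e.symm z)) z v) := by
  -- The base points are generalized so that their equality can be eliminated although the tangent
  -- vectors live in spaces depending on them.
  have h : ∀ (x y : M) (u w : Fin n → ℂ), x = y → u = w →
      (⟨x, u⟩ : HolTangent n M) = ⟨y, w⟩ := by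
    rintro x _ u _ rfl rfl; rfl
  exact h _ _ _ _ (e'.left_inv hz').symm (tangentVec_transition he he' hz hz' v)

theorem sesqForm_transition (he : e ∈ holCharts n M) (he' : e' ∈ holCharts n M)
    {z : Fin n → ℂ} (hz : z ∈ e.target) (hz' : e.symm z ∈ e'.source) (v w : Fin n → ℂ) :
    sesqForm ((toLocal a b he).aAt z) v w =
      sesqForm ((toLocal a b he').aAt (e' (e.symm z)))
        (fderiv ℂ (fun z => e' (e.symm z)) z v) (fderiv ℂ (fun z => e' (e.symm z)) z w) := by
  have h : ∀ (x y : M) (u w u' w' : Fin n → ℂ), x = y → u = u' → w = w' →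
      a.form x u w = a.form y u' w' := by
    rintro x _ u w _ _ rfl rfl rfl; rfl
  have h1 := h _ _ _ _ _ _ (e'.left_inv hz').symm (tangentVec_transition he he' hz hz' v)
    (tangentVec_transition he he' hz hz' w)
  have h2 := a.form_tangentVec e z v w
  have h3 := a.form_tangentVec e' (e' (e.symm z)) (fderiv ℂ (fun z => e' (e.symm z)) z v)
    (fderiv ℂ (fun z => e' (e.symm z)) z w)
  exact h2.symm.trans (h1.trans h3)

end Charts

end CFinsler

end

noncomputable section

namespace CFinsler

variable {n : ℕ}

/-! ## The geodesic equation of a Hermitian metric as an Euler-Lagrange equation -/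

theorem contDiffAt_deriv {E : Type*} [NormedAddCommGroup E] [NormedSpace ℝ E] {c : ℝ → E} {s : ℝ}
    (hc : ContDiffAt ℝ 2 c s) : ContDiffAt ℝ 1 (deriv c) s :=
  (hc.fderiv_right (m := 1) (by norm_num)).clm_apply contDiffAt_const

namespace LocalRanders
variable {R : LocalRanders n}

theorem thetaStar_A_eq_raise {p : Coord n} (hp : p ∈ R.U) (k : Fin n) :
    thetaStar R.A k p = ∑ m, R.inv p.1 m k * ∑ i, ∑ j,
      (wirtBar (Pi.single m 1) (R.a i j) p.1 - wirtBar (Pi.single j 1) (R.a i m) p.1)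
        * p.2 i * star (p.2 j) := by
  rw [thetaStar_A hp]
  simp only [gamma, Finset.mul_sum, Finset.sum_mul]
  symm
  rw [Finset.sum_comm]
  refine Finset.sum_congr rfl fun i _ => ?_
  rw [Finset.sum_comm]
  refine Finset.sum_congr rfl fun j _ => Finset.sum_congr rfl fun m _ => by ring

theorem smooth_thetaStar_A {p : Coord n} (hp : p ∈ R.U) (k : Fin n) :
    ContDiffAt ℝ ∞ (thetaStar R.A k) p := by
  have h1 : ∀ i, ContDiffAt ℝ ∞ (fun q : Coord n => star (q.2 i)) p := fun i =>
    contDiffAt_star (smooth_eta i p)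
  have h2 : ∀ m i j, ContDiffAt ℝ ∞ (fun q : Coord n => wirtBar (Pi.single m 1) (R.a i j) q.1) p :=
    fun m i j => (contDiffAt_wirtBar (R.smooth_a i j p.1 hp) _).comp p contDiffAt_fst
  have h3 : ContDiffAt ℝ ∞ (fun p : Coord n => ∑ m, fundInv R.A m k p * ∑ i, ∑ j,
      (wirtBar (Pi.single m 1) (R.a i j) p.1 - wirtBar (Pi.single j 1) (R.a i m) p.1)
        * p.2 i * star (p.2 j)) p :=
    ContDiffAt.sum fun m _ => (isFinslerOn_A.smooth_fundInv hp m k).mul <|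
      ContDiffAt.sum fun i _ => ContDiffAt.sum fun j _ =>
        (((h2 m i j).sub (h2 j i m)).mul (smooth_eta i p)).mul (h1 j)
  refine h3.congr_of_eventuallyEq ?_
  filter_upwards [isOpen_U.mem_nhds hp] with q hq
  rw [thetaStar_A_eq_raise hq]
  simp only [fundInv_A hq]

theorem wirtBar_sesqForm {z : Fin n → ℂ} (hz : z ∈ R.V) (v ξ ζ : Fin n → ℂ) :
    wirtBar v (fun z => sesqForm (R.aAt z) ξ ζ) z =
      ∑ i, ∑ j, wirtBar v (R.a i j) z * ξ i * star (ζ j) := by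
  have d : ∀ i j, DifferentiableAt ℝ (R.a i j) z := fun i j => diff_a i j hz
  unfold sesqForm
  rw [wirtBar_sum _ fun i _ => DifferentiableAt.fun_sum fun j _ => by fun_prop]
  refine Finset.sum_congr rfl fun i _ => ?_
  rw [wirtBar_sum _ fun j _ => by fun_prop]
  refine Finset.sum_congr rfl fun j _ => ?_
  rw [wirtBar_mul (by fun_prop) (by fun_prop), wirtBar_mul (by fun_prop) (by fun_prop)]
  simp

theorem wirtBar_eq_sum (v : Fin n → ℂ) (f : (Fin n → ℂ) → ℂ) (z : Fin n → ℂ) :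
    wirtBar v f z = ∑ j, star (v j) * wirtBar (Pi.single j 1) f z := by
  nth_rewrite 1 [sum_smul_single v]
  rw [wirtBar_sum_left]
  simp only [wirtBar_smul_left]

variable (R) in
/-- The Euler-Lagrange equation of the energy `α²`, tested against the covector slot `v`. -/
def EulerLagrange (c : ℝ → Fin n → ℂ) (s : ℝ) (v : Fin n → ℂ) : Prop :=
  deriv (fun t => sesqForm (R.aAt (c t)) (deriv c t) v) s =
    wirtBar v (fun z => sesqForm (R.aAt z) (deriv c s) (deriv c s)) (c s)

theorem hasDerivAt_low {c : ℝ → Fin n → ℂ} {s : ℝ} (hc : ContDiffAt ℝ 2 c s) (hs : c s ∈ R.V)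
    (m : Fin n) : HasDerivAt (fun t => R.low m (c t, deriv c t))
      (∑ i, ((wirt (deriv c s) (R.a i m) (c s) + wirtBar (deriv c s) (R.a i m) (c s)) * deriv c s i
        + R.a i m (c s) * deriv (deriv c) s i)) s := by
  have h1 : HasDerivAt c (deriv c s) s := (hc.differentiableAt (by simp)).hasDerivAt
  have h2 : HasDerivAt (deriv c) (deriv (deriv c) s) s :=
    (contDiffAt_deriv hc).differentiableAt (by simp) |>.hasDerivAt
  unfold low
  refine HasDerivAt.fun_sum fun i _ => ?_
  have h3 : HasDerivAt (fun t => R.a i m (c t))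
      (wirt (deriv c s) (R.a i m) (c s) + wirtBar (deriv c s) (R.a i m) (c s)) s := by
    rw [← fderiv_eq_wirt_add_wirtBar]
    exact (diff_a i m hs).hasFDerivAt.comp_hasDerivAt s h1
  have h4 : HasDerivAt (fun t => deriv c t i) (deriv (deriv c) s i) s := (hasDerivAt_pi.1 h2) i
  exact h3.mul h4

/-- The geodesic equation with lowered index. -/
theorem lower_geodesic {c : ℝ → Fin n → ℂ} {s : ℝ} (hc : ContDiffAt ℝ 2 c s) (hs : c s ∈ R.V)
    (m : Fin n) :
    ∑ i, (deriv (deriv c) s i + 2 * spray R.A i (c s, deriv c s)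
        - thetaStar R.A i (c s, deriv c s)) * R.a i m (c s) =
      deriv (fun t => R.low m (c t, deriv c t)) s -
        wirtBar (Pi.single m 1) (fun z => sesqForm (R.aAt z) (deriv c s) (deriv c s)) (c s) := by
  set ξ := deriv c s
  have hp : ((c s, ξ) : Coord n) ∈ R.U := hs
  rw [(hasDerivAt_low hc hs m).deriv, wirtBar_sesqForm hs]
  have e1 : ∑ i, (wirt ξ (R.a i m) (c s) * ξ i +
      R.a i m (c s) * (-(2 * spray R.A i (c s, ξ)))) = 0 := by
    have h1 := isFinslerOn_A.lower_spray hp m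
    have h2 : wirt (sprayField R.A (c s, ξ)) (dEtaBar m R.A) (c s, ξ) =
        wirt (sprayField R.A (c s, ξ)) (R.low m) (c s, ξ) := by
      refine wirt_congr ?_ _
      filter_upwards [isOpen_U.mem_nhds hp] with q hq using dEtaBar_A hq m
    rw [h2, wirt_low hp] at h1
    exact h1
  have e2 : ∑ k, thetaStar R.A k (c s, ξ) * R.a k m (c s) = ∑ i, ∑ j,
      (wirtBar (Pi.single m 1) (R.a i j) (c s) - wirtBar (Pi.single j 1) (R.a i m) (c s))
        * ξ i * star (ξ j) := by
    have := isFinslerOn_A.lower_raise hp (fun m => ∑ i, ∑ j,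
      (wirtBar (Pi.single m 1) (R.a i j) (c s) - wirtBar (Pi.single j 1) (R.a i m) (c s))
        * ξ i * star (ξ j)) m
    rw [← this]
    refine Finset.sum_congr rfl fun k _ => ?_
    rw [thetaStar_A_eq_raise hp, fundTensor_A hp]
    simp only [fundInv_A hp]
  have e3 : ∑ i, wirtBar ξ (R.a i m) (c s) * ξ i =
      ∑ i, ∑ j, wirtBar (Pi.single j 1) (R.a i m) (c s) * ξ i * star (ξ j) := by
    refine Finset.sum_congr rfl fun i _ => ?_
    rw [wirtBar_eq_sum, Finset.sum_mul]
    exact Finset.sum_congr rfl fun j _ => by ring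
  simp only [sub_mul, add_mul, Finset.sum_sub_distrib, Finset.sum_add_distrib] at e1 e2 ⊢
  rw [e2, e3]
  have e4 : ∑ i, R.a i m (c s) * (-(2 * spray R.A i (c s, ξ))) =
      -∑ i, 2 * spray R.A i (c s, ξ) * R.a i m (c s) := by
    rw [← Finset.sum_neg_distrib]
    exact Finset.sum_congr rfl fun i _ => by ring
  have e5 : ∑ i, R.a i m (c s) * deriv (deriv c) s i = ∑ i, deriv (deriv c) s i * R.a i m (c s) :=
    Finset.sum_congr rfl fun i _ => mul_comm _ _
  rw [e4] at e1
  rw [e5]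
  linear_combination -e1

/-- Lowered with a, the geodesic equation of α is d/dt(∂α²/∂η̄^m) = ∂α²/∂z̄^m. This form involves
neither G nor θ*, and its invariance under holomorphic changes of chart can be checked directly. -/
theorem geodesic_iff_eulerLagrange {c : ℝ → Fin n → ℂ} {s : ℝ} (hc : ContDiffAt ℝ 2 c s)
    (hs : c s ∈ R.V) :
    (∀ i, deriv (deriv c) s i + 2 * spray R.A i (c s, deriv c s) =
      thetaStar R.A i (c s, deriv c s)) ↔ ∀ v, R.EulerLagrange c s v := by
  have key : ∀ v, deriv (fun t => sesqForm (R.aAt (c t)) (deriv c t) v) s -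
      wirtBar v (fun z => sesqForm (R.aAt z) (deriv c s) (deriv c s)) (c s) =
      ∑ m, (∑ i, (deriv (deriv c) s i + 2 * spray R.A i (c s, deriv c s)
        - thetaStar R.A i (c s, deriv c s)) * R.a i m (c s)) * star (v m) := fun v => by
    have h1 : HasDerivAt (fun t => sesqForm (R.aAt (c t)) (deriv c t) v)
        (∑ m, deriv (fun t => R.low m (c t, deriv c t)) s * star (v m)) s := by
      simp only [sesqForm_eq_conjForm]
      exact HasDerivAt.fun_sum fun m _ =>
        ((hasDerivAt_low hc hs m).differentiableAt.hasDerivAt).mul_const _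
    rw [h1.deriv, wirtBar_eq_sum]
    rw [← Finset.sum_sub_distrib]
    refine Finset.sum_congr rfl fun m _ => ?_
    rw [lower_geodesic hc hs]
    ring
  constructor
  · intro h v
    have := key v
    simp only [h, sub_self, zero_mul, Finset.sum_const_zero] at this
    exact sub_eq_zero.1 this
  · intro h i
    refine sub_eq_zero.1 (eq_zero_of_lower hs (x := fun i => deriv (deriv c) s i
      + 2 * spray R.A i (c s, deriv c s) - thetaStar R.A i (c s, deriv c s)) (fun m => ?_) i)
    have h1 := key (Pi.single m 1)
    rw [sub_eq_zero.2 (h (Pi.single m 1))] at h1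
    have h2 := conjForm_single (fun m => ∑ i, (deriv (deriv c) s i
      + 2 * spray R.A i (c s, deriv c s) - thetaStar R.A i (c s, deriv c s)) * R.a i m (c s)) m
    rw [conjForm, ← h1] at h2
    exact h2.symm

/-- Invariance of the Euler-Lagrange equation under holomorphic changes of coordinates. -/
theorem EulerLagrange.map {R' : LocalRanders n} {f : (Fin n → ℂ) → Fin n → ℂ}
    {c : ℝ → Fin n → ℂ} {s : ℝ} (hc : ContDiffAt ℝ 2 c s)
    (hf : ContDiffAt ℂ ω f (c s)) (hfs : f (c s) ∈ R'.V)
    (hR : ∀ᶠ z in 𝓝 (c s), ∀ v w, sesqForm (R.aAt z) v w =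
      sesqForm (R'.aAt (f z)) (fderiv ℂ f z v) (fderiv ℂ f z w))
    {v : Fin n → ℂ} (h : R.EulerLagrange c s v) :
    R'.EulerLagrange (fun t => f (c t)) s (fderiv ℂ f (c s) v) := by
  have hc1 : HasDerivAt c (deriv c s) s := (hc.differentiableAt (by simp)).hasDerivAt
  have hfd : ∀ᶠ z in 𝓝 (c s), DifferentiableAt ℂ f z := by
    have : ∀ᶠ z in 𝓝 (c s), ContDiffAt ℂ 1 f z :=
      (hf.of_le (by simp)).eventually (by simp)
    filter_upwards [this] with z hz using hz.differentiableAt (by simp)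
  have hf2 : DifferentiableAt ℂ (fderiv ℂ f) (c s) :=
    (hf.fderiv_right (m := 1) (by simp)).differentiableAt (by simp)
  have hsym : ∀ u w, fderiv ℂ (fderiv ℂ f) (c s) u w = fderiv ℂ (fderiv ℂ f) (c s) w u :=
    (hf.isSymmSndFDerivAt (by simp)).eq
  have hcd : ∀ᶠ t in 𝓝 s, DifferentiableAt ℝ c t := by
    have : ∀ᶠ t in 𝓝 s, ContDiffAt ℝ 1 c t := (hc.of_le (by norm_num)).eventually (by simp)
    filter_upwards [this] with t ht using ht.differentiableAt (by simp)
  have hder : ∀ t, DifferentiableAt ℝ c t → DifferentiableAt ℂ f (c t) →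
      deriv (fun t => f (c t)) t = fderiv ℂ f (c t) (deriv c t) := fun t h1 h2 =>
    ((h2.hasFDerivAt.restrictScalars ℝ).comp_hasDerivAt t h1.hasDerivAt).deriv
  have hξ := hder s hc1.differentiableAt hfd.self_of_nhds
  set ξ := deriv c s with hξdef
  set ξ' := fderiv ℂ f (c s) ξ with hξ'
  set v' := fderiv ℂ f (c s) v with hv'
  set D := fderiv ℂ (fderiv ℂ f) (c s) with hD
  have hc' : ContDiffAt ℝ 2 (fun t => f (c t)) s :=
    ((hf.restrict_scalars ℝ).of_le (by simp)).comp s hc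
  -- the derivative of the momentum
  have e1 : deriv (fun t => sesqForm (R.aAt (c t)) (deriv c t) v) s =
      deriv (fun t => sesqForm (R'.aAt (f (c t))) (deriv (fun t => f (c t)) t) v') s
        + sesqForm (R'.aAt (f (c s))) ξ' (D ξ v) := by
    have h1 : (fun t => sesqForm (R.aAt (c t)) (deriv c t) v) =ᶠ[𝓝 s]
        fun t => ∑ m, R'.low m (f (c t), deriv (fun t => f (c t)) t)
          * star (fderiv ℂ f (c t) v m) := by
      filter_upwards [hcd, hc1.continuousAt.eventually hfd, hc1.continuousAt.eventually hR]
        with t h1 h2 h3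
      rw [h3, hder t h1 h2, sesqForm_eq_conjForm]
      rfl
    have h2 := fun m => hasDerivAt_low (R := R') hc' hfs m
    have h3 : HasDerivAt (fun t => fderiv ℂ f (c t) v) (D ξ v) s := by
      have := (hf2.hasFDerivAt.restrictScalars ℝ).comp_hasDerivAt s hc1
      exact (((ContinuousLinearMap.apply ℂ (Fin n → ℂ) v).restrictScalars ℝ).hasFDerivAt
        (x := fderiv ℂ f (c s))).comp_hasDerivAt s this
    have h4 : ∀ m, HasDerivAt (fun t => star (fderiv ℂ f (c t) v m)) (star (D ξ v m)) s := fun m =>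
      ((hasDerivAt_pi.1 h3) m).star
    have h6 := HasDerivAt.fun_sum (u := Finset.univ) fun m _ => (h2 m).fun_mul (h4 m)
    rw [h1.deriv_eq, h6.deriv]
    have h5 : HasDerivAt (fun t => sesqForm (R'.aAt (f (c t))) (deriv (fun t => f (c t)) t) v')
        (∑ m, deriv (fun t => R'.low m (f (c t), deriv (fun t => f (c t)) t)) s * star (v' m)) s := by
      simp only [sesqForm_eq_conjForm]
      exact HasDerivAt.fun_sum fun m _ => ((h2 m).differentiableAt.hasDerivAt).mul_const _
    rw [h5.deriv, sesqForm_eq_conjForm, conjForm, ← Finset.sum_add_distrib]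
    refine Finset.sum_congr rfl fun m _ => ?_
    rw [(h2 m).deriv, hξ]
    rfl
  -- the derivative of the energy
  have e2 : wirtBar v (fun z => sesqForm (R.aAt z) ξ ξ) (c s) =
      wirtBar v' (fun z => sesqForm (R'.aAt z) ξ' ξ') (f (c s))
        + sesqForm (R'.aAt (f (c s))) ξ' (D v ξ) := by
    have h1 : (fun z => sesqForm (R.aAt z) ξ ξ) =ᶠ[𝓝 (c s)] fun z =>
        ∑ i, ∑ j, R'.a i j (f z) * fderiv ℂ f z ξ i * star (fderiv ℂ f z ξ j) := by
      filter_upwards [hR] with z hz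
      rw [hz]; rfl
    have hd : ∀ i, DifferentiableAt ℂ (fun z => fderiv ℂ f z ξ i) (c s) := fun i => by
      have : DifferentiableAt ℂ (fun z => fderiv ℂ f z ξ) (c s) := by fun_prop
      exact differentiableAt_pi.1 this i
    have hdR : ∀ i, DifferentiableAt ℝ (fun z => fderiv ℂ f z ξ i) (c s) := fun i =>
      (hd i).restrictScalars ℝ
    have hds : ∀ i, DifferentiableAt ℝ (fun z => star (fderiv ℂ f z ξ i)) (c s) := fun i =>
      differentiableAt_star (hdR i)
    have hfR : DifferentiableAt ℝ f (c s) := hfd.self_of_nhds.restrictScalars ℝ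
    have hda : ∀ i j, DifferentiableAt ℝ (fun z => R'.a i j (f z)) (c s) := fun i j =>
      (diff_a i j hfs).comp (c s) hfR
    have hda2 : ∀ i j, DifferentiableAt ℝ (fun z => R'.a i j (f z) * fderiv ℂ f z ξ i) (c s) :=
      fun i j => (hda i j).fun_mul (hdR i)
    have hda3 : ∀ i j, DifferentiableAt ℝ
        (fun z => R'.a i j (f z) * fderiv ℂ f z ξ i * star (fderiv ℂ f z ξ j)) (c s) :=
      fun i j => (hda2 i j).fun_mul (hds j)
    have hw : ∀ j, wirt v (fun z => fderiv ℂ f z ξ j) (c s) = D v ξ j := fun j => by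
      rw [wirt_of_differentiableAt (hd j), fderiv_apply (by fun_prop),
        fderiv_clm_apply hf2 (by fun_prop)]
      simp [hD]
    rw [wirtBar_congr h1, wirtBar_sum _ fun i _ => DifferentiableAt.fun_sum fun j _ => hda3 i j,
      wirtBar_sesqForm hfs, sesqForm, ← Finset.sum_add_distrib]
    refine Finset.sum_congr rfl fun i _ => ?_
    rw [wirtBar_sum _ fun j _ => hda3 i j, ← Finset.sum_add_distrib]
    refine Finset.sum_congr rfl fun j _ => ?_
    rw [wirtBar_mul (hda2 i j) (hds j), wirtBar_mul (hda i j) (hdR i),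
      wirtBar_of_differentiableAt (hd i), wirtBar_star, hw,
      wirtBar_comp (diff_a i j hfs) hfd.self_of_nhds]
    ring
  unfold EulerLagrange at h ⊢
  rw [hξ]
  -- Momentum and energy each acquire a term in the second derivative of f; the two agree by its
  -- symmetry and cancel.
  rw [← hξdef, e1, e2, hsym ξ v] at h
  exact add_right_cancel h

end LocalRanders
end CFinsler

end

noncomputable section

namespace CFinsler

variable {n : ℕ}

/-! ## Existence of geodesics -/

namespace LocalRanders
variable {R : LocalRanders n}

/-- Picard–Lindelöf for the first-order system z' = η, η' = θ* − 2G, with the interval shrunk so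
that β stays nonzero along the velocity. -/
theorem exists_geodesic {p : Coord n} (hp : p ∈ R.Om) :
    ∃ c : ℝ → Fin n → ℂ, ∃ ε > 0, c 0 = p.1 ∧ deriv c 0 = p.2 ∧
      ∀ t ∈ Set.Ioo (-ε) ε, ContDiffAt ℝ 2 c t ∧ (c t, deriv c t) ∈ R.Om ∧
        ∀ i, deriv (deriv c) t i + 2 * spray R.A i (c t, deriv c t) =
          thetaStar R.A i (c t, deriv c t) := by
  let Φ : Coord n → Coord n := fun q => (q.2, fun i => thetaStar R.A i q - 2 * spray R.A i q)
  have hΦ : ∀ q ∈ R.Om, ContDiffAt ℝ 1 Φ q := fun q hq => by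
    refine contDiffAt_snd.prodMk (contDiffAt_pi.2 fun i => ?_)
    exact ((smooth_thetaStar_A hq.1 i).of_le (by simp)).sub
      (contDiffAt_const.mul ((isFinslerOn_A.smooth_spray hq.1 i).of_le (by simp)))
  obtain ⟨Ψ, hΨ0, ε₀, hε₀, hΨ⟩ :=
    (hΦ p hp).exists_forall_mem_closedBall_exists_eq_forall_mem_Ioo_hasDerivAt₀ 0
  have hcont : ContinuousAt Ψ 0 := (hΨ 0 (by constructor <;> linarith)).continuousAt
  have hOm : ∀ᶠ t in 𝓝 (0 : ℝ), Ψ t ∈ R.Om :=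
    hcont.eventually_mem (by rw [hΨ0]; exact isOpen_Om.mem_nhds hp)
  obtain ⟨ε₁, hε₁, hball⟩ := Metric.eventually_nhds_iff_ball.1 hOm
  have hmem : ∀ t ∈ Set.Ioo (-min ε₀ ε₁) (min ε₀ ε₁), HasDerivAt Ψ (Φ (Ψ t)) t ∧ Ψ t ∈ R.Om := by
    intro t ht
    have h1 := min_le_left ε₀ ε₁
    have h2 := min_le_right ε₀ ε₁
    refine ⟨hΨ t ⟨by linarith [ht.1], by linarith [ht.2]⟩, hball t ?_⟩
    rw [Metric.mem_ball, dist_zero_right, Real.norm_eq_abs, abs_lt]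
    exact ⟨by linarith [ht.1], by linarith [ht.2]⟩
  set ε := min ε₀ ε₁ with hε
  have hε0 : 0 < ε := lt_min hε₀ hε₁
  have hJ : IsOpen (Set.Ioo (-ε) ε) := isOpen_Ioo
  have h1 : ∀ t ∈ Set.Ioo (-ε) ε, HasDerivAt (fun t => (Ψ t).1) (Ψ t).2 t := fun t ht =>
    (hmem t ht).1.fst
  have h2 : ∀ t ∈ Set.Ioo (-ε) ε, HasDerivAt (fun t => (Ψ t).2)
      (fun i => thetaStar R.A i (Ψ t) - 2 * spray R.A i (Ψ t)) t := fun t ht =>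
    (hmem t ht).1.snd
  have hd1 : ∀ t ∈ Set.Ioo (-ε) ε, deriv (fun t => (Ψ t).1) t = (Ψ t).2 := fun t ht => (h1 t ht).deriv
  have hC1 : ContDiffOn ℝ 1 Ψ (Set.Ioo (-ε) ε) := by
    -- Regularity is bootstrapped: the derivative Φ ∘ Ψ is continuous, so Ψ is C¹, and its first
    -- component, with derivative the second, is C².
    have : ContDiffOn ℝ (0 + 1) Ψ (Set.Ioo (-ε) ε) := by
      rw [contDiffOn_succ_iff_deriv_of_isOpen hJ]
      refine ⟨fun t ht => (hmem t ht).1.differentiableAt.differentiableWithinAt, by simp, ?_⟩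
      rw [contDiffOn_zero]
      refine ContinuousOn.congr (f := fun t => Φ (Ψ t)) (fun t ht => ?_) fun t ht => (hmem t ht).1.deriv
      exact ((hΦ _ (hmem t ht).2).continuousAt.comp
        (hmem t ht).1.continuousAt).continuousWithinAt
    simpa using this
  have hC2 : ContDiffOn ℝ 2 (fun t => (Ψ t).1) (Set.Ioo (-ε) ε) := by
    have : ContDiffOn ℝ (1 + 1) (fun t => (Ψ t).1) (Set.Ioo (-ε) ε) := by
      rw [contDiffOn_succ_iff_deriv_of_isOpen hJ]
      exact ⟨fun t ht => (h1 t ht).differentiableAt.differentiableWithinAt, by simp,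
        hC1.snd.congr hd1⟩
    convert this using 1; norm_num
  refine ⟨fun t => (Ψ t).1, ε, hε0, by simp [hΨ0], ?_, fun t ht => ⟨?_, ?_, ?_⟩⟩
  · rw [hd1 0 (by constructor <;> linarith), hΨ0]
  · exact hC2.contDiffAt (hJ.mem_nhds ht)
  · rw [hd1 t ht]; exact (hmem t ht).2
  · intro i
    have h3 : deriv (deriv fun t => (Ψ t).1) t =
        fun i => thetaStar R.A i (Ψ t) - 2 * spray R.A i (Ψ t) := by
      rw [← (h2 t ht).deriv]
      exact Filter.EventuallyEq.deriv_eq (Filter.eventuallyEq_of_mem (hJ.mem_nhds ht) hd1)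
    rw [h3, hd1 t ht]
    simp only [sub_add_cancel]

end LocalRanders

variable {M : Type*} [TopologicalSpace M] [ChartedSpace (Fin n → ℂ) M]

/-- A complex geodesic must satisfy its equation in every holomorphic chart, whereas the solution is
built in one; the Euler–Lagrange form carries it over. -/
theorem exists_complexGeodesic (a : HermitianMetric n M) (b : OneZeroForm n M)
    {e : OpenPartialHomeomorph M (Fin n → ℂ)} (he : e ∈ holCharts n M) {p : Coord n}
    (hp : p ∈ (toLocal a b he).Om) :
    ∃ (γ : ℝ → M) (J : Set ℝ), IsOpen J ∧ J.OrdConnected ∧ 0 ∈ J ∧ γ 0 ∈ e.source ∧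
      e (γ 0) = p.1 ∧ deriv (fun t => e (γ t)) 0 = p.2 ∧
      IsComplexGeodesicOn a.alpha b.regularDom γ J := by
  obtain ⟨c, ε, hε, hc0, hc1, hc⟩ := LocalRanders.exists_geodesic hp
  have h0 : (0 : ℝ) ∈ Set.Ioo (-ε) ε := by constructor <;> linarith
  have htgt : ∀ t ∈ Set.Ioo (-ε) ε, c t ∈ e.target := fun t ht => (hc t ht).2.1.1
  have hder : ∀ e' ∈ holCharts n M, ∀ s ∈ Set.Ioo (-ε) ε, e.symm (c s) ∈ e'.source →
      deriv (fun t => e' (e.symm (c t))) s =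
        fderiv ℂ (fun z => e' (e.symm z)) (c s) (deriv c s) := fun e' he' s hs hs' =>
    ((((contDiffAt_transition he he' (htgt s hs) hs').differentiableAt
      (by simp)).hasFDerivAt.restrictScalars ℝ).comp_hasDerivAt s
      (((hc s hs).1.differentiableAt (by simp)).hasDerivAt)).deriv
  have hC2 : ∀ e' ∈ holCharts n M, ∀ s ∈ Set.Ioo (-ε) ε, e.symm (c s) ∈ e'.source →
      ContDiffAt ℝ 2 (fun t => e' (e.symm (c t))) s := fun e' he' s hs hs' =>
    (((contDiffAt_transition he he' (htgt s hs) hs').restrict_scalars ℝ).of_le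
      (by simp)).comp s (hc s hs).1
  refine ⟨fun t => e.symm (c t), Set.Ioo (-ε) ε, isOpen_Ioo, Set.ordConnected_Ioo, h0,
    e.map_target (htgt 0 h0), ?_, ?_, ⟨?_, hC2, ?_, ?_⟩⟩
  · rw [e.right_inv (htgt 0 h0), hc0]
  · rw [← hc1]
    refine Filter.EventuallyEq.deriv_eq ?_
    filter_upwards [isOpen_Ioo.mem_nhds h0] with t ht using e.right_inv (htgt t ht)
  · exact fun t ht => ((e.continuousAt_symm (htgt t ht)).comp
      (hc t ht).1.continuousAt).continuousWithinAt
  · intro e' he' s hs hs'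
    rw [hder e' he' s hs hs']
    refine ⟨e'.map_source hs', ?_⟩
    rw [← tangentPt_transition he he' (htgt s hs) hs']
    have := (hc s hs).2.1
    rw [← localDom_regularDom] at this
    exact this.2
  · intro e' he' s hs hs'
    rw [localL_alpha a b he']
    have htgt' : e' (e.symm (c s)) ∈ (toLocal a b he').V := e'.map_source hs'
    refine (LocalRanders.geodesic_iff_eulerLagrange (R := toLocal a b he') (hC2 e' he' s hs hs')
      htgt').2 fun w => ?_
    -- The derivative of the transition map is onto, so every test vector in the new chart comes
    -- from the old one.
    obtain ⟨v, rfl⟩ : ∃ v, fderiv ℂ (fun z => e' (e.symm z)) (c s) v = w := by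
      obtain ⟨v, hv⟩ := (tangentVec_bijective he (htgt s hs)).2 (tangentVec e' (e' (e.symm (c s))) w)
      refine ⟨v, (tangentVec_bijective he' htgt').1 ?_⟩
      exact (tangentVec_transition he he' (htgt s hs) hs' v).symm.trans hv
    refine LocalRanders.EulerLagrange.map (R := toLocal a b he) (hc s hs).1
      (contDiffAt_transition he he' (htgt s hs) hs') htgt' ?_
      ((LocalRanders.geodesic_iff_eulerLagrange (hc s hs).1 (htgt s hs)).1 (hc s hs).2.2 v)
    filter_upwards [eventually_transition (e' := e') (htgt s hs) hs'] with z hz v w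
    exact sesqForm_transition a b he he' hz.1 hz.2 v w

/-! ## Projectively related metrics -/

/-- If the geodesics of `α` are, up to parametrization, geodesics of the Randers metric, then the
geodesic equations differ by a real multiple of the velocity. -/
theorem exists_factor_of_geodesicsReparam {a : HermitianMetric n M} {b : OneZeroForm n M}
    (h : GeodesicsReparam a.alpha (randers a b) b.regularDom)
    {e : OpenPartialHomeomorph M (Fin n → ℂ)} (he : e ∈ holCharts n M) {p : Coord n}
    (hp : p ∈ (toLocal a b he).Om) :
    ∃ r : ℝ, ∀ i, 2 * (spray (toLocal a b he).L i p - spray (toLocal a b he).A i p)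
      - (thetaStar (toLocal a b he).L i p - thetaStar (toLocal a b he).A i p) = r * p.2 i := by
  obtain ⟨γ, J, hJ, hJc, h0, hγ0, hγp, hγv, hγ⟩ := exists_complexGeodesic a b he hp
  obtain ⟨φ, γ', hφ, hγ', hgeo⟩ := h γ J hJ hJc hγ
  have hφ0 : φ 0 ∈ φ '' J := Set.mem_image_of_mem φ h0
  have hγ'0 : γ' (φ 0) ∈ e.source := by rw [hγ' 0 h0]; exact hγ0
  set c : ℝ → Fin n → ℂ := fun t => e (γ t) with hcdef
  set c' : ℝ → Fin n → ℂ := fun t => e (γ' t) with hcdef'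
  have hcc : ∀ t ∈ J, c t = c' (φ t) := fun t ht => by simp only [c, c', hγ' t ht]
  have hc' : ContDiffAt ℝ 2 c' (φ 0) := hgeo.contDiffAt e he _ hφ0 hγ'0
  have eq1 := hγ.equation e he 0 h0 hγ0
  have eq2 := hgeo.equation e he _ hφ0 hγ'0
  rw [localL_alpha a b he] at eq1
  rw [localL_randers a b he] at eq2
  have hr : 0 < deriv φ 0 := (hφ 0 h0).2
  have hφC := (hφ 0 h0).1
  have hφd : HasDerivAt φ (deriv φ 0) 0 := (hφC.differentiableAt (by simp)).hasDerivAt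
  have hφdd : HasDerivAt (deriv φ) (deriv (deriv φ) 0) 0 :=
    ((contDiffAt_deriv hφC).differentiableAt (by simp)).hasDerivAt
  have hcdd : HasDerivAt (deriv c') (deriv (deriv c') (φ 0)) (φ 0) :=
    ((contDiffAt_deriv hc').differentiableAt (by simp)).hasDerivAt
  have hcd : ∀ᶠ t in 𝓝 (φ 0), DifferentiableAt ℝ c' t := by
    have : ∀ᶠ t in 𝓝 (φ 0), ContDiffAt ℝ 1 c' t := (hc'.of_le (by norm_num)).eventually (by simp)
    filter_upwards [this] with t ht using ht.differentiableAt (by simp)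
  have hd1 : deriv c =ᶠ[𝓝 0] fun t => deriv φ t • deriv c' (φ t) := by
    filter_upwards [hJ.mem_nhds h0, hφd.continuousAt.eventually hcd] with t ht htd
    have e1 : c =ᶠ[𝓝 t] fun t => c' (φ t) := Filter.eventuallyEq_of_mem (hJ.mem_nhds ht) hcc
    rw [e1.deriv_eq]
    exact (htd.hasDerivAt.scomp t ((hφ t ht).1.differentiableAt (by simp)).hasDerivAt).deriv
  have hd2 : deriv (deriv c) 0 = deriv φ 0 • (deriv φ 0 • deriv (deriv c') (φ 0))
      + deriv (deriv φ) 0 • deriv c' (φ 0) := by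
    rw [hd1.deriv_eq]
    exact (hφdd.smul (hcdd.scomp 0 hφd)).deriv
  have hv : p.2 = ((deriv φ 0 : ℝ) : ℂ) • deriv c' (φ 0) := by
    rw [← hγv, hd1.self_of_nhds]
    ext i; simp
  have hz : c' (φ 0) = p.1 := by rw [← hcc 0 h0]; exact hγp
  -- The two velocities differ by the positive real factor φ'(0), under which both G and θ* scale by
  -- its square.
  have hps : p = scale ((deriv φ 0 : ℝ) : ℂ) (c' (φ 0), deriv c' (φ 0)) := by
    ext1
    · exact hz.symm
    · exact hv
  have hne : ((deriv φ 0 : ℝ) : ℂ) ≠ 0 := by exact_mod_cast hr.ne'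
  have hst : star ((deriv φ 0 : ℝ) : ℂ) = ((deriv φ 0 : ℝ) : ℂ) := Complex.conj_ofReal _
  -- The second derivative of c' ∘ φ exceeds the rescaled acceleration by φ'' times the velocity of
  -- c', which is φ''/φ' times `p.2`.
  refine ⟨deriv (deriv φ) 0 / deriv φ 0, fun i => ?_⟩
  have e1 := eq1 i
  have e2 := eq2 i
  rw [show e (γ 0) = p.1 from hγp, show deriv (fun t => e (γ t)) 0 = p.2 from hγv] at e1
  have e3 : deriv (deriv c) 0 i = deriv φ 0 * (deriv φ 0 * deriv (deriv c') (φ 0) i)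
      + deriv (deriv φ) 0 * deriv c' (φ 0) i := by
    rw [hd2]; simp
  have e4 : spray (toLocal a b he).L i p =
      ((deriv φ 0 : ℝ) : ℂ) ^ 2 * spray (toLocal a b he).L i (c' (φ 0), deriv c' (φ 0)) := by
    rw [← LocalRanders.isFinslerOn_L.spray_scale hne, ← hps]
  have e5 : thetaStar (toLocal a b he).L i p = ((deriv φ 0 : ℝ) : ℂ) * ((deriv φ 0 : ℝ) : ℂ) *
      thetaStar (toLocal a b he).L i (c' (φ 0), deriv c' (φ 0)) := by
    have := LocalRanders.isFinslerOn_L.thetaStar_scale (L := (toLocal a b he).L) hne i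
      (c' (φ 0), deriv c' (φ 0))
    rw [← hps, hst] at this
    exact this
  have e6 : p.2 i = deriv φ 0 * deriv c' (φ 0) i := by rw [hv]; simp
  rw [e4, e5, e6]
  change deriv (deriv c) 0 i + 2 * spray (toLocal a b he).A i p = thetaStar (toLocal a b he).A i p
    at e1
  change deriv (deriv c') (φ 0) i + _ = _ at e2
  rw [e3] at e1
  push_cast
  field_simp
  linear_combination ((deriv φ 0 : ℝ) : ℂ) ^ 2 * e2 - e1

theorem eq_of_projectivelyRelated (hn : 2 ≤ n) {a : HermitianMetric n M} {b : OneZeroForm n M}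
    (h : GeodesicsReparam a.alpha (randers a b) b.regularDom)
    {e : OpenPartialHomeomorph M (Fin n → ℂ)} (he : e ∈ holCharts n M) {p : Coord n}
    (hp : p ∈ (toLocal a b he).Om) :
    (toLocal a b he).bTheta p = 0 ∧
      (∀ i, spray (toLocal a b he).L i p = spray (toLocal a b he).A i p) ∧
      ∀ i, thetaStar (toLocal a b he).L i p = thetaStar (toLocal a b he).A i p :=
  LocalRanders.eq_of_projective hn (fun _ hq => exists_factor_of_geodesicsReparam h he hq) hp

theorem geodesicsReparam_of_eq {F₁ F₂ : HolTangent n M → ℝ} {R : Set (HolTangent n M)}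
    (h : ∀ e ∈ holCharts n M, ∀ p ∈ localDom R e, ∀ i,
      spray (localL F₁ e) i p = spray (localL F₂ e) i p ∧
      thetaStar (localL F₁ e) i p = thetaStar (localL F₂ e) i p) : GeodesicsReparam F₁ F₂ R := by
  intro γ J _ _ hγ
  refine ⟨id, γ, fun s _ => ⟨contDiffAt_id, by simp⟩, fun s _ => rfl, ?_⟩
  rw [Set.image_id]
  refine ⟨hγ.continuousOn, hγ.contDiffAt, hγ.velocity_mem, fun e he s hs hse i => ?_⟩
  have h1 := h e he _ (hγ.velocity_mem e he s hs hse) i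
  rw [← h1.1, ← h1.2]
  exact hγ.equation e he s hs hse i

theorem projectivelyRelated_of_eq {a : HermitianMetric n M} {b : OneZeroForm n M}
    (h : ∀ e, ∀ he : e ∈ holCharts n M, ∀ p ∈ (toLocal a b he).Om, ∀ i,
      spray (toLocal a b he).L i p = spray (toLocal a b he).A i p ∧
      thetaStar (toLocal a b he).L i p = thetaStar (toLocal a b he).A i p) :
    ProjectivelyRelated a.alpha (randers a b) b.regularDom := by
  have h' : ∀ e ∈ holCharts n M, ∀ p ∈ localDom b.regularDom e, ∀ i,
      spray (localL a.alpha e) i p = spray (localL (randers a b) e) i p ∧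
      thetaStar (localL a.alpha e) i p = thetaStar (localL (randers a b) e) i p := by
    intro e he p hp i
    rw [localDom_regularDom a b he] at hp
    rw [localL_alpha a b he, localL_randers a b he]
    exact ⟨(h e he p hp i).1.symm, (h e he p hp i).2.symm⟩
  exact ⟨geodesicsReparam_of_eq h',
    geodesicsReparam_of_eq fun e he p hp i => ⟨(h' e he p hp i).1.symm, (h' e he p hp i).2.symm⟩⟩

theorem isGeneralizedBerwald_iff {a : HermitianMetric n M} {b : OneZeroForm n M} :
    IsGeneralizedBerwald (randers a b) b.regularDom ↔
      ∀ e, ∀ he : e ∈ holCharts n M, ∀ p ∈ (toLocal a b he).Om, ∀ i k,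
        dEtaBar k (spray (toLocal a b he).L i) p = 0 := by
  refine forall_congr' fun e => forall_congr' fun he => ?_
  rw [localDom_regularDom a b he, localL_randers a b he]

theorem isKahler_randers_iff {a : HermitianMetric n M} {b : OneZeroForm n M} :
    IsKahler (randers a b) b.regularDom ↔
      ∀ e, ∀ he : e ∈ holCharts n M, ∀ p ∈ (toLocal a b he).Om, ∀ i k,
        ∑ j, torsion (toLocal a b he).L i j k p * p.2 j = 0 := by
  refine forall_congr' fun e => forall_congr' fun he => ?_
  rw [localDom_regularDom a b he, localL_randers a b he]

/-- The Kähler condition for the Hermitian metric extends from the set where `β` does not vanish. -/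
theorem isKahler_alpha {a : HermitianMetric n M} {b : OneZeroForm n M}
    (hb : Dense {x : M | b.form x ≠ 0})
    (h : ∀ e, ∀ he : e ∈ holCharts n M, ∀ z ∈ e.target, (toLocal a b he).bAt z ≠ 0 →
      ∀ i j k, (toLocal a b he).chern i j k z = (toLocal a b he).chern i k j z) :
    IsKahler a.alpha (slitBundle n M) := by
  intro e he p hp i k
  rw [localL_alpha a b he]
  set R := toLocal a b he with hR
  have hz : p.1 ∈ R.V := hp.1
  -- Continuity of the inverse matrix is taken from the inverse fundamental tensor of α² on the zero
  -- section.
  have hcont : ∀ j k, ContinuousAt (R.chern i j k) p.1 := fun j k => by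
    have h1 : ∀ m, ContinuousAt (fun z => fundInv R.A m i (z, 0)) p.1 := fun m =>
      ContinuousAt.comp (g := fundInv R.A m i) (f := fun z : Fin n → ℂ => ((z, 0) : Coord n))
        ((LocalRanders.isFinslerOn_A (R := R)).smooth_fundInv (p := (p.1, 0)) hz m i).continuousAt
        (by fun_prop)
    have h2 : ∀ m, ContinuousAt (fun z => wirt (Pi.single k 1) (R.a j m) z) p.1 := fun m =>
      (contDiffAt_wirt (R.smooth_a j m p.1 hz) _).continuousAt
    have h3 : ContinuousAt (fun z => ∑ m, fundInv R.A m i (z, 0) *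
        wirt (Pi.single k 1) (R.a j m) z) p.1 :=
      tendsto_finsetSum _ fun m _ => (h1 m).mul (h2 m)
    refine h3.congr ?_
    filter_upwards [R.isOpen.mem_nhds hz] with z hz'
    have hz2 : ((z, 0) : Coord n) ∈ R.U := hz'
    simp only [LocalRanders.fundInv_A hz2, LocalRanders.chern]
  have key : ∀ j, R.chern i j k p.1 = R.chern i k j p.1 := by
    intro j
    by_contra hne
    -- Nonzero torsion would persist on an open set, which meets the dense set b ≠ 0 where the
    -- torsion vanishes.
    have hev : ∀ᶠ z in 𝓝 p.1, R.chern i j k z - R.chern i k j z ≠ 0 :=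
      ((hcont j k).sub (hcont k j)).eventually_ne (sub_ne_zero.2 hne)
    obtain ⟨O, hO, hOo, hpO⟩ := eventually_nhds_iff.1 (hev.and (e.open_target.mem_nhds hp.1))
    have hopen : IsOpen (e.source ∩ e ⁻¹' O) := e.isOpen_inter_preimage hOo
    obtain ⟨x, ⟨hxs, hxO⟩, hx⟩ := hb.inter_open_nonempty _ hopen
      ⟨e.symm p.1, e.map_target hp.1, by rw [Set.mem_preimage, e.right_inv hp.1]; exact hpO⟩
    refine (hO (e x) hxO).1 (sub_eq_zero.2 (h e he (e x) (e.map_source hxs) (fun h0 => hx ?_) i j k))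
    have h1 : ∀ η, b.form (e.symm (e x)) (tangentVec e (e x) η) = 0 := fun η => by
      rw [b.form_tangentVec]
      have : (fun i => b.coeff e i (e x)) = 0 := h0
      rw [this]; simp [linForm]
    have h2 : b.form (e.symm (e x)) = 0 := by
      ext v
      obtain ⟨η, rfl⟩ := (tangentVec_bijective he (e.map_source hxs)).2 v
      exact h1 η
    rw [e.left_inv hxs] at h2
    exact h2
  refine Finset.sum_eq_zero fun j _ => ?_
  rw [LocalRanders.torsion_A (R := R) hz, key j, sub_self, zero_mul]

end CFinsler

end

/-! ### The two equivalences on the manifold. -/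

noncomputable section

namespace CFinsler

variable {n : ℕ} {M : Type*} [TopologicalSpace M] [ChartedSpace (Fin n → ℂ) M]
  {a : HermitianMetric n M} {b : OneZeroForm n M}

theorem mem_slitBundle_of_mem_Om {e : OpenPartialHomeomorph M (Fin n → ℂ)}
    (he : e ∈ holCharts n M) {p : Coord n} (hp : p ∈ (toLocal a b he).Om) :
    p ∈ localDom (slitBundle n M) e := by
  refine ⟨hp.1, fun h0 => hp.2 ?_⟩
  rw [← beta_tangentPt a b he, OneZeroForm.beta, h0, map_zero]

theorem thetaStar_A_eq_zero_of_isKahler (hK : IsKahler a.alpha (slitBundle n M))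
    {e : OpenPartialHomeomorph M (Fin n → ℂ)} (he : e ∈ holCharts n M) {p : Coord n}
    (hp : p ∈ (toLocal a b he).Om) (k : Fin n) : thetaStar (toLocal a b he).A k p = 0 := by
  refine IsFinslerOn.thetaStar_eq_zero_of_kahler (fun i k => ?_) k
  rw [← localL_alpha a b he]
  exact hK e he p (mem_slitBundle_of_mem_Om he hp) i k

theorem sameSpray_of_eq
    (h : ∀ e, ∀ he : e ∈ holCharts n M, ∀ p ∈ (toLocal a b he).Om, ∀ i,
      spray (toLocal a b he).L i p = spray (toLocal a b he).A i p) :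
    SameSpray a.alpha (randers a b) b.regularDom := by
  intro e he p hp i
  rw [localDom_regularDom a b he] at hp
  rw [localL_alpha a b he, localL_randers a b he]
  exact h e he p hp i

/-- Both sides are equivalent to equality of the sprays and of the functions θ*. Forward, P vanishes
along with b_k θ^{*k}, so both sides of the equation for B are zero; backward, the identity change
of parameter suffices. -/
theorem projectivelyRelated_iff (hn : 2 ≤ n) :
    ProjectivelyRelated a.alpha (randers a b) b.regularDom ↔
      IsGeneralizedBerwald (randers a b) b.regularDom ∧
      ∀ e ∈ holCharts n M, ∀ p ∈ localDom b.regularDom e, ∀ i : Fin n,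
        thetaDiff a.alpha (randers a b) e i p = -randersP a b e p * p.2 i := by
  constructor
  · refine fun h => ⟨isGeneralizedBerwald_iff.2 fun e he p hp =>
      LocalRanders.generalizedBerwald_of_spray_eq
        (fun q hq => (eq_of_projectivelyRelated hn h.1 he hq).2.1) hp, fun e he p hp i => ?_⟩
    rw [localDom_regularDom a b he] at hp
    obtain ⟨h1, -, h2⟩ := eq_of_projectivelyRelated hn h.1 he hp
    rw [thetaDiff, localL_alpha a b he, localL_randers a b he, h2, randersP_eq a b he hp, h1]
    ring
  · rintro ⟨hB, hP⟩
    refine projectivelyRelated_of_eq fun e he p hp i =>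
      ⟨LocalRanders.spray_eq_of_generalizedBerwald hn (isGeneralizedBerwald_iff.1 hB e he) hp i,
        (LocalRanders.thetaStar_eq_of_diff hp fun i => ?_).2 i⟩
    have := hP e he p (by rwa [localDom_regularDom a b he]) i
    rwa [thetaDiff, localL_alpha a b he, localL_randers a b he, randersP_eq a b he hp] at this

/-- The link between the two Kähler conditions is θ* = 0. It passes from α to F̃ through projective
relatedness; in the other direction it feeds the rigidity of the torsion of α, and density of b ≠ 0
is needed only there. -/
theorem isKahler_and_projectivelyRelated_iff (hn : 2 ≤ n) (hb : Dense {x : M | b.form x ≠ 0}) :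
    IsKahler a.alpha (slitBundle n M) ∧ ProjectivelyRelated a.alpha (randers a b) b.regularDom ↔
      IsComplexBerwald (randers a b) b.regularDom := by
  constructor
  · rintro ⟨hK, h⟩
    have hB := ((projectivelyRelated_iff hn).1 h).1
    refine ⟨isKahler_randers_iff.2 fun e he p hp i k => ?_, hB⟩
    refine LocalRanders.isFinslerOn_L.kahler_of_thetaStar_eq_zero
      (isGeneralizedBerwald_iff.1 hB e he) (fun q hq k => ?_) hp i k
    rw [(eq_of_projectivelyRelated hn h.1 he hq).2.2, thetaStar_A_eq_zero_of_isKahler hK he hq]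
  · rintro ⟨hK, hB⟩
    have hB' := isGeneralizedBerwald_iff.1 hB
    have hθ : ∀ e, ∀ he : e ∈ holCharts n M, ∀ p ∈ (toLocal a b he).Om, ∀ k,
        thetaStar (toLocal a b he).L k p = 0 := fun e he p hp k =>
      IsFinslerOn.thetaStar_eq_zero_of_kahler (isKahler_randers_iff.1 hK e he p hp) k
    have hKα : IsKahler a.alpha (slitBundle n M) := isKahler_alpha hb fun e he z hz hbz =>
      LocalRanders.torsion_A_eq_zero hn (hB' e he) (hθ e he) hz hbz
    refine ⟨hKα, projectivelyRelated_of_eq fun e he p hp i =>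
      ⟨LocalRanders.spray_eq_of_generalizedBerwald hn (hB' e he) hp i, ?_⟩⟩
    rw [hθ e he p hp, thetaStar_A_eq_zero_of_isKahler hKα he hp]

end CFinsler

end

theorem theorem4p3 {n : ℕ} (hn : 2 ≤ n) {M : Type*} [TopologicalSpace M]
    [ChartedSpace (Fin n → ℂ) M] [IsManifold 𝓘(ℂ, Fin n → ℂ) ω M] [ConnectedSpace M]
    (a : CFinsler.HermitianMetric n M) (b : CFinsler.OneZeroForm n M)
    (hb : Dense {x : M | b.form x ≠ 0}) :
    -- i)
    (CFinsler.ProjectivelyRelated a.alpha (CFinsler.randers a b) b.regularDom ↔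
      CFinsler.IsGeneralizedBerwald (CFinsler.randers a b) b.regularDom ∧
      ∀ e ∈ CFinsler.holCharts n M, ∀ p ∈ CFinsler.localDom b.regularDom e, ∀ i : Fin n,
        CFinsler.thetaDiff a.alpha (CFinsler.randers a b) e i p
          = -CFinsler.randersP a b e p * p.2 i) ∧
    -- ii)
    (CFinsler.IsKahler a.alpha (CFinsler.slitBundle n M) ∧
        CFinsler.ProjectivelyRelated a.alpha (CFinsler.randers a b) b.regularDom ↔
      CFinsler.IsComplexBerwald (CFinsler.randers a b) b.regularDom) ∧
    -- the projective change in both cases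
    (CFinsler.ProjectivelyRelated a.alpha (CFinsler.randers a b) b.regularDom →
      CFinsler.SameSpray a.alpha (CFinsler.randers a b) b.regularDom) ∧
    (CFinsler.IsComplexBerwald (CFinsler.randers a b) b.regularDom →
      CFinsler.SameSpray a.alpha (CFinsler.randers a b) b.regularDom) :=
  ⟨CFinsler.projectivelyRelated_iff hn, CFinsler.isKahler_and_projectivelyRelated_iff hn hb,
    fun h => CFinsler.sameSpray_of_eq fun _ he _ hp =>
      (CFinsler.eq_of_projectivelyRelated hn h.1 he hp).2.1,
    fun h => CFinsler.sameSpray_of_eq fun e he _ hp =>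
      CFinsler.LocalRanders.spray_eq_of_generalizedBerwald hn
        (CFinsler.isGeneralizedBerwald_iff.1 h.2 e he) hp⟩
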